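/- **Setting.** Let $\mathcal F$ be a smooth foliation of a finite-dimensional smooth Hausdorff manifold $M$ without boundary, with tangent (vertical) bundle $T\mathcal F\subset TM$, and let $g$ be a smooth bundle-like Riemannian metric on $M$ (each distinguished submersion $\pi_i:U_i\to\Sigma_i$ of $\mathcal F$ is a Riemannian submersion for some Riemannian metric on the local quotient $\Sigma_i$). Let $\nabla$ be the Levi-Civita connection of $g$, let $\mathbf V:TM\to T\mathcal F$ and $\mathbf H:TM\to T\mathcal F^\perp$ be the orthogonal projections, and let $\mathring\nabla$ be the adapted connection $$\mathring\nabla_EX=\mathbf V\nabla_E(\mathbf VX)+\mathbf H\nabla_E(\mathbf HX),$$ with torsion $\mathring T(E,G)=\mathring\nabla_EG-\mathring\nabla_GE-[E,G]$ and curvature $\mathring R(E,G)=[\mathring\nabla_E,\mathring\nabla_G]-\mathring\nabla_{[E,G]}$. For $a<b$, a *leafwise geodesic* is a smooth curve $\gamma:[a,b]\to M$ that lies in one leaf of $\mathcal F$, is tangent to it, and satisfies $\mathring\nabla_{\dot\gamma}\dot\gamma=0$. A smooth tangent vector field $X$ of $M$ along $\gamma$ is an *adapted Jacobi field* if $$\mathring\nabla_{\dot\gamma}\mathring\nabla_{\dot\gamma}X-\mathring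 R(\dot\gamma,X)\dot\gamma-\mathring\nabla_{\dot\gamma}\bigl(\mathring T(\dot\gamma,X)\bigr)=0\quad\text{and}\quad \mathring\nabla_{\dot\gamma(a)}X-\mathring T(\dot\gamma(a),X(a))\in T_{\gamma(a)}\mathcal F .$$ Let $\mathcal J(M,\mathcal F,\gamma)$ be the set of these fields. A *leafwise geodesic variation* of $\gamma$ is a smooth map $f:[a,b]\times(-\epsilon,\epsilon)\to M$, for some $\epsilon>0$, such that every curve $f(\cdot,s)$ is a leafwise geodesic and $f(\cdot,0)=\gamma$; its *variation field* is $t\mapsto\partial_sf(t,s)|_{s=0}$. **Proposition.** Let $\gamma:[a,b]\to M$, $a<b$, be a leafwise geodesic. Then: 1. $\mathcal J(M,\mathcal F,\gamma)$ is equal to the set of variation fields of leafwise geodesic variations of $\gamma$. 2. $\mathcal J(M,\mathcal F,\gamma)$ is a linear space, and $$X\mapsto\bigl(X(a),\ \mathring\nabla_{\dot\gamma(a)}X-\mathring T(\dot\gamma(a),X(a))\bigr)$$ is a linear isomorphism of $\mathcal J(M,\mathcal F,\gamma)$ onto $T_{\gamma(a)}M\oplus T_{\gamma(a)}\mathcal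 F$. -/

import Mathlib

open Set Filter Bundle
open scoped Manifold ContDiff Topology

noncomputable section

/-! ### Smooth foliations -/

/-- A smooth foliation of the manifold `M`, with transverse model `E'` and leaf model `E''`, given
by a foliated atlas. A foliated chart is a smooth chart `φ` onto a product `U' ×ˢ U''` of open sets
with `U''` connected. Its distinguished submersion is `π = fst ∘ φ` and the fibres of `π` are its
plaques. Changes of foliated charts are locally of the form `(x', x'') ↦ (h x', g (x', x''))`. -/
structure SmoothFoliation
    (E' : Type*) [NormedAddCommGroup E'] [NormedSpace ℝ E']
    (E'' : Type*) [NormedAddCommGroup E''] [NormedSpace ℝ E'']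
    (E : Type*) [NormedAddCommGroup E] [NormedSpace ℝ E]
    (M : Type*) [TopologicalSpace M] [ChartedSpace E M] where
  /-- The foliated charts. -/
  charts : Set (OpenPartialHomeomorph M (E' × E''))
  contMDiffOn : ∀ φ ∈ charts, ContMDiffOn 𝓘(ℝ, E) 𝓘(ℝ, E' × E'') ∞ φ φ.source
  contMDiffOn_symm : ∀ φ ∈ charts, ContMDiffOn 𝓘(ℝ, E' × E'') 𝓘(ℝ, E) ∞ φ.symm φ.target
  target_eq_prod : ∀ φ ∈ charts, ∃ (U' : Set E') (U'' : Set E''),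
    IsOpen U' ∧ IsOpen U'' ∧ IsPreconnected U'' ∧ φ.target = U' ×ˢ U''
  exists_mem_source : ∀ p : M, ∃ φ ∈ charts, p ∈ φ.source
  compatible : ∀ φ ∈ charts, ∀ ψ ∈ charts, ∀ p ∈ φ.source ∩ ψ.source, ∃ W ∈ 𝓝 p,
    ∀ q ∈ W, ∀ r ∈ W, (φ q).1 = (φ r).1 → (ψ q).1 = (ψ r).1

namespace SmoothFoliation

variable {E' : Type*} [NormedAddCommGroup E'] [NormedSpace ℝ E']
  {E'' : Type*} [NormedAddCommGroup E''] [NormedSpace ℝ E'']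
  {E : Type*} [NormedAddCommGroup E] [NormedSpace ℝ E]
  {M : Type*} [TopologicalSpace M] [ChartedSpace E M]

/-- Two points lie in a common plaque. -/
def SamePlaque (F : SmoothFoliation E' E'' E M) (p q : M) : Prop :=
  ∃ φ ∈ F.charts, p ∈ φ.source ∧ q ∈ φ.source ∧ (φ p).1 = (φ q).1

/-- The leaf through `p`: the points that can be joined to `p` by a finite chain of plaques. -/
def leaf (F : SmoothFoliation E' E'' E M) (p : M) : Set M :=
  {q | Relation.EqvGen F.SamePlaque p q}

/-- The differential at `p` of the distinguished submersion `π = fst ∘ φ` of the chart `φ`. -/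
def submersionDeriv (φ : OpenPartialHomeomorph M (E' × E'')) (p : M) :
    TangentSpace 𝓘(ℝ, E) p →L[ℝ] E' :=
  mfderiv 𝓘(ℝ, E) 𝓘(ℝ, E') (fun q ↦ (φ q).1) p

/-- The space `T_pF` of vertical vectors at `p`: those killed by the differentials of the
distinguished submersions around `p` (these differentials all have the same kernel). -/
def vert (F : SmoothFoliation E' E'' E M) (p : M) : Submodule ℝ (TangentSpace 𝓘(ℝ, E) p) where
  carrier := {v | ∀ φ ∈ F.charts, p ∈ φ.source → submersionDeriv φ p v = 0}
  add_mem' {u v} hu hv φ hφ hp := by rw [map_add, hu φ hφ hp, hv φ hφ hp, add_zero]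
  zero_mem' φ _ _ := map_zero _
  smul_mem' c v hv φ hφ hp := by rw [map_smul, hv φ hφ hp, smul_zero]

end SmoothFoliation

/-! ### Calculus with a linear connection

A linear connection on `M` is handled here as an operator `cov` on vector fields, where
`cov X p v` is the covariant derivative at `p` of the field `X` in the direction `v`. -/

section Connection

variable {E : Type*} [NormedAddCommGroup E] [NormedSpace ℝ E]
  {M : Type*} [TopologicalSpace M] [ChartedSpace E M] [IsManifold 𝓘(ℝ, E) ∞ M]

/-- Operators of the type of a linear connection on `M`. -/
abbrev ConnectionOperator (E : Type*) [NormedAddCommGroup E] [NormedSpace ℝ E]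
    (M : Type*) [TopologicalSpace M] [ChartedSpace E M] : Type _ :=
  (Π p : M, TangentSpace 𝓘(ℝ, E) p) →
    (Π p : M, TangentSpace 𝓘(ℝ, E) p →L[ℝ] TangentSpace 𝓘(ℝ, E) p)

/-- The torsion tensor `T(u, v) = ∇_U V - ∇_V U - [U, V]` at `p`, where `U` and `V` are vector
fields, smooth around `p`, that extend `u` and `v`. -/
def torsionTensor (cov : ConnectionOperator E M) (p : M) (u v : TangentSpace 𝓘(ℝ, E) p) :
    TangentSpace 𝓘(ℝ, E) p :=
  let U : Π q : M, TangentSpace 𝓘(ℝ, E) q := FiberBundle.extend E u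
  let V : Π q : M, TangentSpace 𝓘(ℝ, E) q := FiberBundle.extend E v
  cov V p u - cov U p v - VectorField.mlieBracket 𝓘(ℝ, E) U V p

/-- The curvature tensor `R(u, v) w = ∇_U ∇_V W - ∇_V ∇_U W - ∇_[U, V] W` at `p`, where `U`, `V`
and `W` are vector fields, smooth around `p`, that extend `u`, `v` and `w`. -/
def curvatureTensor (cov : ConnectionOperator E M) (p : M) (u v w : TangentSpace 𝓘(ℝ, E) p) :
    TangentSpace 𝓘(ℝ, E) p :=
  let U : Π q : M, TangentSpace 𝓘(ℝ, E) q := FiberBundle.extend E u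
  let V : Π q : M, TangentSpace 𝓘(ℝ, E) q := FiberBundle.extend E v
  let W : Π q : M, TangentSpace 𝓘(ℝ, E) q := FiberBundle.extend E w
  cov (fun q ↦ cov W q (V q)) p u - cov (fun q ↦ cov W q (U q)) p v
    - cov W p (VectorField.mlieBracket 𝓘(ℝ, E) U V p)

/-- The velocity of a curve `γ` that is defined on the interval `J`. -/
def curveVelocity (J : Set ℝ) (γ : ℝ → M) (t : ℝ) : TangentSpace 𝓘(ℝ, E) (γ t) :=
  mfderivWithin 𝓘(ℝ, ℝ) 𝓘(ℝ, E) γ J t (1 : ℝ)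

/-- The covariant derivative along the curve `γ : J → M` of the vector field `X` along `γ`. If
`(e_i)` is the coordinate frame around `γ t` and `X = ∑ X^i e_i` along `γ`, then it equals
`∑ (X^i)'(t) e_i + ∑ X^i(t) ∇_{γ'(t)} e_i`: the first sum is obtained by differentiating the
components of `X` in the trivialization of `TM` at `γ t`, and the second one is the derivative of
the field that extends `X t` with constant components. -/
def covAlong (cov : ConnectionOperator E M) (J : Set ℝ) (γ : ℝ → M)
    (X : Π t : ℝ, TangentSpace 𝓘(ℝ, E) (γ t)) (t : ℝ) : TangentSpace 𝓘(ℝ, E) (γ t) :=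
  let e := trivializationAt E (TangentSpace 𝓘(ℝ, E) : M → Type _) (γ t)
  e.symm (γ t) (derivWithin (fun s ↦ (e ⟨γ s, X s⟩).2) J t)
    + cov (FiberBundle.extend E (X t)) (γ t) (curveVelocity J γ t)

/-- Extension of a vector field along `γ : [a, b] → M` by zero outside `[a, b]`; only its values
on `[a, b]` matter below. -/
def extendField {a b : ℝ} {γ : ℝ → M} (X : Π t : Icc a b, TangentSpace 𝓘(ℝ, E) (γ t)) (t : ℝ) :
    TangentSpace 𝓘(ℝ, E) (γ t) :=
  open scoped Classical in if h : t ∈ Icc a b then X ⟨t, h⟩ else 0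

/-- `X` is a smooth tangent vector field of `M` along `γ : [a, b] → M`. -/
def IsSmoothFieldAlong {a b : ℝ} {γ : ℝ → M}
    (X : Π t : Icc a b, TangentSpace 𝓘(ℝ, E) (γ t)) : Prop :=
  ContMDiffOn 𝓘(ℝ, ℝ) 𝓘(ℝ, E).tangent ∞
    (fun t ↦ (⟨γ t, extendField X t⟩ : TangentBundle 𝓘(ℝ, E) M)) (Icc a b)

end Connection

/-! ### Bundle-like metrics and the adapted connection -/

section Riemannian

variable {E' : Type*} [NormedAddCommGroup E'] [NormedSpace ℝ E']
  {E'' : Type*} [NormedAddCommGroup E''] [NormedSpace ℝ E'']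
  {E : Type*} [NormedAddCommGroup E] [NormedSpace ℝ E] [FiniteDimensional ℝ E]
  {M : Type*} [TopologicalSpace M] [ChartedSpace E M] [IsManifold 𝓘(ℝ, E) ∞ M]
  [RiemannianBundle (fun p : M ↦ TangentSpace 𝓘(ℝ, E) p)]

/-- The Riemannian metric of `M` is bundle-like for `F`: the local quotient `π(U)` of each
foliated chart carries a Riemannian metric for which the distinguished submersion `π = fst ∘ φ` is
a Riemannian submersion, that is, `dπ` is isometric on horizontal vectors. -/
def SmoothFoliation.IsBundleLike (F : SmoothFoliation E' E'' E M) : Prop :=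
  ∀ φ ∈ F.charts, ∃ g : E' → E' →L[ℝ] E' →L[ℝ] ℝ,
    ContDiffOn ℝ ∞ g (Prod.fst '' φ.target) ∧
    (∀ y ∈ Prod.fst '' φ.target, (∀ u v, g y u v = g y v u) ∧ ∀ u, u ≠ 0 → 0 < g y u u) ∧
    ∀ p ∈ φ.source, ∀ u ∈ (F.vert p)ᗮ, ∀ v ∈ (F.vert p)ᗮ,
      g (φ p).1 (submersionDeriv φ p u) (submersionDeriv φ p v) = inner ℝ u v

/-- `nabla` is the Levi-Civita connection of the Riemannian metric of `M`: the smooth linear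
connection that is metric and torsion-free. -/
structure IsLeviCivita
    (nabla : CovariantDerivative 𝓘(ℝ, E) E (fun p : M ↦ TangentSpace 𝓘(ℝ, E) p)) : Prop where
  smooth : CovariantDerivative.ContMDiffCovariantDerivative nabla ∞
  metric : ∀ (X Y : Π p : M, TangentSpace 𝓘(ℝ, E) p) (p : M) (v : TangentSpace 𝓘(ℝ, E) p),
    MDifferentiableAt 𝓘(ℝ, E) 𝓘(ℝ, E).tangent
      (fun q ↦ (⟨q, X q⟩ : TangentBundle 𝓘(ℝ, E) M)) p →
    MDifferentiableAt 𝓘(ℝ, E) 𝓘(ℝ, E).tangent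
      (fun q ↦ (⟨q, Y q⟩ : TangentBundle 𝓘(ℝ, E) M)) p →
    (mfderiv 𝓘(ℝ, E) 𝓘(ℝ, ℝ) (fun q ↦ (inner ℝ (X q) (Y q) : ℝ)) p v : ℝ) =
      inner ℝ (nabla X p v) (Y p) + inner ℝ (X p) (nabla Y p v)
  torsion_free : ∀ (X Y : Π p : M, TangentSpace 𝓘(ℝ, E) p) (p : M),
    MDifferentiableAt 𝓘(ℝ, E) 𝓘(ℝ, E).tangent
      (fun q ↦ (⟨q, X q⟩ : TangentBundle 𝓘(ℝ, E) M)) p →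
    MDifferentiableAt 𝓘(ℝ, E) 𝓘(ℝ, E).tangent
      (fun q ↦ (⟨q, Y q⟩ : TangentBundle 𝓘(ℝ, E) M)) p →
    nabla Y p (X p) - nabla X p (Y p) = VectorField.mlieBracket 𝓘(ℝ, E) X Y p

/-- The orthogonal projection `𝐕 : T_pM → T_pF`, as an endomorphism of `T_pM`. -/
def SmoothFoliation.vertProj (F : SmoothFoliation E' E'' E M) (p : M) :
    TangentSpace 𝓘(ℝ, E) p →L[ℝ] TangentSpace 𝓘(ℝ, E) p :=
  haveI : FiniteDimensional ℝ (TangentSpace 𝓘(ℝ, E) p) := inferInstanceAs (FiniteDimensional ℝ E)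
  haveI : CompleteSpace (F.vert p) := FiniteDimensional.complete ℝ (F.vert p)
  (F.vert p).starProjection

/-- The orthogonal projection `𝐇` of `T_pM` onto the horizontal space `(T_pF)ᗮ`. -/
def SmoothFoliation.horProj (F : SmoothFoliation E' E'' E M) (p : M) :
    TangentSpace 𝓘(ℝ, E) p →L[ℝ] TangentSpace 𝓘(ℝ, E) p :=
  ContinuousLinearMap.id ℝ _ - F.vertProj p

/-- The adapted connection `X ↦ 𝐕 ∇ (𝐕 X) + 𝐇 ∇ (𝐇 X)`. -/
def SmoothFoliation.adaptedConnection (F : SmoothFoliation E' E'' E M)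
    (nabla : CovariantDerivative 𝓘(ℝ, E) E (fun p : M ↦ TangentSpace 𝓘(ℝ, E) p)) :
    ConnectionOperator E M :=
  fun X p ↦ (F.vertProj p).comp (nabla (fun q ↦ F.vertProj q (X q)) p)
    + (F.horProj p).comp (nabla (fun q ↦ F.horProj q (X q)) p)

end Riemannian

/-! ### Leafwise geodesics, their variations, and adapted Jacobi fields

Here `cov` stands for the adapted connection. -/

namespace SmoothFoliation

variable {E' : Type*} [NormedAddCommGroup E'] [NormedSpace ℝ E']
  {E'' : Type*} [NormedAddCommGroup E''] [NormedSpace ℝ E'']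
  {E : Type*} [NormedAddCommGroup E] [NormedSpace ℝ E]
  {M : Type*} [TopologicalSpace M] [ChartedSpace E M] [IsManifold 𝓘(ℝ, E) ∞ M]

/-- `γ : [a, b] → M` is a leafwise geodesic: a smooth curve in a leaf (so it is tangent to the
leaf) which is a geodesic of `cov`. Values of `γ` outside `[a, b]` are irrelevant. -/
structure IsLeafwiseGeodesic (F : SmoothFoliation E' E'' E M) (cov : ConnectionOperator E M)
    (a b : ℝ) (γ : ℝ → M) : Prop where
  smooth : ContMDiffOn 𝓘(ℝ, ℝ) 𝓘(ℝ, E) ∞ γ (Icc a b)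
  mem_leaf : ∃ p : M, ∀ t ∈ Icc a b, γ t ∈ F.leaf p
  tangent : ∀ t ∈ Icc a b, curveVelocity (E := E) (Icc a b) γ t ∈ F.vert (γ t)
  geodesic : ∀ t ∈ Icc a b, covAlong cov (Icc a b) γ (curveVelocity (Icc a b) γ) t = 0

/-- For a field `X` along `γ : [a, b] → M`, the field `∇_γ' X - T(γ', X)` along `γ`. -/
def jacobiInitial (cov : ConnectionOperator E M) {a b : ℝ} {γ : ℝ → M}
    (X : Π t : Icc a b, TangentSpace 𝓘(ℝ, E) (γ t)) (t : ℝ) : TangentSpace 𝓘(ℝ, E) (γ t) :=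
  covAlong cov (Icc a b) γ (extendField X) t
    - torsionTensor cov (γ t) (curveVelocity (Icc a b) γ t) (extendField X t)

/-- The set of adapted Jacobi fields along `γ : [a, b] → M`: the smooth fields `X` along `γ` with
`∇_γ' ∇_γ' X - R(γ', X) γ' - ∇_γ' (T(γ', X)) = 0` on `[a, b]` and with
`∇_γ'(a) X - T(γ'(a), X(a))` vertical. -/
def adaptedJacobiFields (F : SmoothFoliation E' E'' E M) (cov : ConnectionOperator E M)
    (a b : ℝ) (γ : ℝ → M) : Set (Π t : Icc a b, TangentSpace 𝓘(ℝ, E) (γ t)) :=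
  {X | IsSmoothFieldAlong X ∧
    (∀ t ∈ Icc a b,
      covAlong cov (Icc a b) γ (covAlong cov (Icc a b) γ (extendField X)) t
        - curvatureTensor cov (γ t) (curveVelocity (Icc a b) γ t) (extendField X t)
            (curveVelocity (Icc a b) γ t)
        - covAlong cov (Icc a b) γ
            (fun s ↦ torsionTensor cov (γ s) (curveVelocity (Icc a b) γ s) (extendField X s)) t
        = 0) ∧
    jacobiInitial cov X a ∈ F.vert (γ a)}

/-- `f : [a, b] × (-ε, ε) → M` is a leafwise geodesic variation of `γ : [a, b] → M`. -/
structure IsLeafwiseGeodesicVariation (F : SmoothFoliation E' E'' E M)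
    (cov : ConnectionOperator E M) (a b : ℝ) (γ : ℝ → M) (ε : ℝ) (f : ℝ × ℝ → M) : Prop where
  smooth : ContMDiffOn 𝓘(ℝ, ℝ × ℝ) 𝓘(ℝ, E) ∞ f (Icc a b ×ˢ Ioo (-ε) ε)
  leafwise : ∀ s ∈ Ioo (-ε) ε, F.IsLeafwiseGeodesic cov a b (fun t ↦ f (t, s))
  eq_curve : ∀ t ∈ Icc a b, f (t, 0) = γ t

/-- `X` is the variation field `t ↦ ∂_s f(t, s)` at `s = 0` of the variation `f` of `γ`. The
equality is stated in the tangent bundle, where `(γ t, X t)` and `(f(t, 0), ∂_s f(t, 0))` live. -/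
def IsVariationField {a b : ℝ} {γ : ℝ → M} (f : ℝ × ℝ → M)
    (X : Π t : Icc a b, TangentSpace 𝓘(ℝ, E) (γ t)) : Prop :=
  ∀ t : Icc a b, (⟨γ t, X t⟩ : TangentBundle 𝓘(ℝ, E) M) =
    ⟨f (t, 0), mfderiv 𝓘(ℝ, ℝ) 𝓘(ℝ, E) (fun s : ℝ ↦ f (t, s)) 0 (1 : ℝ)⟩

end SmoothFoliation

end

/-! Write `∇` for the adapted connection, `P` for the vertical projection, `f` for a variation of
`γ` and `X` for its variation field. Torsion is exactly what separates `∇_t ∂_s f` from `∇_s ∂_t f`,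
so the field `Z = ∇_γ' X - T(γ', X)`, called the momentum below, is `∇_s ∂_t f` at `s = 0`. In terms
of `Z` the Jacobi equation reads `∇_t Z = R(γ', X) γ'`. When the curves of `f` are geodesics, this
is the commutation rule for `∇_t` and `∇_s` applied to `∂_t f`, because `∇_s ∇_t ∂_t f = 0`
(`jacobi_of_geodesic_variation`).

The foliation enters through the identity `∇P = 0`. It shows that `Z` is vertical if `∂_t f` is
vertical for every `s`, and that a geodesic with vertical initial velocity stays vertical
(`curveVelocity_mem_vert`). A vertical curve has locally constant transverse coordinates, hence
stays in one leaf. Leafwise geodesics are therefore governed by their initial states alone.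

Conversely, given `u` and a vertical `w` at `γ a`, choose a curve of vertical initial velocities
whose first-order data at `s = 0` are `u` and `w`, and follow the geodesics over all of `[a, b]`.
The variation field is a Jacobi field with initial data `(u, w)` (`exists_variationField`). On the
other hand `(X, Z)` solves a linear first-order system, so the initial data determine a Jacobi field
(`eq_zero_of_jacobiOperator_eq_zero`). Both claims follow: the initial data map is bijective, and
every Jacobi field equals the variation field with the same data. Existence of Jacobi fields thus
comes from geodesics and not from a linear existence theorem.

The computations take place in charts, through Christoffel symbols (`HasChristoffel`). Two analytic
points remain. Smoothness of a variation in `s` requires smooth dependence of a flow on its initial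
value, proved with the implicit function theorem in `C([0, 1], F)`. Passage from a chart to the
whole of `[a, b]` always uses that a locally constant property on an interval is constant
(`forall_mem_Icc_of_eventually_iff`): this serves for vanishing, for verticality, for staying in a
leaf and for continuation of a family of geodesics. -/

set_option linter.unusedSectionVars false
set_option maxSynthPendingDepth 3

/-! ### Superposition operators and primitives on spaces of continuous functions. -/

noncomputable section

section SmoothDependence

universe u

variable {K : Type*} [TopologicalSpace K] [CompactSpace K]
  {F F' : Type u} [NormedAddCommGroup F] [NormedSpace ℝ F]
  [NormedAddCommGroup F'] [NormedSpace ℝ F']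

/-- The pointwise application of a continuous bilinear map to two continuous functions. -/
def ContinuousMap.bilinear (K : Type*) [TopologicalSpace K] [CompactSpace K]
    {A F F' : Type u} [NormedAddCommGroup A] [NormedSpace ℝ A] [NormedAddCommGroup F]
    [NormedSpace ℝ F] [NormedAddCommGroup F'] [NormedSpace ℝ F'] (B : A →L[ℝ] F →L[ℝ] F') :
    C(K, A) →L[ℝ] C(K, F) →L[ℝ] C(K, F') :=
  LinearMap.mkContinuous₂
    (LinearMap.mk₂ ℝ (fun (f : C(K, A)) (h : C(K, F)) ↦
      (⟨fun t ↦ B (f t) (h t), (B.continuous.comp f.continuous).clm_apply h.continuous⟩ : C(K, F')))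
      (fun f g h ↦ by ext t; simp) (fun c f h ↦ by ext t; simp)
      (fun f h k ↦ by ext t; simp) (fun c f h ↦ by ext t; simp))
    ‖B‖ (fun f h ↦ by
      rw [ContinuousMap.norm_le _
        (mul_nonneg (mul_nonneg B.opNorm_nonneg (norm_nonneg _)) (norm_nonneg _))]
      intro t
      refine (B.le_opNorm₂ (f t) (h t)).trans ?_
      exact mul_le_mul (mul_le_mul_of_nonneg_left (f.norm_coe_le_norm t) B.opNorm_nonneg)
        (h.norm_coe_le_norm t) (norm_nonneg _) (mul_nonneg B.opNorm_nonneg (norm_nonneg _)))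

instance : NormedAddCommGroup C(K, F →L[ℝ] F') := ContinuousMap.instNormedAddCommGroup

instance : NormedSpace ℝ C(K, F →L[ℝ] F') := ContinuousMap.normedSpace

/-- Pointwise application of a continuous family of continuous linear maps. -/
def ContinuousMap.clmApply (K : Type*) [TopologicalSpace K] [CompactSpace K]
    (F F' : Type u) [NormedAddCommGroup F] [NormedSpace ℝ F]
    [NormedAddCommGroup F'] [NormedSpace ℝ F'] :
    C(K, F →L[ℝ] F') →L[ℝ] C(K, F) →L[ℝ] C(K, F') :=
  ContinuousMap.bilinear K (ContinuousLinearMap.id ℝ (F →L[ℝ] F'))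

/-- The superposition operator `u ↦ G ∘ u` has the expected derivative. -/
lemma ContinuousMap.hasFDerivAt_comp_left {G : F → F'} (hG : ContDiff ℝ 1 G)
    (u : C(K, F)) :
    HasFDerivAt (fun u : C(K, F) ↦ (⟨G, hG.continuous⟩ : C(F, F')).comp u)
      (ContinuousMap.clmApply K F F'
        ((⟨fderiv ℝ G, hG.continuous_fderiv one_ne_zero⟩ : C(F, F →L[ℝ] F')).comp u)) u := by
  rw [hasFDerivAt_iff_isLittleO_nhds_zero, Asymptotics.isLittleO_iff]
  intro c hc
  -- On the compact range of `u` the continuity of `fderiv ℝ G` is uniform, so one `δ` makes the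
  -- mean value estimate hold for all `t` at once.
  have hcpt : IsCompact (range u) := isCompact_range u.continuous
  have hunif := hcpt.uniformContinuousAt_of_continuousAt (fderiv ℝ G)
    (fun a _ ↦ (hG.continuous_fderiv one_ne_zero).continuousAt) (Metric.dist_mem_uniformity hc)
  obtain ⟨δ, hδ, hδ'⟩ := Metric.mem_uniformity_dist.1 hunif
  filter_upwards [Metric.ball_mem_nhds (0 : C(K, F)) hδ] with h hh
  rw [mem_ball_zero_iff] at hh
  rw [ContinuousMap.norm_le _ (by positivity)]
  intro t
  have hht : ‖h t‖ < δ := (h.norm_coe_le_norm t).trans_lt hh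
  have key := (convex_ball (u t) δ).norm_image_sub_le_of_norm_hasFDerivWithin_le'
    (f := G) (f' := fun y ↦ fderiv ℝ G y) (φ := fderiv ℝ G (u t)) (C := c) (x := u t)
    (y := u t + h t)
    (fun y _ ↦ ((hG.differentiable one_ne_zero) y).hasFDerivAt.hasFDerivWithinAt)
    (fun y hy ↦ by
      have h1 := hδ' (show dist (u t) y < δ by rw [dist_comm]; exact hy) (mem_range_self t)
      have h2 : dist (fderiv ℝ G (u t)) (fderiv ℝ G y) < c := h1
      rw [dist_comm, dist_eq_norm] at h2
      exact h2.le)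
    (Metric.mem_ball_self hδ) (by simpa using hht)
  rw [add_sub_cancel_left] at key
  exact key.trans (mul_le_mul_of_nonneg_left (h.norm_coe_le_norm t) hc.le)

/-- Induction on `n`: the derivative of the superposition operator of `G` is the superposition
operator of `fderiv ℝ G` followed by a fixed continuous linear map. The target space changes from
`F'` to `F →L[ℝ] F'`, hence the quantification over `F'` inside the induction. -/
lemma ContinuousMap.contDiff_nat_comp_left (n : ℕ) :
    ∀ {F' : Type u} [NormedAddCommGroup F'] [NormedSpace ℝ F'] {G : F → F'}
      (hG : ContDiff ℝ n G),
      ContDiff ℝ n (fun u : C(K, F) ↦ (⟨G, hG.continuous⟩ : C(F, F')).comp u) := by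
  induction n with
  | zero =>
    intro F' _ _ G hG
    have : Continuous (fun u : C(K, F) ↦ (⟨G, hG.continuous⟩ : C(F, F')).comp u) :=
      ContinuousMap.continuous_postcomp _
    exact contDiff_zero.2 this
  | succ n ih =>
    intro F' _ _ G hG
    have h1 : ContDiff ℝ 1 G := hG.of_le (by exact_mod_cast Nat.le_add_left 1 n)
    have h2 : ContDiff ℝ n (fderiv ℝ G) := hG.fderiv_right (by norm_cast)
    push_cast
    rw [contDiff_succ_iff_hasFDerivAt]
    exact ⟨_, (ContinuousMap.clmApply K F F').contDiff.comp (ih h2),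
      fun u ↦ ContinuousMap.hasFDerivAt_comp_left h1 u⟩

/-- The superposition operator of a smooth map is smooth. -/
lemma ContinuousMap.contDiff_comp_left {G : F → F'} (hG : ContDiff ℝ ∞ G) :
    ContDiff ℝ ∞ (fun u : C(K, F) ↦ (⟨G, hG.continuous⟩ : C(F, F')).comp u) := by
  rw [contDiff_infty]
  exact fun n ↦ ContinuousMap.contDiff_nat_comp_left n (contDiff_infty.1 hG n)

/-- The primitive that vanishes at `0`, as an operator on `C([0, 1], F)`. -/
def ContinuousMap.primitive (F : Type u) [NormedAddCommGroup F] [NormedSpace ℝ F] :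
    C(unitInterval, F) →L[ℝ] C(unitInterval, F) :=
  LinearMap.mkContinuous
    -- The projection `projIcc` extends `u` to the line by constants, so that it can be integrated
    -- there.
    { toFun := fun u ↦ ⟨fun τ ↦ ∫ s in (0 : ℝ)..τ, u (projIcc 0 1 zero_le_one s), by
        have h : Continuous fun s : ℝ ↦ u (projIcc 0 1 zero_le_one s) :=
          u.continuous.comp continuous_projIcc
        exact (intervalIntegral.continuous_primitive
          (fun a b ↦ h.intervalIntegrable a b) 0).comp continuous_subtype_val⟩
      map_add' := fun u v ↦ by
        ext τ
        have h (u : C(unitInterval, F)) : Continuous fun s : ℝ ↦ u (projIcc 0 1 zero_le_one s) :=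
          u.continuous.comp continuous_projIcc
        exact intervalIntegral.integral_add ((h u).intervalIntegrable _ _)
          ((h v).intervalIntegrable _ _)
      map_smul' := fun c u ↦ by
        ext τ
        exact intervalIntegral.integral_smul c _ }
    1 (fun u ↦ by
      rw [one_mul, ContinuousMap.norm_le _ (norm_nonneg _)]
      intro τ
      refine (intervalIntegral.norm_integral_le_of_norm_le_const
        (C := ‖u‖) fun s _ ↦ u.norm_coe_le_norm _).trans ?_
      rw [sub_zero, abs_of_nonneg τ.2.1]
      exact mul_le_of_le_one_right (norm_nonneg _) τ.2.2)

lemma ContinuousMap.primitive_apply (u : C(unitInterval, F)) (τ : unitInterval) :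
    ContinuousMap.primitive F u τ = ∫ s in (0 : ℝ)..τ, u (projIcc 0 1 zero_le_one s) := rfl

/-- Constant functions, as a continuous linear map. -/
def ContinuousMap.constCLM (K : Type*) [TopologicalSpace K] [CompactSpace K]
    (F : Type u) [NormedAddCommGroup F] [NormedSpace ℝ F] : F →L[ℝ] C(K, F) :=
  LinearMap.mkContinuous
    { toFun := fun z ↦ ContinuousMap.const K z
      map_add' := fun _ _ ↦ rfl
      map_smul' := fun _ _ ↦ rfl }
    1 (fun z ↦ by
      rw [one_mul, ContinuousMap.norm_le _ (norm_nonneg _)]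
      exact fun _ ↦ le_rfl)

lemma ContinuousMap.constCLM_apply (z : F) (t : K) :
    ContinuousMap.constCLM K F z t = z := rfl

end SmoothDependence
end

/-! ### The smooth local flow of a smooth vector field. -/

noncomputable section

section SmoothDependence

universe u

/-- The implicit function of a smooth equation is smooth at all nearby points. -/
lemma exists_contDiffAt_implicit {A C : Type*} [NormedAddCommGroup A] [NormedSpace ℝ A]
    [CompleteSpace A] [NormedAddCommGroup C] [NormedSpace ℝ C] [CompleteSpace C]
    {H : A × C → C} (hH : ContDiff ℝ ∞ H) {p : A × C} (hp : H p = 0)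
    (hinv : (fderiv ℝ H p ∘L .inr ℝ A C).IsInvertible) :
    ∃ ψ : A → C, (∀ᶠ q in 𝓝 p.1, ContDiffAt ℝ ∞ ψ q) ∧ ∀ᶠ v in 𝓝 p, H v = 0 ↔ ψ v.1 = v.2 := by
  have hne : (∞ : WithTop ℕ∞) ≠ 0 := by simp
  have hc (v : A × C) : ContDiffAt ℝ ∞ H v := hH.contDiffAt
  set ψ := (hc p).implicitFunction hne hinv with hψ
  have hψ1 : ContDiffAt ℝ 1 ψ p.1 :=
    ((hc p).contDiffAt_implicitFunction hne hinv).of_le (by exact_mod_cast le_top)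
  have hψp : ψ p.1 = p.2 := (hc p).implicitFunction_apply_self hne hinv
  have hiff : ∀ᶠ v in 𝓝 p, H v = 0 ↔ ψ v.1 = v.2 := by
    simpa only [hp] using (hc p).eventually_apply_eq_iff_implicitFunction hne hinv
  have hsol : ∀ᶠ q in 𝓝 p.1, H (q, ψ q) = 0 := by
    simpa only [hp] using (hc p).eventually_apply_implicitFunction hne hinv
  refine ⟨ψ, ?_, hiff⟩
  have hgraph : Tendsto (fun q ↦ (q, ψ q)) (𝓝 p.1) (𝓝 p) := by
    have : Tendsto (fun q ↦ (q, ψ q)) (𝓝 p.1) (𝓝 (p.1, ψ p.1)) :=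
      (continuousAt_id.prodMk hψ1.continuousAt)
    rwa [hψp] at this
  -- Smoothness of order `∞` at the single point `p.1` provides, for each finite order, a
  -- neighbourhood that may depend on the order. Invertibility is an open condition, so the implicit
  -- function theorem applies again at each nearby point of the graph, and its local uniqueness
  -- identifies the new implicit function with `ψ`.
  have hopen : ∀ᶠ v in 𝓝 p, (fderiv ℝ H v ∘L .inr ℝ A C).IsInvertible := by
    have hcont : Continuous fun v ↦ fderiv ℝ H v ∘L .inr ℝ A C :=
      (hH.continuous_fderiv hne).clm_comp continuous_const
    obtain ⟨e, he⟩ := hinv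
    have := (e.nhds)
    rw [he] at this
    filter_upwards [hcont.continuousAt.preimage_mem_nhds this] with v hv
    exact hv
  filter_upwards [hsol.eventually_nhds, hgraph.eventually hopen,
    hψ1.eventually (by simp)] with q hq hqinv hqψ
  have hq0 : H (q, ψ q) = 0 := hq.self_of_nhds
  have hloc := (hc (q, ψ q)).eventually_apply_eq_iff_implicitFunction hne hqinv
  have hgraph' : Tendsto (fun q ↦ (q, ψ q)) (𝓝 q) (𝓝 (q, ψ q)) :=
    (continuousAt_id.prodMk hqψ.continuousAt)
  refine ((hc (q, ψ q)).contDiffAt_implicitFunction hne hqinv).congr_of_eventuallyEq ?_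
  filter_upwards [hq, hgraph'.eventually hloc] with q' h1 h2
  exact (h2.1 (by rw [h1, hq0])).symm

variable {F : Type u} [NormedAddCommGroup F] [NormedSpace ℝ F]

/-- The defect of a curve `z + u` in the integral equation of `x' = t G(x)`, `x(0) = z`. -/
def picardDefect {G : F → F} (hG : Continuous G) (p : (ℝ × F) × C(unitInterval, F)) :
    C(unitInterval, F) :=
  p.2 - p.1.1 • ContinuousMap.primitive F
    ((⟨G, hG⟩ : C(F, F)).comp (ContinuousMap.constCLM unitInterval F p.1.2 + p.2))

lemma contDiff_picardDefect {G : F → F} (hG : ContDiff ℝ ∞ G) :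
    ContDiff ℝ ∞ (picardDefect hG.continuous) := by
  refine contDiff_snd.sub (ContDiff.smul (contDiff_fst.comp contDiff_fst)
    ((ContinuousMap.primitive F).contDiff.comp
      ((ContinuousMap.contDiff_comp_left hG).comp
        (((ContinuousMap.constCLM unitInterval F).contDiff.comp
          (contDiff_snd.comp contDiff_fst)).add contDiff_snd))))

/-- After rescaling to `[0, 1]`, time is a parameter that multiplies the integral term. At time `0`
that term disappears and the defect is `u ↦ u`, so the implicit function theorem applies at every
`z` without any smallness condition on `G`. -/
lemma fderiv_picardDefect_comp_inr {G : F → F} (hG : ContDiff ℝ ∞ G) (z : F) :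
    fderiv ℝ (picardDefect hG.continuous) ((0, z), 0) ∘L .inr ℝ (ℝ × F) C(unitInterval, F) =
      ContinuousLinearMap.id ℝ _ := by
  have h1 : HasFDerivAt (fun u : C(unitInterval, F) ↦ (((0 : ℝ), z), u))
      (.inr ℝ (ℝ × F) C(unitInterval, F)) 0 := hasFDerivAt_prodMk_right _ _
  have h2 := (((contDiff_picardDefect hG).differentiable (by simp)) ((0, z), 0)).hasFDerivAt.comp
    (0 : C(unitInterval, F)) h1
  have h3 : (picardDefect hG.continuous) ∘ (fun u : C(unitInterval, F) ↦ (((0 : ℝ), z), u)) =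
      id := by
    ext1 u
    simp [picardDefect]
  rw [h3] at h2
  exact h2.unique (hasFDerivAt_id _)

/-- A solution of `x' = G(x)`, reparametrized, satisfies the integral equation. -/
lemma picardDefect_eq_zero {G : F → F} [CompleteSpace F] (hG : Continuous G) {α : ℝ → F} {ε : ℝ}
    (hα : ∀ t ∈ Ioo (-ε) ε, HasDerivAt α (G (α t)) t) {t : ℝ} (ht : t ∈ Ioo (-ε) ε)
    (u : C(unitInterval, F)) (hu : ∀ τ : unitInterval, u τ = α (t * τ) - α 0) :
    picardDefect hG ((t, α 0), u) = 0 := by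
  have hmem (s : ℝ) (hs : s ∈ Icc (0 : ℝ) 1) : t * s ∈ Ioo (-ε) ε := by
    have h1 : |t * s| ≤ |t| := by
      rw [abs_mul, abs_of_nonneg hs.1]; exact mul_le_of_le_one_right (abs_nonneg _) hs.2
    exact abs_lt.1 (h1.trans_lt (abs_lt.2 ht))
  have hd (s : ℝ) (hs : s ∈ Icc (0 : ℝ) 1) :
      HasDerivAt (fun s ↦ α (t * s)) (t • G (α (t * s))) s := by
    have := (hα _ (hmem s hs)).scomp s ((hasDerivAt_id s).const_mul t)
    simpa [Function.comp_def] using this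
  ext τ
  have hsub : uIcc (0 : ℝ) τ ⊆ Icc 0 1 := by
    rw [uIcc_of_le τ.2.1]; exact Icc_subset_Icc_right τ.2.2
  have hcont : ContinuousOn (fun s ↦ t • G (α (t * s))) (uIcc (0 : ℝ) τ) := fun s hs ↦
    ((hG.continuousAt.comp (hd s (hsub hs)).continuousAt).const_smul t).continuousWithinAt
  have hftc := intervalIntegral.integral_eq_sub_of_hasDerivAt
    (fun s hs ↦ hd s (hsub hs)) hcont.intervalIntegrable
  rw [intervalIntegral.integral_smul] at hftc
  have hint : ContinuousMap.primitive F ((⟨G, hG⟩ : C(F, F)).comp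
      (ContinuousMap.constCLM unitInterval F (α 0) + u)) τ = ∫ s in (0 : ℝ)..τ, G (α (t * s)) := by
    rw [ContinuousMap.primitive_apply]
    refine intervalIntegral.integral_congr fun s hs ↦ ?_
    have hs' := hsub hs
    simp only [ContinuousMap.comp_apply, ContinuousMap.coe_mk, ContinuousMap.add_apply,
      ContinuousMap.constCLM_apply, hu, add_sub_cancel, projIcc_of_mem zero_le_one hs']
  change u τ - t • _ = 0
  rw [hint, hftc, hu, mul_zero, sub_self]

/-- A smooth vector field has a smooth local flow. -/
theorem exists_contDiffOn_flow_of_contDiff [CompleteSpace F] {G : F → F} (hG : ContDiff ℝ ∞ G)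
    (z₀ : F) : ∃ δ > 0, ∃ Φ : ℝ × F → F,
      (∀ q ∈ Ioo (-δ) δ ×ˢ Metric.ball z₀ δ, ContDiffAt ℝ ∞ Φ q) ∧
      ∀ z ∈ Metric.ball z₀ δ, Φ (0, z) = z ∧
        ∀ t ∈ Ioo (-δ) δ, HasDerivAt (fun t ↦ Φ (t, z)) (G (Φ (t, z))) t := by
  obtain ⟨ε, hε, a, r, L, K, hr, hpl⟩ :=
    IsPicardLindelof.of_contDiffAt_one (x₀ := z₀) (hG.contDiffAt.of_le (by exact_mod_cast le_top))
  obtain ⟨α, hα, hαc⟩ := (hpl 0).exists_forall_mem_closedBall_eq_hasDerivWithinAt_continuousOn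
  simp only [zero_sub, zero_add] at hα hαc
  have hαd (z) (hz : z ∈ Metric.closedBall z₀ r) (t) (ht : t ∈ Ioo (-ε) ε) :
      HasDerivAt (fun t ↦ α (z, t)) (G (α (z, t))) t :=
    ((hα z hz).2 t (Ioo_subset_Icc_self ht)).hasDerivAt (Icc_mem_nhds ht.1 ht.2)
  obtain ⟨ψ, hψ, hiff⟩ := exists_contDiffAt_implicit (contDiff_picardDefect hG)
    (p := ((0, z₀), 0)) (by simp [picardDefect])
    (by
      rw [fderiv_picardDefect_comp_inr hG]
      exact ⟨ContinuousLinearEquiv.refl ℝ _, rfl⟩)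
  obtain ⟨η, hη, hiff⟩ := Metric.eventually_nhds_iff_ball.1 hiff
  have hz₀r : z₀ ∈ Metric.closedBall z₀ r := Metric.mem_closedBall_self r.2
  have hα0 : ContinuousAt α (z₀, 0) := hαc.continuousAt
    (prod_mem_nhds (Metric.closedBall_mem_nhds _ hr) (Icc_mem_nhds (by linarith) hε))
  have hα1 : ContinuousAt (fun q : F × ℝ ↦ α q - q.1) (z₀, 0) := hα0.sub continuousAt_fst
  -- The implicit function is characterized only in the ball of radius `η`, so trajectories must be
  -- shown to stay close to their initial points. The margin `η / 2` compensates for the non-strict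
  -- bound that pointwise estimates give for a sup norm.
  have hclose : ∀ᶠ q : F × ℝ in 𝓝 (z₀, 0), ‖α q - q.1‖ < η / 2 := by
    have h0 : α (z₀, 0) - z₀ = 0 := sub_eq_zero.2 (hα z₀ hz₀r).1
    have := hα1.norm
    simp only [ContinuousAt, h0, norm_zero] at this
    exact this.eventually (gt_mem_nhds (by positivity))
  obtain ⟨δ₁, hδ₁, hclose⟩ := Metric.eventually_nhds_iff_ball.1 hclose
  obtain ⟨δ₂, hδ₂, hψ⟩ := Metric.eventually_nhds_iff_ball.1 hψ
  set δ := min (min δ₁ δ₂) (min (min ε r) η) with hδ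
  have hδ0 : 0 < δ := by
    simp only [hδ, lt_min_iff]; exact ⟨⟨hδ₁, hδ₂⟩, ⟨hε, hr⟩, hη⟩
  have hd1 : δ ≤ δ₁ := (min_le_left _ _).trans (min_le_left _ _)
  have hd2 : δ ≤ δ₂ := (min_le_left _ _).trans (min_le_right _ _)
  have hdε : δ ≤ ε := (min_le_right _ _).trans ((min_le_left _ _).trans (min_le_left _ _))
  have hdr : δ ≤ r := (min_le_right _ _).trans ((min_le_left _ _).trans (min_le_right _ _))
  have hdη : δ ≤ η := (min_le_right _ _).trans (min_le_right _ _)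
  have hprod (t : ℝ) (ht : t ∈ Ioo (-δ) δ) (z : F) (hz : z ∈ Metric.ball z₀ δ) (ρ : ℝ)
      (hρ : δ ≤ ρ) : (t, z) ∈ Metric.ball ((0 : ℝ), z₀) ρ := by
    rw [← ball_prod_same, mem_prod]
    exact ⟨by rw [mem_ball_zero_iff]; exact (abs_lt.2 ht).trans_le hρ,
      Metric.ball_subset_ball hρ hz⟩
  have hzr (z : F) (hz : z ∈ Metric.ball z₀ δ) : z ∈ Metric.closedBall z₀ r :=
    Metric.ball_subset_closedBall (Metric.ball_subset_ball hdr hz)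
  have hformula (t : ℝ) (ht : t ∈ Ioo (-δ) δ) (z : F) (hz : z ∈ Metric.ball z₀ δ) :
      α (z, t) = z + ψ (t, z) 1 := by
    have hmem (τ : unitInterval) : t * τ ∈ Ioo (-δ) δ := by
      have h1 : |t * τ| ≤ |t| := by
        rw [abs_mul, abs_of_nonneg τ.2.1]; exact mul_le_of_le_one_right (abs_nonneg _) τ.2.2
      exact abs_lt.1 (h1.trans_lt (abs_lt.2 ht))
    have hz0 : α (z, 0) = z := (hα z (hzr z hz)).1
    -- The trajectory of `z` up to time `t`, rescaled to `[0, 1]` and measured from its initial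
    -- point. It solves the integral equation, so it equals `ψ (t, z)`; evaluation at `1` recovers
    -- the flow at time `t`.
    let u : C(unitInterval, F) := ⟨fun τ ↦ α (z, t * τ) - α (z, 0), by
      refine Continuous.sub (continuous_iff_continuousAt.2 fun τ ↦ ?_) continuous_const
      have := hαd z (hzr z hz) (t * τ)
        ⟨(neg_le_neg hdε).trans_lt (hmem τ).1, (hmem τ).2.trans_le hdε⟩
      exact ContinuousAt.comp (f := fun τ : unitInterval ↦ t * (τ : ℝ)) this.continuousAt
        (by fun_prop)⟩
    have hu : ‖u‖ < η := by
      refine lt_of_le_of_lt ?_ (half_lt_self hη)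
      rw [ContinuousMap.norm_le _ (by positivity)]
      intro τ
      have : (z, t * (τ : ℝ)) ∈ Metric.ball (z₀, (0 : ℝ)) δ₁ := by
        rw [← ball_prod_same, mem_prod]
        exact ⟨Metric.ball_subset_ball hd1 hz, by
          rw [mem_ball_zero_iff]; exact (abs_lt.2 (hmem τ)).trans_le hd1⟩
      have := hclose _ this
      change ‖α (z, t * τ) - α (z, 0)‖ ≤ _
      rw [hz0]
      exact this.le
    have hdef : picardDefect hG.continuous ((t, α (z, 0)), u) = 0 :=
      picardDefect_eq_zero hG.continuous (α := fun t ↦ α (z, t)) (ε := ε)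
        (hαd z (hzr z hz)) ⟨(neg_le_neg hdε).trans_lt ht.1, ht.2.trans_le hdε⟩ u (fun _ ↦ rfl)
    rw [hz0] at hdef
    have hball : ((t, z), u) ∈ Metric.ball (((0 : ℝ), z₀), (0 : C(unitInterval, F))) η := by
      rw [← ball_prod_same, mem_prod]
      exact ⟨hprod t ht z hz η hdη, by rwa [mem_ball_zero_iff]⟩
    have hψu : ψ (t, z) = u := (hiff _ hball).1 hdef
    rw [hψu]
    change _ = z + (α (z, t * 1) - α (z, 0))
    rw [hz0, mul_one, add_sub_cancel]
  refine ⟨δ, hδ0, fun q ↦ α (q.2, q.1), ?_, ?_⟩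
  · rintro ⟨t, z⟩ ⟨ht, hz⟩
    have hev : ContDiffAt ℝ ∞ (fun u : C(unitInterval, F) ↦ u 1) (ψ (t, z)) :=
      (ContinuousMap.evalCLM ℝ (M := F) (1 : unitInterval)).contDiff.contDiffAt
    have h1 : ContDiffAt ℝ ∞ (fun q : ℝ × F ↦ q.2 + ψ q 1) (t, z) :=
      contDiffAt_snd.add (hev.comp _ (hψ _ (hprod t ht z hz δ₂ hd2)))
    refine h1.congr_of_eventuallyEq ?_
    filter_upwards [prod_mem_nhds (isOpen_Ioo.mem_nhds ht) (Metric.isOpen_ball.mem_nhds hz)]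
      with q hq
    exact hformula q.1 hq.1 q.2 hq.2
  · intro z hz
    exact ⟨(hα z (hzr z hz)).1, fun t ht ↦
      hαd z (hzr z hz) t ⟨(neg_le_neg hdε).trans_lt ht.1, ht.2.trans_le hdε⟩⟩

/-- A vector field that is smooth on a neighbourhood `Ω` of `z₀` has a smooth local flow around
`z₀`, with values in `Ω`. -/
theorem exists_contDiffOn_flow [FiniteDimensional ℝ F] {G : F → F} {Ω : Set F} {z₀ : F}
    (hΩ : Ω ∈ 𝓝 z₀) (hG : ContDiffOn ℝ ∞ G Ω) : ∃ δ > 0, ∃ Φ : ℝ × F → F,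
      (∀ q ∈ Ioo (-δ) δ ×ˢ Metric.ball z₀ δ, ContDiffAt ℝ ∞ Φ q) ∧
      ∀ z ∈ Metric.ball z₀ δ, Φ (0, z) = z ∧
        ∀ t ∈ Ioo (-δ) δ, HasDerivAt (fun t ↦ Φ (t, z)) (G (Φ (t, z))) t ∧ Φ (t, z) ∈ Ω := by
  have : CompleteSpace F := FiniteDimensional.complete ℝ F
  obtain ⟨ρ, hρ, hρΩ⟩ := Metric.mem_nhds_iff.1 hΩ
  -- The cutoff turns `G` into a field that is smooth on the whole space and unchanged on the closed
  -- ball of radius `ρ / 3`. Time and initial values are restricted below until the flow stays in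
  -- that ball, where it is a flow of `G` itself.
  let χ : ContDiffBump z₀ := ⟨ρ / 3, ρ / 2, by positivity, by linarith⟩
  have hχsupp : tsupport χ ⊆ Metric.ball z₀ ρ := by
    rw [χ.tsupport_eq]; exact Metric.closedBall_subset_ball (by change ρ / 2 < ρ; linarith)
  have hsmooth : ContDiff ℝ ∞ fun x ↦ χ x • G x := by
    rw [contDiff_iff_contDiffAt]
    intro x
    by_cases hx : x ∈ tsupport χ
    · exact χ.contDiff.contDiffAt.smul (hG.contDiffAt
        (mem_of_superset (Metric.isOpen_ball.mem_nhds (hχsupp hx)) hρΩ))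
    · refine contDiffAt_const (c := (0 : F)) |>.congr_of_eventuallyEq ?_
      filter_upwards [(isClosed_tsupport χ).isOpen_compl.mem_nhds hx] with y hy
      rw [image_eq_zero_of_notMem_tsupport hy, zero_smul]
  obtain ⟨δ, hδ, Φ, hΦ, hflow⟩ := exists_contDiffOn_flow_of_contDiff hsmooth z₀
  have hcont : ContinuousAt Φ (0, z₀) :=
    (hΦ (0, z₀) ⟨⟨by linarith, hδ⟩, Metric.mem_ball_self hδ⟩).continuousAt
  have hev : ∀ᶠ q in 𝓝 ((0 : ℝ), z₀), Φ q ∈ Metric.ball z₀ (ρ / 3) := by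
    refine hcont.preimage_mem_nhds ?_
    rw [(hflow z₀ (Metric.mem_ball_self hδ)).1]
    exact Metric.ball_mem_nhds _ (by positivity)
  obtain ⟨δ', hδ', hev⟩ := Metric.eventually_nhds_iff_ball.1 hev
  have hsub : Metric.ball z₀ (min δ δ') ⊆ Metric.ball z₀ δ :=
    Metric.ball_subset_ball (min_le_left _ _)
  have hsub' : Ioo (-(min δ δ')) (min δ δ') ⊆ Ioo (-δ) δ :=
    Ioo_subset_Ioo (neg_le_neg (min_le_left _ _)) (min_le_left _ _)
  refine ⟨min δ δ', lt_min hδ hδ', Φ, fun q hq ↦ hΦ q ⟨hsub' hq.1, hsub hq.2⟩, fun z hz ↦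
    ⟨(hflow z (hsub hz)).1, fun t ht ↦ ?_⟩⟩
  have hval : Φ (t, z) ∈ Metric.ball z₀ (ρ / 3) := by
    refine hev _ ?_
    rw [← ball_prod_same, mem_prod]
    refine ⟨?_, Metric.ball_subset_ball (min_le_right _ _) hz⟩
    rw [mem_ball_zero_iff]; exact (abs_lt.2 ht).trans_le (min_le_right _ _)
  refine ⟨?_, hρΩ (Metric.ball_subset_ball (by linarith) hval)⟩
  have := (hflow z (hsub hz)).2 t (hsub' ht)
  rwa [χ.one_of_mem_closedBall (Metric.ball_subset_closedBall hval), one_smul] at this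

end SmoothDependence
end

noncomputable section

/-! ### Coordinates in a chart -/

section Coordinates

variable {E : Type*} [NormedAddCommGroup E] [NormedSpace ℝ E]
  {M : Type*} [TopologicalSpace M] [ChartedSpace E M]
  {V : Type*} [NormedAddCommGroup V] [NormedSpace ℝ V]

section Functions

lemma extChartAt_symm_mem_source {p₀ : M} {x : E} (hx : x ∈ (extChartAt 𝓘(ℝ, E) p₀).target) :
    (extChartAt 𝓘(ℝ, E) p₀).symm x ∈ (chartAt E p₀).source := by
  rw [← extChartAt_source 𝓘(ℝ, E)]
  exact (extChartAt 𝓘(ℝ, E) p₀).map_target hx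

lemma extChartAt_mem_target {p₀ q : M} (hq : q ∈ (chartAt E p₀).source) :
    extChartAt 𝓘(ℝ, E) p₀ q ∈ (extChartAt 𝓘(ℝ, E) p₀).target :=
  (extChartAt 𝓘(ℝ, E) p₀).map_source (by rwa [extChartAt_source])

lemma extChartAt_left_inv {p₀ q : M} (hq : q ∈ (chartAt E p₀).source) :
    (extChartAt 𝓘(ℝ, E) p₀).symm (extChartAt 𝓘(ℝ, E) p₀ q) = q :=
  (extChartAt 𝓘(ℝ, E) p₀).left_inv (by rwa [extChartAt_source])

lemma extChartAt_target_mem_nhds_of_mem {p₀ q : M} (hq : q ∈ (chartAt E p₀).source) :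
    (extChartAt 𝓘(ℝ, E) p₀).target ∈ 𝓝 (extChartAt 𝓘(ℝ, E) p₀ q) :=
  (isOpen_extChartAt_target p₀).mem_nhds (extChartAt_mem_target hq)

lemma comp_extChartAt_symm_comp {V : Type*} {p₀ q : M} (hq : q ∈ (chartAt E p₀).source)
    (f : M → V) :
    f =ᶠ[𝓝 q] (f ∘ (extChartAt 𝓘(ℝ, E) p₀).symm) ∘ extChartAt 𝓘(ℝ, E) p₀ := by
  filter_upwards [(chartAt E p₀).open_source.mem_nhds hq] with r hr
  simp only [Function.comp_apply]
  rw [extChartAt_left_inv hr]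

variable [IsManifold 𝓘(ℝ, E) ∞ M]

lemma contMDiffAt_extChartAt_symm {p₀ : M} {x : E}
    (hx : x ∈ (extChartAt 𝓘(ℝ, E) p₀).target) :
    ContMDiffAt 𝓘(ℝ, E) 𝓘(ℝ, E) ∞ (extChartAt 𝓘(ℝ, E) p₀).symm x :=
  (contMDiffOn_extChartAt_symm p₀).contMDiffAt ((isOpen_extChartAt_target p₀).mem_nhds hx)

lemma contMDiffAt_iff_contDiffAt_comp_symm {p₀ q : M} (hq : q ∈ (chartAt E p₀).source)
    {f : M → V} :
    ContMDiffAt 𝓘(ℝ, E) 𝓘(ℝ, V) ∞ f q ↔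
      ContDiffAt ℝ ∞ (f ∘ (extChartAt 𝓘(ℝ, E) p₀).symm) (extChartAt 𝓘(ℝ, E) p₀ q) := by
  constructor
  · intro h
    rw [← contMDiffAt_iff_contDiffAt]
    refine ContMDiffAt.comp _ ?_ (contMDiffAt_extChartAt_symm (extChartAt_mem_target hq))
    rwa [extChartAt_left_inv hq]
  · intro h
    exact ((contMDiffAt_iff_contDiffAt.2 h).comp q (contMDiffAt_extChartAt' hq)).congr_of_eventuallyEq
      (comp_extChartAt_symm_comp hq f)

lemma mdifferentiableAt_iff_differentiableAt_comp_symm {p₀ q : M}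
    (hq : q ∈ (chartAt E p₀).source) {f : M → V} :
    MDifferentiableAt 𝓘(ℝ, E) 𝓘(ℝ, V) f q ↔
      DifferentiableAt ℝ (f ∘ (extChartAt 𝓘(ℝ, E) p₀).symm) (extChartAt 𝓘(ℝ, E) p₀ q) := by
  constructor
  · intro h
    rw [← mdifferentiableAt_iff_differentiableAt]
    refine MDifferentiableAt.comp _ (I' := 𝓘(ℝ, E)) ?_
      ((contMDiffAt_extChartAt_symm (extChartAt_mem_target hq)).mdifferentiableAt (by simp))
    rwa [extChartAt_left_inv hq]
  · intro h
    exact ((mdifferentiableAt_iff_differentiableAt.2 h).comp q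
      ((contMDiffAt_extChartAt' hq).mdifferentiableAt (n := ∞) (by simp))).congr_of_eventuallyEq
      (comp_extChartAt_symm_comp hq f)

end Functions

variable [IsManifold 𝓘(ℝ, E) ∞ M]

/-- The coordinates of a tangent vector at `q` in the chart at `p₀`. -/
def coordVec (p₀ q : M) : TangentSpace 𝓘(ℝ, E) q →L[ℝ] E :=
  (trivializationAt E (TangentSpace 𝓘(ℝ, E) : M → Type _) p₀).continuousLinearMapAt ℝ q

/-- The tangent vector at `q` with given coordinates in the chart at `p₀`. -/
def ofCoordVec (p₀ q : M) : E →L[ℝ] TangentSpace 𝓘(ℝ, E) q :=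
  (trivializationAt E (TangentSpace 𝓘(ℝ, E) : M → Type _) p₀).symmL ℝ q

/-- The coordinate expression, in the chart at `p₀`, of a vector field. -/
def fieldRep (p₀ : M) (X : Π q : M, TangentSpace 𝓘(ℝ, E) q) (x : E) : E :=
  coordVec p₀ ((extChartAt 𝓘(ℝ, E) p₀).symm x) (X ((extChartAt 𝓘(ℝ, E) p₀).symm x))

lemma coordVec_apply {p₀ q : M} (hq : q ∈ (chartAt E p₀).source)
    (v : TangentSpace 𝓘(ℝ, E) q) :
    coordVec p₀ q v =
      (trivializationAt E (TangentSpace 𝓘(ℝ, E) : M → Type _) p₀ ⟨q, v⟩).2 := by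
  rw [coordVec, Trivialization.continuousLinearMapAt_apply, Trivialization.linearMapAt_apply,
    if_pos (by simpa using hq)]

lemma ofCoordVec_apply {p₀ q : M} (hq : q ∈ (chartAt E p₀).source) (w : E) :
    ofCoordVec p₀ q w =
      (trivializationAt E (TangentSpace 𝓘(ℝ, E) : M → Type _) p₀).symm q w :=
  Trivialization.symmL_apply _ (by simpa using hq) w

lemma ofCoordVec_coordVec {p₀ q : M} (hq : q ∈ (chartAt E p₀).source)
    (v : TangentSpace 𝓘(ℝ, E) q) : ofCoordVec p₀ q (coordVec p₀ q v) = v :=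
  Trivialization.symmL_continuousLinearMapAt _ (by simpa using hq) v

lemma coordVec_ofCoordVec {p₀ q : M} (hq : q ∈ (chartAt E p₀).source) (w : E) :
    coordVec p₀ q (ofCoordVec p₀ q w) = w :=
  Trivialization.continuousLinearMapAt_symmL _ (by simpa using hq) w

lemma coordVec_injective {p₀ q : M} (hq : q ∈ (chartAt E p₀).source) :
    Function.Injective (coordVec (E := E) p₀ q) :=
  Function.LeftInverse.injective (ofCoordVec_coordVec hq)

lemma coordVec_eq_mfderiv {p₀ q : M} (hq : q ∈ (chartAt E p₀).source) :
    coordVec p₀ q = mfderiv 𝓘(ℝ, E) 𝓘(ℝ, E) (extChartAt 𝓘(ℝ, E) p₀) q :=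
  TangentBundle.continuousLinearMapAt_trivializationAt hq

lemma mfderiv_apply_eq_fderiv {p₀ q : M} (hq : q ∈ (chartAt E p₀).source) {f : M → V}
    (hf : MDifferentiableAt 𝓘(ℝ, E) 𝓘(ℝ, V) f q) (v : TangentSpace 𝓘(ℝ, E) q) :
    mfderiv 𝓘(ℝ, E) 𝓘(ℝ, V) f q v =
      fderiv ℝ (f ∘ (extChartAt 𝓘(ℝ, E) p₀).symm) (extChartAt 𝓘(ℝ, E) p₀ q)
        (coordVec p₀ q v) := by
  have h1 := (mdifferentiableAt_iff_differentiableAt_comp_symm hq).1 hf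
  rw [(comp_extChartAt_symm_comp hq f).mfderiv_eq,
    mfderiv_comp q (mdifferentiableAt_iff_differentiableAt.2 h1)
      ((contMDiffAt_extChartAt' hq).mdifferentiableAt (n := ∞) (by simp)),
    mfderiv_eq_fderiv, coordVec_eq_mfderiv hq]
  rfl

lemma fieldRep_eventuallyEq {p₀ : M} {x : E} (hx : x ∈ (extChartAt 𝓘(ℝ, E) p₀).target)
    (X : Π q : M, TangentSpace 𝓘(ℝ, E) q) :
    fieldRep p₀ X =ᶠ[𝓝 x] (fun q : M ↦
      (trivializationAt E (TangentSpace 𝓘(ℝ, E) : M → Type _) p₀ ⟨q, X q⟩).2) ∘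
        (extChartAt 𝓘(ℝ, E) p₀).symm := by
  filter_upwards [(isOpen_extChartAt_target p₀).mem_nhds hx] with y hy
  exact coordVec_apply (extChartAt_symm_mem_source hy) _

lemma mdifferentiableAt_field_iff {p₀ q : M} (hq : q ∈ (chartAt E p₀).source)
    {X : Π q : M, TangentSpace 𝓘(ℝ, E) q} :
    MDifferentiableAt 𝓘(ℝ, E) 𝓘(ℝ, E).tangent
      (fun q ↦ (⟨q, X q⟩ : TangentBundle 𝓘(ℝ, E) M)) q ↔
      DifferentiableAt ℝ (fieldRep p₀ X) (extChartAt 𝓘(ℝ, E) p₀ q) := by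
  rw [(fieldRep_eventuallyEq (extChartAt_mem_target hq) X).differentiableAt_iff,
    ← mdifferentiableAt_iff_differentiableAt_comp_symm hq]
  exact Trivialization.mdifferentiableAt_section_iff 𝓘(ℝ, E) _ X (by simpa using hq)

lemma contMDiffAt_field_iff {p₀ q : M} (hq : q ∈ (chartAt E p₀).source)
    {X : Π q : M, TangentSpace 𝓘(ℝ, E) q} :
    ContMDiffAt 𝓘(ℝ, E) 𝓘(ℝ, E).tangent ∞
      (fun q ↦ (⟨q, X q⟩ : TangentBundle 𝓘(ℝ, E) M)) q ↔
      ContDiffAt ℝ ∞ (fieldRep p₀ X) (extChartAt 𝓘(ℝ, E) p₀ q) := by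
  have h := fieldRep_eventuallyEq (extChartAt_mem_target hq) X
  refine (Trivialization.contMDiffAt_section_iff
    (trivializationAt E (TangentSpace 𝓘(ℝ, E) : M → Type _) p₀) (by simpa using hq)).trans ?_
  rw [contMDiffAt_iff_contDiffAt_comp_symm hq]
  exact ⟨fun h' ↦ h'.congr_of_eventuallyEq h, fun h' ↦ h'.congr_of_eventuallyEq h.symm⟩

lemma fieldRep_extChartAt {p₀ q : M} (hq : q ∈ (chartAt E p₀).source)
    (X : Π q : M, TangentSpace 𝓘(ℝ, E) q) :
    fieldRep p₀ X (extChartAt 𝓘(ℝ, E) p₀ q) = coordVec p₀ q (X q) := by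
  rw [fieldRep, extChartAt_left_inv hq]

/-- The change of coordinates of tangent vectors from the chart at `p₁` to the chart at `p₀`, as
a function of the coordinate `x` in the chart at `p₀`. -/
def coordChangeRep (p₁ p₀ : M) (x : E) : E →L[ℝ] E :=
  ((trivializationAt E (TangentSpace 𝓘(ℝ, E) : M → Type _) p₁).coordChangeL ℝ
    (trivializationAt E (TangentSpace 𝓘(ℝ, E) : M → Type _) p₀)
      ((extChartAt 𝓘(ℝ, E) p₀).symm x) : E →L[ℝ] E)

lemma coordChangeRep_apply {p₁ p₀ q : M} (hq : q ∈ (chartAt E p₀).source)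
    (hq₁ : q ∈ (chartAt E p₁).source) (w : E) :
    coordChangeRep p₁ p₀ (extChartAt 𝓘(ℝ, E) p₀ q) w =
      coordVec p₀ q ((trivializationAt E (TangentSpace 𝓘(ℝ, E) : M → Type _) p₁).symm q w) := by
  rw [coordVec_apply hq, coordChangeRep, extChartAt_left_inv hq]
  exact Trivialization.coordChangeL_apply _ _ ⟨by simpa using hq₁, by simpa using hq⟩ w

lemma contDiffAt_coordChangeRep {p₁ p₀ q : M} (hq : q ∈ (chartAt E p₀).source)
    (hq₁ : q ∈ (chartAt E p₁).source) :
    ContDiffAt ℝ ∞ (coordChangeRep (E := E) p₁ p₀) (extChartAt 𝓘(ℝ, E) p₀ q) := by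
  have h : ContMDiffAt 𝓘(ℝ, E) 𝓘(ℝ, E →L[ℝ] E) ∞ (fun b : M ↦
      ((trivializationAt E (TangentSpace 𝓘(ℝ, E) : M → Type _) p₁).coordChangeL ℝ
        (trivializationAt E (TangentSpace 𝓘(ℝ, E) : M → Type _) p₀) b : E →L[ℝ] E)) q :=
    contMDiffAt_coordChangeL (IB := 𝓘(ℝ, E)) (by simpa using hq₁) (by simpa using hq)
  exact (contMDiffAt_iff_contDiffAt_comp_symm hq).1 h

/-- `FiberBundle.extend` produces the field with constant components in the trivialization at the
base point `p` of `v`. In another chart these constants are carried by the change of coordinates,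
which depends smoothly on the point. -/
lemma fieldRep_extend_eventuallyEq {p₀ p q : M} (hq : q ∈ (chartAt E p₀).source)
    (hqp : q ∈ (chartAt E p).source) (v : TangentSpace 𝓘(ℝ, E) p) :
    fieldRep p₀ (FiberBundle.extend E v) =ᶠ[𝓝 (extChartAt 𝓘(ℝ, E) p₀ q)]
      fun x ↦ coordChangeRep p p₀ x (coordVec p p v) := by
  have hcont : ContinuousAt (extChartAt 𝓘(ℝ, E) p₀).symm (extChartAt 𝓘(ℝ, E) p₀ q) :=
    (contMDiffAt_extChartAt_symm (extChartAt_mem_target hq)).continuousAt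
  have hsrc : (chartAt E p).source ∈ 𝓝 ((extChartAt 𝓘(ℝ, E) p₀).symm
      (extChartAt 𝓘(ℝ, E) p₀ q)) := by
    rw [extChartAt_left_inv hq]; exact (chartAt E p).open_source.mem_nhds hqp
  filter_upwards [extChartAt_target_mem_nhds_of_mem hq, hcont.preimage_mem_nhds hsrc] with x hx hx'
  have hx0 := extChartAt_symm_mem_source hx
  have := coordChangeRep_apply hx0 hx' (coordVec p p v)
  rw [(extChartAt 𝓘(ℝ, E) p₀).right_inv hx] at this
  rw [this, fieldRep, FiberBundle.extend, coordVec_apply (mem_chart_source E p)]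

lemma contMDiffAt_field_extend (p : M) (v : TangentSpace 𝓘(ℝ, E) p) :
    ContMDiffAt 𝓘(ℝ, E) 𝓘(ℝ, E).tangent ∞
      (fun q ↦ (⟨q, FiberBundle.extend E v q⟩ : TangentBundle 𝓘(ℝ, E) M)) p := by
  have hp := mem_chart_source E p
  rw [contMDiffAt_field_iff hp]
  exact (((contDiffAt_coordChangeRep hp hp).clm_apply contDiffAt_const).congr_of_eventuallyEq
    (fieldRep_extend_eventuallyEq hp hp v))

end Coordinates
end

noncomputable section

/-! ### Connections in coordinates -/

lemma minSmoothness_two_le_infty : minSmoothness ℝ 2 ≤ ∞ := by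
  rw [minSmoothness_of_isRCLikeNormedField]
  exact WithTop.coe_le_coe.2 (le_top : (2 : ℕ∞) ≤ ⊤)

section Curvature

variable {E : Type*} [NormedAddCommGroup E] [NormedSpace ℝ E]

/-- The curvature of the connection with Christoffel symbols `Γ` on an open subset of `E`. -/
def christoffelCurvature (Γ : E → E →L[ℝ] E →L[ℝ] E) (x u v w : E) : E :=
  fderiv ℝ Γ x u w v - fderiv ℝ Γ x v w u + Γ x (Γ x w v) u - Γ x (Γ x w u) v

/-- The product rule for `∇_V Z`, with the second derivative of `Z` isolated, because it is the term
that disappears by symmetry in the curvature. -/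
lemma hasFDerivAt_christoffel_covariant {Γ : E → E →L[ℝ] E →L[ℝ] E} {Z V : E → E} {x : E}
    (hΓ : DifferentiableAt ℝ Γ x) (hZ : ContDiffAt ℝ ∞ Z x) (hV : DifferentiableAt ℝ V x) (u : E) :
    fderiv ℝ (fun y ↦ fderiv ℝ Z y (V y) + Γ y (Z y) (V y)) x u =
      fderiv ℝ (fderiv ℝ Z) x u (V x) + fderiv ℝ Z x (fderiv ℝ V x u) +
      (fderiv ℝ Γ x u (Z x) (V x) + Γ x (fderiv ℝ Z x u) (V x) + Γ x (Z x) (fderiv ℝ V x u)) := by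
  have hZ1 : DifferentiableAt ℝ Z x := hZ.differentiableAt (by simp)
  have hZ2 : DifferentiableAt ℝ (fderiv ℝ Z) x :=
    (hZ.fderiv_right (m := 1) (by norm_cast)).differentiableAt (by simp)
  have h := (hZ2.hasFDerivAt.clm_apply hV.hasFDerivAt).add
    ((hΓ.hasFDerivAt.clm_apply hZ1.hasFDerivAt).clm_apply hV.hasFDerivAt)
  have h' : fderiv ℝ (fun y ↦ fderiv ℝ Z y (V y) + Γ y (Z y) (V y)) x = _ := h.fderiv
  rw [h']
  simp only [_root_.add_apply, ContinuousLinearMap.comp_apply,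
    ContinuousLinearMap.flip_apply]
  abel

/-- The commutation relation `∇_U ∇_V Z - ∇_V ∇_U Z - ∇_[U, V] Z = R(U, V) Z`. -/
lemma christoffelCurvature_eq {Γ : E → E →L[ℝ] E →L[ℝ] E} {Z U V : E → E} {x : E}
    (hΓ : DifferentiableAt ℝ Γ x) (hZ : ContDiffAt ℝ ∞ Z x) (hU : DifferentiableAt ℝ U x)
    (hV : DifferentiableAt ℝ V x) :
    (fderiv ℝ (fun y ↦ fderiv ℝ Z y (V y) + Γ y (Z y) (V y)) x (U x)
        + Γ x (fderiv ℝ Z x (V x) + Γ x (Z x) (V x)) (U x))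
      - (fderiv ℝ (fun y ↦ fderiv ℝ Z y (U y) + Γ y (Z y) (U y)) x (V x)
        + Γ x (fderiv ℝ Z x (U x) + Γ x (Z x) (U x)) (V x))
      - (fderiv ℝ Z x (fderiv ℝ V x (U x) - fderiv ℝ U x (V x))
        + Γ x (Z x) (fderiv ℝ V x (U x) - fderiv ℝ U x (V x)))
      = christoffelCurvature Γ x (U x) (V x) (Z x) := by
  rw [hasFDerivAt_christoffel_covariant hΓ hZ hV, hasFDerivAt_christoffel_covariant hΓ hZ hU]
  -- Second derivatives of `Z` cancel by symmetry, and the derivatives of `U` and `V` cancel against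
  -- the bracket; an expression without derivatives of the fields is left.
  have hsymm : fderiv ℝ (fderiv ℝ Z) x (U x) (V x) = fderiv ℝ (fderiv ℝ Z) x (V x) (U x) :=
    (hZ.isSymmSndFDerivAt minSmoothness_two_le_infty).eq _ _
  rw [hsymm, christoffelCurvature]
  simp only [map_add, map_sub, _root_.add_apply]
  abel

end Curvature

section Connection

variable {E : Type*} [NormedAddCommGroup E] [NormedSpace ℝ E]
  {M : Type*} [TopologicalSpace M] [ChartedSpace E M] [IsManifold 𝓘(ℝ, E) ∞ M]

lemma ofCoordVec_eq_mfderiv {p₀ q : M} (hq : q ∈ (chartAt E p₀).source) :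
    ofCoordVec (E := E) p₀ q = mfderiv 𝓘(ℝ, E) 𝓘(ℝ, E) (extChartAt 𝓘(ℝ, E) p₀).symm
      (extChartAt 𝓘(ℝ, E) p₀ q) := by
  have := TangentBundle.symmL_trivializationAt (I := 𝓘(ℝ, E)) hq
  rw [ModelWithCorners.range_eq_univ, mfderivWithin_univ] at this
  exact this

lemma inverse_mfderiv_extChartAt_symm {p₀ : M} {x : E}
    (hx : x ∈ (extChartAt 𝓘(ℝ, E) p₀).target) :
    (mfderiv 𝓘(ℝ, E) 𝓘(ℝ, E) (extChartAt 𝓘(ℝ, E) p₀).symm x).inverse =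
      coordVec p₀ ((extChartAt 𝓘(ℝ, E) p₀).symm x) := by
  have hq := extChartAt_symm_mem_source hx
  have h := ofCoordVec_eq_mfderiv (E := E) hq
  rw [(extChartAt 𝓘(ℝ, E) p₀).right_inv hx] at h
  refine ContinuousLinearMap.inverse_eq ?_ ?_
  · refine ContinuousLinearMap.ext fun v ↦ ?_
    exact (congrArg (fun A : E →L[ℝ] TangentSpace 𝓘(ℝ, E) ((extChartAt 𝓘(ℝ, E) p₀).symm x) ↦
      A (coordVec p₀ _ v)) h.symm).trans (ofCoordVec_coordVec hq v)
  · refine ContinuousLinearMap.ext fun w ↦ ?_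
    exact (congrArg (fun A : E →L[ℝ] TangentSpace 𝓘(ℝ, E) ((extChartAt 𝓘(ℝ, E) p₀).symm x) ↦
      coordVec p₀ _ (A w)) h.symm).trans (coordVec_ofCoordVec hq w)

lemma mpullback_extChartAt_symm_eventuallyEq {p₀ q : M} (hq : q ∈ (chartAt E p₀).source)
    (X : Π q : M, TangentSpace 𝓘(ℝ, E) q) :
    VectorField.mpullback 𝓘(ℝ, E) 𝓘(ℝ, E) (extChartAt 𝓘(ℝ, E) p₀).symm X
      =ᶠ[𝓝 (extChartAt 𝓘(ℝ, E) p₀ q)] fieldRep p₀ X := by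
  filter_upwards [extChartAt_target_mem_nhds_of_mem hq] with x hx
  rw [VectorField.mpullback_apply, inverse_mfderiv_extChartAt_symm hx]
  rfl

/-- The Lie bracket in the coordinates of the chart at `p₀`. -/
lemma coordVec_mlieBracket [CompleteSpace E] {p₀ q : M} (hq : q ∈ (chartAt E p₀).source)
    {U V : Π q : M, TangentSpace 𝓘(ℝ, E) q}
    (hU : MDifferentiableAt 𝓘(ℝ, E) 𝓘(ℝ, E).tangent
      (fun q ↦ (⟨q, U q⟩ : TangentBundle 𝓘(ℝ, E) M)) q)
    (hV : MDifferentiableAt 𝓘(ℝ, E) 𝓘(ℝ, E).tangent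
      (fun q ↦ (⟨q, V q⟩ : TangentBundle 𝓘(ℝ, E) M)) q) :
    coordVec p₀ q (VectorField.mlieBracket 𝓘(ℝ, E) U V q) =
      fderiv ℝ (fieldRep p₀ V) (extChartAt 𝓘(ℝ, E) p₀ q) (coordVec p₀ q (U q))
        - fderiv ℝ (fieldRep p₀ U) (extChartAt 𝓘(ℝ, E) p₀ q) (coordVec p₀ q (V q)) := by
  have hx := extChartAt_mem_target hq
  have hn := minSmoothness_two_le_infty
  have : IsManifold 𝓘(ℝ, E) (minSmoothness ℝ 2) M := .of_le hn
  -- The bracket is natural under pullback, and the pullback of a field by the inverse chart is its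
  -- coordinate expression.
  have h := VectorField.mpullback_mlieBracket (I := 𝓘(ℝ, E)) (I' := 𝓘(ℝ, E))
    (f := (extChartAt 𝓘(ℝ, E) p₀).symm) (x₀ := extChartAt 𝓘(ℝ, E) p₀ q) (V := U) (W := V) (n := ∞)
    (by rwa [extChartAt_left_inv hq]) (by rwa [extChartAt_left_inv hq])
    (contMDiffAt_extChartAt_symm hx) hn
  rw [VectorField.mpullback_apply, inverse_mfderiv_extChartAt_symm hx, extChartAt_left_inv hq,
    Filter.EventuallyEq.mlieBracket_vectorField_eq (mpullback_extChartAt_symm_eventuallyEq hq U)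
      (mpullback_extChartAt_symm_eventuallyEq hq V)] at h
  have h' : VectorField.mlieBracket 𝓘(ℝ, E) (fieldRep p₀ U) (fieldRep p₀ V)
      (extChartAt 𝓘(ℝ, E) p₀ q) =
      VectorField.lieBracket ℝ (fieldRep p₀ U) (fieldRep p₀ V) (extChartAt 𝓘(ℝ, E) p₀ q) :=
    (congrFun (VectorField.mlieBracketWithin_univ (I := 𝓘(ℝ, E)) (V := fieldRep p₀ U)
      (W := fieldRep p₀ V)).symm _).trans
      ((congrFun VectorField.mlieBracketWithin_eq_lieBracketWithin _).trans
        (congrFun (VectorField.lieBracketWithin_univ (𝕜 := ℝ) (E := E) (V := fieldRep p₀ U)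
          (W := fieldRep p₀ V)) _))
  refine (h.trans h').trans ?_
  rw [VectorField.lieBracket, fieldRep_extChartAt hq, fieldRep_extChartAt hq]

/-- `Γ p₀` is the field of Christoffel symbols, in the chart at `p₀`, of the smooth linear
connection `D`: the `(w, v) ↦ Γ p₀ x w v` is the derivative of the field with constant coordinates
`w` in the direction `v`. -/
structure HasChristoffel (D : ConnectionOperator E M) (Γ : M → E → E →L[ℝ] E →L[ℝ] E) : Prop where
  smooth : ∀ p₀, ContDiffOn ℝ ∞ (Γ p₀) (extChartAt 𝓘(ℝ, E) p₀).target
  coordVec_apply : ∀ {p₀ q : M}, q ∈ (chartAt E p₀).source →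
    ∀ {X : Π q : M, TangentSpace 𝓘(ℝ, E) q},
    MDifferentiableAt 𝓘(ℝ, E) 𝓘(ℝ, E).tangent
      (fun q ↦ (⟨q, X q⟩ : TangentBundle 𝓘(ℝ, E) M)) q →
    ∀ v, coordVec p₀ q (D X q v) =
      fderiv ℝ (fieldRep p₀ X) (extChartAt 𝓘(ℝ, E) p₀ q) (coordVec p₀ q v)
        + Γ p₀ (extChartAt 𝓘(ℝ, E) p₀ q) (coordVec p₀ q (X q)) (coordVec p₀ q v)

namespace HasChristoffel

variable {D : ConnectionOperator E M} {Γ : M → E → E →L[ℝ] E →L[ℝ] E}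

lemma contDiffAt (h : HasChristoffel D Γ) {p₀ q : M} (hq : q ∈ (chartAt E p₀).source) :
    ContDiffAt ℝ ∞ (Γ p₀) (extChartAt 𝓘(ℝ, E) p₀ q) :=
  (h.smooth p₀).contDiffAt (extChartAt_target_mem_nhds_of_mem hq)

/-- The derivatives of the two extensions cancel against the bracket, leaving the antisymmetric part
of `Γ`. The first argument of `Γ` is the differentiated field and the second is the direction. -/
lemma coordVec_torsionTensor [CompleteSpace E] (h : HasChristoffel D Γ) {p₀ q : M}
    (hq : q ∈ (chartAt E p₀).source) (u v : TangentSpace 𝓘(ℝ, E) q) :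
    coordVec p₀ q (torsionTensor D q u v) =
      Γ p₀ (extChartAt 𝓘(ℝ, E) p₀ q) (coordVec p₀ q v) (coordVec p₀ q u)
        - Γ p₀ (extChartAt 𝓘(ℝ, E) p₀ q) (coordVec p₀ q u) (coordVec p₀ q v) := by
  have hu := (contMDiffAt_field_extend q u).mdifferentiableAt (by simp)
  have hv := (contMDiffAt_field_extend q v).mdifferentiableAt (by simp)
  rw [torsionTensor, map_sub, map_sub, h.coordVec_apply hq hv, h.coordVec_apply hq hu,
    coordVec_mlieBracket hq hu hv]
  simp only [FiberBundle.extend_apply_self]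
  abel

/-- The coordinate expression of `q ↦ ∇_V W`. -/
lemma fieldRep_covariant_eventuallyEq (h : HasChristoffel D Γ) {p₀ q : M}
    (hq : q ∈ (chartAt E p₀).source) {V W : Π q : M, TangentSpace 𝓘(ℝ, E) q}
    (hW : ContMDiffAt 𝓘(ℝ, E) 𝓘(ℝ, E).tangent ∞
      (fun q ↦ (⟨q, W q⟩ : TangentBundle 𝓘(ℝ, E) M)) q) :
    fieldRep p₀ (fun q ↦ D W q (V q)) =ᶠ[𝓝 (extChartAt 𝓘(ℝ, E) p₀ q)]
      fun x ↦ fderiv ℝ (fieldRep p₀ W) x (fieldRep p₀ V x)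
        + Γ p₀ x (fieldRep p₀ W x) (fieldRep p₀ V x) := by
  have hW' : ContDiffAt ℝ 1 (fieldRep p₀ W) (extChartAt 𝓘(ℝ, E) p₀ q) :=
    ((contMDiffAt_field_iff hq).1 hW).of_le (by exact_mod_cast le_top)
  filter_upwards [hW'.eventually (by simp), extChartAt_target_mem_nhds_of_mem hq] with x hx hx'
  have hr := extChartAt_symm_mem_source hx'
  have hWr := (mdifferentiableAt_field_iff (X := W) hr).2 (by
    rw [(extChartAt 𝓘(ℝ, E) p₀).right_inv hx']; exact hx.differentiableAt (by simp))
  have := h.coordVec_apply hr hWr (V ((extChartAt 𝓘(ℝ, E) p₀).symm x))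
  rw [(extChartAt 𝓘(ℝ, E) p₀).right_inv hx'] at this
  exact this

lemma contDiffAt_fieldRep_covariant (h : HasChristoffel D Γ) {p₀ q : M}
    (hq : q ∈ (chartAt E p₀).source) {V W : Π q : M, TangentSpace 𝓘(ℝ, E) q}
    (hW : ContMDiffAt 𝓘(ℝ, E) 𝓘(ℝ, E).tangent ∞
      (fun q ↦ (⟨q, W q⟩ : TangentBundle 𝓘(ℝ, E) M)) q)
    (hV : ContMDiffAt 𝓘(ℝ, E) 𝓘(ℝ, E).tangent ∞
      (fun q ↦ (⟨q, V q⟩ : TangentBundle 𝓘(ℝ, E) M)) q) :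
    ContMDiffAt 𝓘(ℝ, E) 𝓘(ℝ, E).tangent ∞
      (fun q ↦ (⟨q, D W q (V q)⟩ : TangentBundle 𝓘(ℝ, E) M)) q := by
  rw [contMDiffAt_field_iff hq] at hV ⊢
  have hW' := (contMDiffAt_field_iff hq).1 hW
  refine ContDiffAt.congr_of_eventuallyEq ?_ (h.fieldRep_covariant_eventuallyEq hq hW)
  exact ((hW'.fderiv_right (m := ∞) (by simp)).clm_apply hV).add
    (((h.contDiffAt hq).clm_apply hW').clm_apply hV)

/-- The commutation relation applied to the extensions of the three vectors. Its right side involves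
the values at `q` only, so the choice of extensions does not matter. -/
lemma coordVec_curvatureTensor [CompleteSpace E] (h : HasChristoffel D Γ) {p₀ q : M}
    (hq : q ∈ (chartAt E p₀).source) (u v w : TangentSpace 𝓘(ℝ, E) q) :
    coordVec p₀ q (curvatureTensor D q u v w) =
      christoffelCurvature (Γ p₀) (extChartAt 𝓘(ℝ, E) p₀ q) (coordVec p₀ q u) (coordVec p₀ q v)
        (coordVec p₀ q w) := by
  have hext (z : TangentSpace 𝓘(ℝ, E) q) := contMDiffAt_field_extend q z
  have hext1 (z : TangentSpace 𝓘(ℝ, E) q) := (hext z).mdifferentiableAt (by simp)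
  have hrep (z : TangentSpace 𝓘(ℝ, E) q) :
      fieldRep p₀ (FiberBundle.extend E z) (extChartAt 𝓘(ℝ, E) p₀ q) = coordVec p₀ q z := by
    rw [fieldRep_extChartAt hq, FiberBundle.extend_apply_self]
  have hcov (z : TangentSpace 𝓘(ℝ, E) q) :=
    (h.contDiffAt_fieldRep_covariant hq (hext w) (hext z)).mdifferentiableAt (by simp)
  have hD (z : TangentSpace 𝓘(ℝ, E) q) := (mdifferentiableAt_field_iff hq).1 (hext1 z)
  have key := christoffelCurvature_eq ((h.contDiffAt hq).differentiableAt (by simp))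
    ((contMDiffAt_field_iff hq).1 (hext w)) (hD u) (hD v)
  simp only [hrep] at key
  have hself (z : TangentSpace 𝓘(ℝ, E) q) : (FiberBundle.extend E z : Π q, TangentSpace 𝓘(ℝ, E) q) q
      = z := FiberBundle.extend_apply_self E z
  have hDw (z : TangentSpace 𝓘(ℝ, E) q) := h.coordVec_apply hq (hext1 w) z
  have hDDw (z : TangentSpace 𝓘(ℝ, E) q) (y : TangentSpace 𝓘(ℝ, E) q) :=
    h.coordVec_apply hq (hcov z) y
  simp only [hself, hDw, (h.fieldRep_covariant_eventuallyEq hq (hext w)).fderiv_eq] at hDDw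
  rw [← key, curvatureTensor, map_sub, map_sub, hDDw, hDDw, h.coordVec_apply hq (hext1 w),
    coordVec_mlieBracket hq (hext1 u) (hext1 v)]
  simp only [hself]

end HasChristoffel

end Connection
end

noncomputable section

/-! ### Curves and fields along curves in coordinates -/

section Along

variable {E : Type*} [NormedAddCommGroup E] [NormedSpace ℝ E]
  {M : Type*} [TopologicalSpace M] [ChartedSpace E M] [IsManifold 𝓘(ℝ, E) ∞ M]
  {N : Type*} [NormedAddCommGroup N] [NormedSpace ℝ N]

/-- The product rule in the form suited to a change of frame `C`: the coefficient is differentiated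
with the vector `ξ t` frozen, and `y ↦ C y (ξ t)` is then the coordinate expression of an extension
with constant components. -/
lemma derivWithin_clm_apply_comp {C : E → E →L[ℝ] E} {x ξ : ℝ → E} {x' ξ' : E} {J : Set ℝ} {t : ℝ}
    (hC : DifferentiableAt ℝ C (x t)) (hx : HasDerivWithinAt x x' J t)
    (hξ : HasDerivWithinAt ξ ξ' J t) (hJ : UniqueDiffWithinAt ℝ J t) :
    derivWithin (fun s ↦ C (x s) (ξ s)) J t =
      fderiv ℝ (fun y ↦ C y (ξ t)) (x t) x' + C (x t) ξ' := by
  have h1 := ((hC.hasFDerivAt.comp_hasDerivWithinAt t hx).clm_apply hξ).derivWithin hJ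
  have h2 := (hC.hasFDerivAt.clm_apply (hasFDerivAt_const (ξ t) (x t))).fderiv
  simp only [Function.comp_def] at h1 h2
  rw [h1, h2]
  simp

variable (E) in
/-- A map to `M` in the coordinates of the chart at `p₀`. -/
def mapRep (p₀ : M) (f : N → M) (z : N) : E := extChartAt 𝓘(ℝ, E) p₀ (f z)

/-- A field along a map in the coordinates of the chart at `p₀`. -/
def alongRep (p₀ : M) (f : N → M) (X : Π z, TangentSpace 𝓘(ℝ, E) (f z)) (z : N) : E :=
  coordVec p₀ (f z) (X z)

lemma eventually_mem_chart_source {f : N → M} {S : Set N} {z : N} {p₀ : M}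
    (hf : ContinuousWithinAt f S z) (hz : f z ∈ (chartAt E p₀).source) :
    ∀ᶠ y in 𝓝[S] z, f y ∈ (chartAt E p₀).source :=
  hf.preimage_mem_nhdsWithin ((chartAt E p₀).open_source.mem_nhds hz)

lemma contMDiffWithinAt_iff_mapRep {f : N → M} {S : Set N} {z : N} {p₀ : M}
    (hz : f z ∈ (chartAt E p₀).source) :
    ContMDiffWithinAt 𝓘(ℝ, N) 𝓘(ℝ, E) ∞ f S z ↔
      ContinuousWithinAt f S z ∧ ContDiffWithinAt ℝ ∞ (mapRep E p₀ f) S z := by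
  rw [contMDiffWithinAt_iff_target_of_mem_source hz, contMDiffWithinAt_iff_contDiffWithinAt]
  rfl

lemma differentiableWithinAt_mapRep {f : N → M} {S : Set N} {z : N} {p₀ : M}
    (hz : f z ∈ (chartAt E p₀).source) (hf : MDifferentiableWithinAt 𝓘(ℝ, N) 𝓘(ℝ, E) f S z) :
    DifferentiableWithinAt ℝ (mapRep E p₀ f) S z := by
  rw [← mdifferentiableWithinAt_iff_differentiableWithinAt]
  exact MDifferentiableAt.comp_mdifferentiableWithinAt z
    ((contMDiffAt_extChartAt' hz).mdifferentiableAt (n := ∞) (by simp)) hf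

lemma coordVec_mfderivWithin {f : N → M} {S : Set N} {z : N} {p₀ : M}
    (hz : f z ∈ (chartAt E p₀).source) (hf : MDifferentiableWithinAt 𝓘(ℝ, N) 𝓘(ℝ, E) f S z)
    (hS : UniqueDiffWithinAt ℝ S z) (n : N) :
    coordVec p₀ (f z) (mfderivWithin 𝓘(ℝ, N) 𝓘(ℝ, E) f S z n) =
      fderivWithin ℝ (mapRep E p₀ f) S z n := by
  have h := mfderiv_comp_mfderivWithin z
    ((contMDiffAt_extChartAt' hz).mdifferentiableAt (n := ∞) (by simp)) hf
    (uniqueMDiffWithinAt_iff_uniqueDiffWithinAt.2 hS)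
  rw [mfderivWithin_eq_fderivWithin] at h
  rw [coordVec_eq_mfderiv hz]
  exact (congrArg (fun A : N →L[ℝ] E ↦ A n) h).symm

lemma alongRep_eq_coordChangeRep {f : N → M} {X : Π z, TangentSpace 𝓘(ℝ, E) (f z)} {z : N}
    {p₀ p₁ : M} (hz : f z ∈ (chartAt E p₀).source) (hz₁ : f z ∈ (chartAt E p₁).source) :
    alongRep p₀ f X z = coordChangeRep p₁ p₀ (mapRep E p₀ f z) (alongRep p₁ f X z) := by
  rw [mapRep, coordChangeRep_apply hz hz₁, ← ofCoordVec_apply hz₁, alongRep, alongRep,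
    ofCoordVec_coordVec hz₁]

/-- Smoothness of a field along a map, in coordinates. -/
lemma contMDiffWithinAt_along_iff {f : N → M} {X : Π z, TangentSpace 𝓘(ℝ, E) (f z)}
    {S : Set N} {z : N} {p₀ : M} (hz : f z ∈ (chartAt E p₀).source) :
    ContMDiffWithinAt 𝓘(ℝ, N) 𝓘(ℝ, E).tangent ∞
      (fun z ↦ (⟨f z, X z⟩ : TangentBundle 𝓘(ℝ, E) M)) S z ↔
    ContMDiffWithinAt 𝓘(ℝ, N) 𝓘(ℝ, E) ∞ f S z ∧
      ContDiffWithinAt ℝ ∞ (alongRep p₀ f X) S z := by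
  refine (Trivialization.contMDiffWithinAt_iff
    (e := trivializationAt E (TangentSpace 𝓘(ℝ, E) : M → Type _) p₀) (by simpa using hz)).trans ?_
  refine and_congr_right fun hf ↦ ?_
  rw [contMDiffWithinAt_iff_contDiffWithinAt]
  have h : (fun x ↦ (trivializationAt E (TangentSpace 𝓘(ℝ, E) : M → Type _) p₀ ⟨f x, X x⟩).2)
      =ᶠ[𝓝[S] z] alongRep p₀ f X := by
    filter_upwards [eventually_mem_chart_source hf.continuousWithinAt hz] with y hy
    exact (coordVec_apply hy _).symm
  exact ⟨fun h' ↦ h'.congr_of_eventuallyEq h.symm (coordVec_apply hz _),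
    fun h' ↦ h'.congr_of_eventuallyEq h (coordVec_apply hz _).symm⟩

variable {γ : ℝ → M} {J : Set ℝ} {t : ℝ} {p₀ : M} {X : Π t, TangentSpace 𝓘(ℝ, E) (γ t)}

lemma coordVec_curveVelocity (ht : γ t ∈ (chartAt E p₀).source)
    (hγ : MDifferentiableWithinAt 𝓘(ℝ, ℝ) 𝓘(ℝ, E) γ J t) (hJ : UniqueDiffWithinAt ℝ J t) :
    coordVec p₀ (γ t) (curveVelocity J γ t) = derivWithin (mapRep E p₀ γ) J t :=
  coordVec_mfderivWithin ht hγ hJ _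

lemma differentiableWithinAt_alongRep_change {p₁ : M} (ht : γ t ∈ (chartAt E p₀).source)
    (ht₁ : γ t ∈ (chartAt E p₁).source) (hγ : MDifferentiableWithinAt 𝓘(ℝ, ℝ) 𝓘(ℝ, E) γ J t)
    (hX : DifferentiableWithinAt ℝ (alongRep p₁ γ X) J t) :
    DifferentiableWithinAt ℝ (alongRep p₀ γ X) J t := by
  have hm := differentiableWithinAt_mapRep ht hγ
  have h := (((contDiffAt_coordChangeRep ht ht₁).differentiableAt
    (by simp)).comp_differentiableWithinAt t hm).clm_apply hX
  refine h.congr_of_eventuallyEq ?_ (alongRep_eq_coordChangeRep ht ht₁)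
  filter_upwards [eventually_mem_chart_source hγ.continuousWithinAt ht,
    eventually_mem_chart_source hγ.continuousWithinAt ht₁] with y hy hy₁
  exact alongRep_eq_coordChangeRep hy hy₁

/-- The covariant derivative along a curve in coordinates. -/
lemma HasChristoffel.coordVec_covAlong {D : ConnectionOperator E M}
    {Γ : M → E → E →L[ℝ] E →L[ℝ] E} (h : HasChristoffel D Γ)
    (ht : γ t ∈ (chartAt E p₀).source) (hγ : MDifferentiableWithinAt 𝓘(ℝ, ℝ) 𝓘(ℝ, E) γ J t)
    (hJ : UniqueDiffWithinAt ℝ J t) (hX : DifferentiableWithinAt ℝ (alongRep p₀ γ X) J t) :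
    coordVec p₀ (γ t) (covAlong D J γ X t) = derivWithin (alongRep p₀ γ X) J t +
      Γ p₀ (mapRep E p₀ γ t) (alongRep p₀ γ X t) (derivWithin (mapRep E p₀ γ) J t) := by
  have ht₁ := mem_chart_source E (γ t)
  have hm := differentiableWithinAt_mapRep ht hγ
  have hX₁ := differentiableWithinAt_alongRep_change ht₁ ht hγ hX
  have hC := (contDiffAt_coordChangeRep ht ht₁).differentiableAt (by simp)
  have hev := eventually_mem_chart_source hγ.continuousWithinAt ht
  have hev₁ := eventually_mem_chart_source hγ.continuousWithinAt ht₁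
  have e1 : derivWithin (fun s ↦ (trivializationAt E (TangentSpace 𝓘(ℝ, E) : M → Type _) (γ t)
      ⟨γ s, X s⟩).2) J t = derivWithin (alongRep (γ t) γ X) J t := by
    refine EventuallyEq.derivWithin_eq ?_ (_root_.coordVec_apply ht₁ _).symm
    filter_upwards [hev₁] with s hs
    exact (_root_.coordVec_apply hs _).symm
  have e2 : derivWithin (alongRep p₀ γ X) J t = derivWithin (fun s ↦ coordChangeRep (γ t) p₀
      (mapRep E p₀ γ s) (alongRep (γ t) γ X s)) J t := by
    refine EventuallyEq.derivWithin_eq ?_ (alongRep_eq_coordChangeRep ht ht₁)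
    filter_upwards [hev, hev₁] with s hs hs₁
    exact alongRep_eq_coordChangeRep hs hs₁
  -- The definition differentiates components in the trivialization at `γ t`, whereas the claim uses
  -- the chart at `p₀`. The discrepancy is the derivative of the frame change with `X t` frozen,
  -- which is also the flat part of `∇` of the extension of `X t`.
  have e3 := derivWithin_clm_apply_comp hC hm.hasDerivWithinAt hX₁.hasDerivWithinAt hJ
  have hext := (contMDiffAt_field_extend (γ t) (X t)).mdifferentiableAt (by simp)
  have hself : (FiberBundle.extend E (X t) : Π q, TangentSpace 𝓘(ℝ, E) q) (γ t) = X t :=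
    FiberBundle.extend_apply_self E _
  rw [covAlong, map_add, h.coordVec_apply ht hext, hself, e1, ← coordChangeRep_apply ht ht₁, e2,
    (fieldRep_extend_eventuallyEq ht ht₁ (X t)).fderiv_eq, coordVec_curveVelocity ht hγ hJ]
  rw [e3, add_assoc]
  exact add_left_comm _ _ _

lemma covAlong_congr {D : ConnectionOperator E M} {Y : Π t, TangentSpace 𝓘(ℝ, E) (γ t)}
    (h : ∀ᶠ s in 𝓝[J] t, X s = Y s) (ht : X t = Y t) : covAlong D J γ X t = covAlong D J γ Y t := by
  have : derivWithin (fun s ↦ (trivializationAt E (TangentSpace 𝓘(ℝ, E) : M → Type _) (γ t)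
      ⟨γ s, X s⟩).2) J t = derivWithin (fun s ↦ (trivializationAt E
        (TangentSpace 𝓘(ℝ, E) : M → Type _) (γ t) ⟨γ s, Y s⟩).2) J t := by
    refine EventuallyEq.derivWithin_eq ?_ (by rw [ht])
    filter_upwards [h] with s hs
    rw [hs]
  rw [covAlong, covAlong, this, ht]

end Along
end

noncomputable section

/-! ### Christoffel symbols of a covariant derivative -/

section Christoffel

variable {E : Type*} [NormedAddCommGroup E] [NormedSpace ℝ E]
  {M : Type*} [TopologicalSpace M] [ChartedSpace E M] [IsManifold 𝓘(ℝ, E) ∞ M]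

/-- The field with constant coordinates `w` in the chart at `p₀`. -/
def constField (p₀ : M) (w : E) (q : M) : TangentSpace 𝓘(ℝ, E) q := ofCoordVec p₀ q w

lemma fieldRep_constField {p₀ : M} {x : E} (hx : x ∈ (extChartAt 𝓘(ℝ, E) p₀).target) (w : E) :
    fieldRep p₀ (constField p₀ w) x = w :=
  coordVec_ofCoordVec (extChartAt_symm_mem_source hx) w

lemma fieldRep_constField_eventuallyEq {p₀ q : M} (hq : q ∈ (chartAt E p₀).source) (w : E) :
    fieldRep p₀ (constField p₀ w) =ᶠ[𝓝 (extChartAt 𝓘(ℝ, E) p₀ q)] fun _ ↦ w := by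
  filter_upwards [extChartAt_target_mem_nhds_of_mem hq] with x hx
  exact fieldRep_constField hx w

lemma contMDiffAt_constField {p₀ q : M} (hq : q ∈ (chartAt E p₀).source) (w : E) :
    ContMDiffAt 𝓘(ℝ, E) 𝓘(ℝ, E).tangent ∞
      (fun q ↦ (⟨q, constField p₀ w q⟩ : TangentBundle 𝓘(ℝ, E) M)) q :=
  (contMDiffAt_field_iff hq).2
    (contDiffAt_const.congr_of_eventuallyEq (fieldRep_constField_eventuallyEq hq w))

/-- The flat connection of the chart at `p₀`. -/
def chartConnection (p₀ : M) : ConnectionOperator E M := fun X q ↦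
  (ofCoordVec p₀ q).comp ((fderiv ℝ (fieldRep p₀ X) (extChartAt 𝓘(ℝ, E) p₀ q)).comp
    (coordVec p₀ q))

/-- The difference of two covariant derivatives is a tensor. Comparison with the flat connection of
the chart, over its source, therefore yields Christoffel symbols. -/
lemma isCovariantDerivativeOn_chartConnection (p₀ : M) :
    IsCovariantDerivativeOn (I := 𝓘(ℝ, E)) (V := fun p : M ↦ TangentSpace 𝓘(ℝ, E) p) E
      (chartConnection p₀) (chartAt E p₀).source where
  add {σ σ' q} hσ hσ' hq := by
    have h1 := (mdifferentiableAt_field_iff hq).1 hσ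
    have h2 := (mdifferentiableAt_field_iff hq).1 hσ'
    have h3 : fieldRep p₀ (σ + σ') = fieldRep p₀ σ + fieldRep p₀ σ' := by
      funext x
      exact map_add _ _ _
    refine ContinuousLinearMap.ext fun v ↦ ?_
    simp only [chartConnection, h3, fderiv_add h1 h2]
    exact map_add (ofCoordVec p₀ q) _ _
  leibniz {σ g q} hσ hg hq := by
    have h1 := (mdifferentiableAt_field_iff hq).1 hσ
    have h2 := (mdifferentiableAt_iff_differentiableAt_comp_symm hq).1 hg
    have h3 : fieldRep p₀ (g • σ) =
        fun x ↦ (g ∘ (extChartAt 𝓘(ℝ, E) p₀).symm) x • fieldRep p₀ σ x := by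
      funext x
      exact map_smul (coordVec p₀ ((extChartAt 𝓘(ℝ, E) p₀).symm x)) _ _
    refine ContinuousLinearMap.ext fun v ↦ ?_
    have h4 := mfderiv_apply_eq_fderiv hq hg v
    have h5 : (g ∘ (extChartAt 𝓘(ℝ, E) p₀).symm) (extChartAt 𝓘(ℝ, E) p₀ q) = g q := by
      rw [Function.comp_apply, extChartAt_left_inv hq]
    have h6 : ofCoordVec p₀ q (fderiv ℝ (fieldRep p₀ (g • σ)) (extChartAt 𝓘(ℝ, E) p₀ q)
        (coordVec p₀ q v)) = g q • ofCoordVec p₀ q (fderiv ℝ (fieldRep p₀ σ)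
          (extChartAt 𝓘(ℝ, E) p₀ q) (coordVec p₀ q v)) +
        fderiv ℝ (g ∘ (extChartAt 𝓘(ℝ, E) p₀).symm) (extChartAt 𝓘(ℝ, E) p₀ q)
          (coordVec p₀ q v) • σ q := by
      rw [h3, fderiv_fun_smul h2 h1]
      simp only [_root_.add_apply, _root_.smul_apply,
        ContinuousLinearMap.smulRight_apply, map_add, map_smul, h5, fieldRep_extChartAt hq,
        ofCoordVec_coordVec hq]
    exact h6.trans (congrArg (fun c : ℝ ↦ g q • ofCoordVec p₀ q (fderiv ℝ (fieldRep p₀ σ)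
      (extChartAt 𝓘(ℝ, E) p₀ q) (coordVec p₀ q v)) + c • σ q) h4.symm)

variable [FiniteDimensional ℝ E]

/-- The Christoffel symbols of a covariant derivative. -/
def christoffel (nabla : CovariantDerivative 𝓘(ℝ, E) E (fun p : M ↦ TangentSpace 𝓘(ℝ, E) p))
    (p₀ : M) (x : E) : E →L[ℝ] E →L[ℝ] E :=
  let q := (extChartAt 𝓘(ℝ, E) p₀).symm x
  let δ : TangentSpace 𝓘(ℝ, E) q →L[ℝ] TangentSpace 𝓘(ℝ, E) q →L[ℝ] TangentSpace 𝓘(ℝ, E) q :=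
    (nabla.isCovariantDerivativeOn).difference (isCovariantDerivativeOn_chartConnection p₀) q
  LinearMap.toContinuousLinearMap
    { toFun := fun w ↦ (coordVec p₀ q).comp ((δ (ofCoordVec p₀ q w)).comp (ofCoordVec p₀ q))
      map_add' := fun u v ↦ by
        refine ContinuousLinearMap.ext fun z ↦ ?_
        simp
      map_smul' := fun c v ↦ by
        refine ContinuousLinearMap.ext fun z ↦ ?_
        simp }

lemma christoffel_apply
    (nabla : CovariantDerivative 𝓘(ℝ, E) E (fun p : M ↦ TangentSpace 𝓘(ℝ, E) p))
    {p₀ q : M} (hq : q ∈ (chartAt E p₀).source) {X : Π q : M, TangentSpace 𝓘(ℝ, E) q}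
    (hX : MDifferentiableAt 𝓘(ℝ, E) 𝓘(ℝ, E).tangent
      (fun q ↦ (⟨q, X q⟩ : TangentBundle 𝓘(ℝ, E) M)) q) (v : TangentSpace 𝓘(ℝ, E) q) :
    christoffel nabla p₀ (extChartAt 𝓘(ℝ, E) p₀ q) (coordVec p₀ q (X q)) (coordVec p₀ q v) =
      coordVec p₀ q (nabla X q v)
        - fderiv ℝ (fieldRep p₀ X) (extChartAt 𝓘(ℝ, E) p₀ q) (coordVec p₀ q v) := by
  have h := IsCovariantDerivativeOn.difference_apply (nabla.isCovariantDerivativeOn)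
    (isCovariantDerivativeOn_chartConnection p₀) hq hX
  have h1 : christoffel nabla p₀ (extChartAt 𝓘(ℝ, E) p₀ q) (coordVec p₀ q (X q))
      (coordVec p₀ q v) = coordVec p₀ q ((nabla.isCovariantDerivativeOn).difference
        (isCovariantDerivativeOn_chartConnection p₀) q (X q) v) := by
    simp only [christoffel, LinearMap.coe_toContinuousLinearMap', LinearMap.coe_mk, AddHom.coe_mk,
      ContinuousLinearMap.comp_apply]
    rw [extChartAt_left_inv hq, ofCoordVec_coordVec hq, ofCoordVec_coordVec hq]
  rw [h1, h]
  have h2 : coordVec p₀ q ((nabla X q - chartConnection p₀ X q) v) =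
    coordVec p₀ q (nabla X q v) - coordVec p₀ q (chartConnection p₀ X q v) := map_sub _ _ _
  refine h2.trans ?_
  congr 1
  exact coordVec_ofCoordVec hq _

/-- Smoothness of `nabla` is applied to a globally smooth field, while a constant coordinate field
is smooth only over the chart. A bump function at `q` extends it by zero, globally smoothly since
`M` is Hausdorff, and locality of `nabla` removes the bump function near `q`. -/
lemma contMDiffAt_covariant_constField [T2Space M]
    {nabla : CovariantDerivative 𝓘(ℝ, E) E (fun p : M ↦ TangentSpace 𝓘(ℝ, E) p)}
    (hn : CovariantDerivative.ContMDiffCovariantDerivative nabla ∞)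
    {p₀ q : M} (hq : q ∈ (chartAt E p₀).source) (w v : E) :
    ContMDiffAt 𝓘(ℝ, E) 𝓘(ℝ, E).tangent ∞ (fun r ↦ (⟨r, nabla (constField p₀ w) r
      (constField p₀ v r)⟩ : TangentBundle 𝓘(ℝ, E) M)) q := by
  obtain ⟨β, -, hβ⟩ := (SmoothBumpFunction.nhds_basis_tsupport (I := 𝓘(ℝ, E)) q).mem_iff.1
    ((chartAt E p₀).open_source.mem_nhds hq)
  have hσ : ContMDiff 𝓘(ℝ, E) 𝓘(ℝ, E).tangent ∞ (fun r ↦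
      (⟨r, β r • constField p₀ w r⟩ : TangentBundle 𝓘(ℝ, E) M)) :=
    ContMDiffOn.smul_section_of_tsupport β.contMDiff.contMDiffOn (chartAt E p₀).open_source hβ
      fun r hr ↦ (contMDiffAt_constField hr w).contMDiffWithinAt
  have h1 := (hn.contMDiff.contMDiff hσ.contMDiffOn).contMDiffAt (x := q) univ_mem
  have h2 := h1.clm_bundle_apply (contMDiffAt_constField hq v)
  refine h2.congr_of_eventuallyEq ?_
  filter_upwards [β.eventuallyEq_one.eventually_nhds, (chartAt E p₀).open_source.mem_nhds hq]
    with r hr hr'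
  have h3 : nabla (fun r ↦ β r • constField p₀ w r) r = nabla (constField p₀ w) r := by
    refine (nabla.isCovariantDerivativeOn).congr_of_eventuallyEq
      ((hσ r).mdifferentiableAt (by simp)) ((contMDiffAt_constField hr' w).mdifferentiableAt
        (by simp)) univ_mem ?_
    filter_upwards [hr] with y hy
    rw [hy, Pi.one_apply, one_smul]
  rw [h3]

lemma hasChristoffel_christoffel [T2Space M]
    {nabla : CovariantDerivative 𝓘(ℝ, E) E (fun p : M ↦ TangentSpace 𝓘(ℝ, E) p)}
    (hn : CovariantDerivative.ContMDiffCovariantDerivative nabla ∞) :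
    HasChristoffel nabla.toFun (christoffel nabla) where
  smooth p₀ := by
    -- In finite dimension it suffices to evaluate on fixed vectors. The flat derivative of a
    -- constant field vanishes, so `Γ w v` is the coordinate expression of `nabla` on constant
    -- fields.
    refine contDiffOn_clm_apply.2 fun w ↦ contDiffOn_clm_apply.2 fun v ↦ ?_
    intro x hx
    have hq := extChartAt_symm_mem_source hx
    have h := (contMDiffAt_field_iff hq).1 (contMDiffAt_covariant_constField hn hq w v)
    rw [(extChartAt 𝓘(ℝ, E) p₀).right_inv hx] at h
    refine (h.congr_of_eventuallyEq ?_).contDiffWithinAt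
    filter_upwards [(isOpen_extChartAt_target p₀).mem_nhds hx] with y hy
    have hy' := extChartAt_symm_mem_source hy
    have h1 := christoffel_apply nabla hy' ((contMDiffAt_constField hy' w).mdifferentiableAt
      (by simp)) (constField p₀ v _)
    rw [(fieldRep_constField_eventuallyEq hy' w).fderiv_eq, fderiv_fun_const,
      (extChartAt 𝓘(ℝ, E) p₀).right_inv hy, constField, constField, coordVec_ofCoordVec hy',
      coordVec_ofCoordVec hy'] at h1
    rw [h1]
    simp [fieldRep, constField]
  coordVec_apply {p₀ q} hq X hX v := by
    rw [christoffel_apply nabla hq hX v]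
    abel

end Christoffel
end

noncomputable section

/-! ### Foliated charts in coordinates -/

namespace SmoothFoliation

variable {E' : Type*} [NormedAddCommGroup E'] [NormedSpace ℝ E']
  {E'' : Type*} [NormedAddCommGroup E''] [NormedSpace ℝ E'']
  {E : Type*} [NormedAddCommGroup E] [NormedSpace ℝ E]
  {M : Type*} [TopologicalSpace M] [ChartedSpace E M]

/-- The coordinate change from the chart at `p₀` to the foliated chart `ψ`. -/
def toFoliated (p₀ : M) (ψ : OpenPartialHomeomorph M (E' × E'')) (x : E) : E' × E'' :=
  ψ ((extChartAt 𝓘(ℝ, E) p₀).symm x)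

variable (E) in
/-- The coordinate change from the foliated chart `ψ` to the chart at `p₀`. -/
def ofFoliated (p₀ : M) (ψ : OpenPartialHomeomorph M (E' × E'')) (z : E' × E'') : E :=
  extChartAt 𝓘(ℝ, E) p₀ (ψ.symm z)

/-- The leaf directions of the foliated chart `ψ` in the coordinates of the chart at `p₀`. -/
def leafFrame (p₀ : M) (ψ : OpenPartialHomeomorph M (E' × E'')) (x : E) : E'' →L[ℝ] E :=
  (fderiv ℝ (ofFoliated E p₀ ψ) (toFoliated p₀ ψ x)).comp (ContinuousLinearMap.inr ℝ E' E'')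

variable [IsManifold 𝓘(ℝ, E) ∞ M] {F : SmoothFoliation E' E'' E M}
  {ψ ψ' : OpenPartialHomeomorph M (E' × E'')} {p₀ q : M}

lemma contDiffAt_toFoliated (hψ : ψ ∈ F.charts) (hq : q ∈ (chartAt E p₀).source)
    (hqψ : q ∈ ψ.source) :
    ContDiffAt ℝ ∞ (toFoliated (E := E) p₀ ψ) (extChartAt 𝓘(ℝ, E) p₀ q) :=
  (contMDiffAt_iff_contDiffAt_comp_symm hq).1
    ((F.contMDiffOn ψ hψ).contMDiffAt (ψ.open_source.mem_nhds hqψ))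

lemma contDiffAt_ofFoliated (hψ : ψ ∈ F.charts) (hq : q ∈ (chartAt E p₀).source)
    (hqψ : q ∈ ψ.source) : ContDiffAt ℝ ∞ (ofFoliated E p₀ ψ) (ψ q) := by
  rw [← contMDiffAt_iff_contDiffAt]
  refine ContMDiffAt.comp (I' := 𝓘(ℝ, E)) _ ?_ ((F.contMDiffOn_symm ψ hψ).contMDiffAt
    (ψ.open_target.mem_nhds (ψ.map_source hqψ)))
  rw [ψ.left_inv hqψ]
  exact contMDiffAt_extChartAt' hq

omit [IsManifold 𝓘(ℝ, E) ∞ M] in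
lemma toFoliated_extChartAt (hq : q ∈ (chartAt E p₀).source) :
    toFoliated p₀ ψ (extChartAt 𝓘(ℝ, E) p₀ q) = ψ q := by
  rw [toFoliated, extChartAt_left_inv hq]

lemma eventually_symm_extChartAt_mem (hq : q ∈ (chartAt E p₀).source) {W : Set M} (hW : W ∈ 𝓝 q) :
    ∀ᶠ x in 𝓝 (extChartAt 𝓘(ℝ, E) p₀ q), (extChartAt 𝓘(ℝ, E) p₀).symm x ∈ W := by
  have h : ContinuousAt (extChartAt 𝓘(ℝ, E) p₀).symm (extChartAt 𝓘(ℝ, E) p₀ q) :=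
    (contMDiffAt_extChartAt_symm (extChartAt_mem_target hq)).continuousAt
  refine h.preimage_mem_nhds ?_
  rwa [extChartAt_left_inv hq]

omit [IsManifold 𝓘(ℝ, E) ∞ M] in
lemma eventually_symm_foliated_mem (hqψ : q ∈ ψ.source) {W : Set M} (hW : W ∈ 𝓝 q) :
    ∀ᶠ z in 𝓝 (ψ q), ψ.symm z ∈ W := by
  have h := ψ.continuousAt_symm (ψ.map_source hqψ)
  refine h.preimage_mem_nhds ?_
  rwa [ψ.left_inv hqψ]

lemma ofFoliated_toFoliated_eventually (hq : q ∈ (chartAt E p₀).source) (hqψ : q ∈ ψ.source) :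
    ofFoliated E p₀ ψ ∘ toFoliated p₀ ψ =ᶠ[𝓝 (extChartAt 𝓘(ℝ, E) p₀ q)] id := by
  filter_upwards [eventually_symm_extChartAt_mem hq (ψ.open_source.mem_nhds hqψ),
    extChartAt_target_mem_nhds_of_mem hq] with x hx hx'
  rw [Function.comp_apply, ofFoliated, toFoliated, ψ.left_inv hx,
    (extChartAt 𝓘(ℝ, E) p₀).right_inv hx', id]

omit [IsManifold 𝓘(ℝ, E) ∞ M] in
lemma toFoliated_ofFoliated_eventually (hq : q ∈ (chartAt E p₀).source) (hqψ : q ∈ ψ.source)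
    (ψ' : OpenPartialHomeomorph M (E' × E'')) :
    toFoliated (E := E) p₀ ψ' ∘ ofFoliated E p₀ ψ =ᶠ[𝓝 (ψ q)] ψ' ∘ ψ.symm := by
  filter_upwards [eventually_symm_foliated_mem hqψ ((chartAt E p₀).open_source.mem_nhds hq)]
    with z hz
  rw [Function.comp_apply, ofFoliated, toFoliated, extChartAt_left_inv hz, Function.comp_apply]

lemma fderiv_ofFoliated_toFoliated (hψ : ψ ∈ F.charts) (hq : q ∈ (chartAt E p₀).source)
    (hqψ : q ∈ ψ.source) (w : E) :
    fderiv ℝ (ofFoliated E p₀ ψ) (ψ q)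
      (fderiv ℝ (toFoliated p₀ ψ) (extChartAt 𝓘(ℝ, E) p₀ q) w) = w := by
  have h1 := (contDiffAt_toFoliated hψ hq hqψ).differentiableAt (by simp)
  have h2 := (contDiffAt_ofFoliated hψ hq hqψ).differentiableAt (by simp)
  rw [← toFoliated_extChartAt hq (ψ := ψ)] at h2 ⊢
  have h3 := (ofFoliated_toFoliated_eventually hq hqψ).fderiv_eq (𝕜 := ℝ)
  rw [fderiv_comp _ h2 h1, fderiv_id] at h3
  exact DFunLike.congr_fun h3 w

lemma fderiv_toFoliated_ofFoliated (hψ : ψ ∈ F.charts) (hψ' : ψ' ∈ F.charts)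
    (hq : q ∈ (chartAt E p₀).source) (hqψ : q ∈ ψ.source) (hqψ' : q ∈ ψ'.source) (z : E' × E'') :
    fderiv ℝ (toFoliated (E := E) p₀ ψ') (extChartAt 𝓘(ℝ, E) p₀ q)
      (fderiv ℝ (ofFoliated E p₀ ψ) (ψ q) z) = fderiv ℝ (ψ' ∘ ψ.symm) (ψ q) z := by
  have h1 := (contDiffAt_toFoliated hψ' hq hqψ').differentiableAt (by simp)
  have h2 := (contDiffAt_ofFoliated hψ hq hqψ).differentiableAt (by simp)
  have h4 : ofFoliated E p₀ ψ (ψ q) = extChartAt 𝓘(ℝ, E) p₀ q := by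
    rw [ofFoliated, ψ.left_inv hqψ]
  rw [← h4] at h1 ⊢
  rw [← (toFoliated_ofFoliated_eventually hq hqψ ψ').fderiv_eq, fderiv_comp _ h1 h2]
  rfl

lemma submersionDeriv_apply (hψ : ψ ∈ F.charts) (hq : q ∈ (chartAt E p₀).source)
    (hqψ : q ∈ ψ.source) (v : TangentSpace 𝓘(ℝ, E) q) :
    submersionDeriv ψ q v =
      (fderiv ℝ (toFoliated p₀ ψ) (extChartAt 𝓘(ℝ, E) p₀ q) (coordVec p₀ q v)).1 := by
  have h1 := (contDiffAt_toFoliated hψ hq hqψ).differentiableAt (by simp)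
  have h2 : MDifferentiableAt 𝓘(ℝ, E) 𝓘(ℝ, E') (fun q ↦ (ψ q).1) q :=
    (mdifferentiableAt_iff_differentiableAt_comp_symm hq).2 h1.fst
  exact (mfderiv_apply_eq_fderiv hq h2 v).trans
    (congrArg (fun A : E →L[ℝ] E' ↦ A (coordVec p₀ q v)) (fderiv.fst h1))

lemma leafFrame_extChartAt (hq : q ∈ (chartAt E p₀).source) (w : E'') :
    leafFrame p₀ ψ (extChartAt 𝓘(ℝ, E) p₀ q) w = fderiv ℝ (ofFoliated E p₀ ψ) (ψ q) (0, w) := by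
  rw [leafFrame, toFoliated_extChartAt hq]
  rfl

lemma fderiv_toFoliated_leafFrame (hψ : ψ ∈ F.charts)
    (hq : q ∈ (chartAt E p₀).source) (hqψ : q ∈ ψ.source) (w : E'') :
    fderiv ℝ (toFoliated (E := E) p₀ ψ) (extChartAt 𝓘(ℝ, E) p₀ q)
      (leafFrame p₀ ψ (extChartAt 𝓘(ℝ, E) p₀ q) w) = (0, w) := by
  rw [leafFrame_extChartAt hq, fderiv_toFoliated_ofFoliated hψ hψ hq hqψ hqψ]
  have h : ψ ∘ ψ.symm =ᶠ[𝓝 (ψ q)] id := by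
    filter_upwards [ψ.open_target.mem_nhds (ψ.map_source hqψ)] with z hz
    exact ψ.right_inv hz
  rw [h.fderiv_eq, fderiv_id]
  rfl

/-- The leaf directions of one foliated chart are vertical in any other one. -/
lemma fst_fderiv_foliated_comp (hψ : ψ ∈ F.charts) (hψ' : ψ' ∈ F.charts)
    (hqψ : q ∈ ψ.source) (hqψ' : q ∈ ψ'.source) (w : E'') :
    (fderiv ℝ (ψ' ∘ ψ.symm) (ψ q) (0, w)).1 = 0 := by
  have hq := mem_chart_source E q
  have h1 : DifferentiableAt ℝ (ψ' ∘ ψ.symm) (ψ q) := by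
    rw [← mdifferentiableAt_iff_differentiableAt]
    refine MDifferentiableAt.comp (I' := 𝓘(ℝ, E)) _ ?_ (((F.contMDiffOn_symm ψ hψ).contMDiffAt
      (ψ.open_target.mem_nhds (ψ.map_source hqψ))).mdifferentiableAt (by simp))
    rw [ψ.left_inv hqψ]
    exact ((F.contMDiffOn ψ' hψ').contMDiffAt (ψ'.open_source.mem_nhds hqψ')).mdifferentiableAt
      (by simp)
  obtain ⟨W, hW, hWc⟩ := F.compatible ψ hψ ψ' hψ' q ⟨hqψ, hqψ'⟩
  -- Compatibility is a statement about points of one plaque. It is differentiated along a line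
  -- inside the plaque of `ψ`, on which the transverse coordinate of `ψ'` is constant near `q`.
  have hl : HasDerivAt (fun t : ℝ ↦ ψ q + t • ((0 : E'), w)) ((0 : E'), w) 0 := by
    simpa using ((hasDerivAt_id (0 : ℝ)).smul_const ((0 : E'), w)).const_add (ψ q)
  have h0 : ψ q + (0 : ℝ) • ((0 : E'), w) = ψ q := by simp
  have h2 : HasDerivAt (fun t : ℝ ↦ ((ψ' ∘ ψ.symm) (ψ q + t • ((0 : E'), w))).1)
      (fderiv ℝ (ψ' ∘ ψ.symm) (ψ q) (0, w)).1 0 := by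
    have h3 := h1.hasFDerivAt
    rw [← h0] at h3
    have h4 := (ContinuousLinearMap.fst ℝ E' E'').hasFDerivAt.comp_hasDerivAt 0
      (h3.comp_hasDerivAt 0 hl)
    rwa [h0] at h4
  have hc : Tendsto (fun t : ℝ ↦ ψ q + t • ((0 : E'), w)) (𝓝 0) (𝓝 (ψ q)) := by
    have := hl.continuousAt.tendsto
    rwa [h0] at this
  have h5 : (fun t : ℝ ↦ ((ψ' ∘ ψ.symm) (ψ q + t • ((0 : E'), w))).1) =ᶠ[𝓝 0]
      fun _ ↦ (ψ' q).1 := by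
    filter_upwards [hc.eventually (eventually_symm_foliated_mem hqψ hW),
      hc.eventually (ψ.open_target.mem_nhds (ψ.map_source hqψ))] with t ht ht'
    refine hWc _ ht _ (mem_of_mem_nhds hW) ?_
    rw [ψ.right_inv ht']
    simp
  exact h2.unique ((hasDerivAt_const (0 : ℝ) (ψ' q).1).congr_of_eventuallyEq h5)

/-- One foliated chart suffices to test verticality: the kernel of its submersion consists of its
leaf directions, and these are vertical in every other chart. -/
lemma mem_vert_iff_fst (hψ : ψ ∈ F.charts) (hq : q ∈ (chartAt E p₀).source)
    (hqψ : q ∈ ψ.source) {v : TangentSpace 𝓘(ℝ, E) q} :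
    v ∈ F.vert q ↔
      (fderiv ℝ (toFoliated p₀ ψ) (extChartAt 𝓘(ℝ, E) p₀ q) (coordVec p₀ q v)).1 = 0 := by
  constructor
  · intro h
    rw [← submersionDeriv_apply hψ hq hqψ]
    exact h ψ hψ hqψ
  · intro h ψ' hψ' hqψ'
    rw [submersionDeriv_apply hψ' hq hqψ', ← fderiv_ofFoliated_toFoliated hψ hq hqψ (coordVec p₀ q v),
      fderiv_toFoliated_ofFoliated hψ hψ' hq hqψ hqψ']
    set z := fderiv ℝ (toFoliated p₀ ψ) (extChartAt 𝓘(ℝ, E) p₀ q) (coordVec p₀ q v)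
    have hz : z = (0, z.2) := Prod.ext h rfl
    rw [hz]
    exact fst_fderiv_foliated_comp hψ hψ' hqψ hqψ' _

/-- Parametrizes the varying vertical spaces by the fixed space `E''`, smoothly in the base point.
This is what makes the orthogonal projection computable by a Gram matrix. -/
lemma mem_vert_iff_leafFrame (hψ : ψ ∈ F.charts) (hq : q ∈ (chartAt E p₀).source)
    (hqψ : q ∈ ψ.source) {v : TangentSpace 𝓘(ℝ, E) q} :
    v ∈ F.vert q ↔ ∃ w, coordVec p₀ q v = leafFrame p₀ ψ (extChartAt 𝓘(ℝ, E) p₀ q) w := by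
  rw [mem_vert_iff_fst hψ hq hqψ]
  constructor
  · intro h
    refine ⟨(fderiv ℝ (toFoliated p₀ ψ) (extChartAt 𝓘(ℝ, E) p₀ q) (coordVec p₀ q v)).2, ?_⟩
    rw [leafFrame_extChartAt hq]
    conv_lhs => rw [← fderiv_ofFoliated_toFoliated hψ hq hqψ (coordVec p₀ q v)]
    congr 1
    exact Prod.ext h rfl
  · rintro ⟨w, hw⟩
    rw [hw, fderiv_toFoliated_leafFrame hψ hq hqψ]

lemma contDiffAt_leafFrame (hψ : ψ ∈ F.charts) (hq : q ∈ (chartAt E p₀).source)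
    (hqψ : q ∈ ψ.source) :
    ContDiffAt ℝ ∞ (leafFrame (E := E) p₀ ψ) (extChartAt 𝓘(ℝ, E) p₀ q) := by
  have h1 := contDiffAt_ofFoliated hψ hq hqψ
  rw [← toFoliated_extChartAt hq (ψ := ψ)] at h1
  exact ((h1.fderiv_right (m := ∞) (by simp)).comp _ (contDiffAt_toFoliated hψ hq hqψ)).clm_comp
    contDiffAt_const

end SmoothFoliation
end

noncomputable section

/-! ### The vertical projection and the adapted connection in coordinates -/

section Metric

variable {E : Type*} [NormedAddCommGroup E] [NormedSpace ℝ E]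
  {M : Type*} [TopologicalSpace M] [ChartedSpace E M] [IsManifold 𝓘(ℝ, E) ∞ M]
  [RiemannianBundle (fun p : M ↦ TangentSpace 𝓘(ℝ, E) p)]

/-- The Riemannian metric in the coordinates of the chart at `p₀`. -/
def metricRep (p₀ : M) (x : E) : E →L[ℝ] E →L[ℝ] ℝ :=
  ContinuousLinearMap.bilinearComp
    (innerSL ℝ (E := TangentSpace 𝓘(ℝ, E) ((extChartAt 𝓘(ℝ, E) p₀).symm x)))
    (ofCoordVec p₀ ((extChartAt 𝓘(ℝ, E) p₀).symm x))
    (ofCoordVec p₀ ((extChartAt 𝓘(ℝ, E) p₀).symm x))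

lemma metricRep_apply {p₀ q : M} (hq : q ∈ (chartAt E p₀).source) (v w : E) :
    metricRep p₀ (extChartAt 𝓘(ℝ, E) p₀ q) v w =
      inner ℝ (ofCoordVec (E := E) p₀ q v) (ofCoordVec (E := E) p₀ q w) := by
  -- The base point occurs in the type of the inner product, so the equality of points is
  -- substituted for a free `r`.
  have h : ∀ r : M, r = q → (inner ℝ (ofCoordVec (E := E) p₀ r v) (ofCoordVec (E := E) p₀ r w) : ℝ) =
      inner ℝ (ofCoordVec (E := E) p₀ q v) (ofCoordVec (E := E) p₀ q w) := by
    rintro r rfl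
    rfl
  exact h _ (extChartAt_left_inv hq)

lemma contDiffOn_metricRep [FiniteDimensional ℝ E]
    [IsContMDiffRiemannianBundle 𝓘(ℝ, E) ∞ E (fun p : M ↦ TangentSpace 𝓘(ℝ, E) p)] (p₀ : M) :
    ContDiffOn ℝ ∞ (metricRep (E := E) p₀) (extChartAt 𝓘(ℝ, E) p₀).target := by
  refine contDiffOn_clm_apply.2 fun v ↦ contDiffOn_clm_apply.2 fun w x hx ↦ ?_
  have hq := extChartAt_symm_mem_source hx
  have h := (contMDiffAt_iff_contDiffAt_comp_symm hq).1
    (ContMDiffAt.inner_bundle (E := fun p : M ↦ TangentSpace 𝓘(ℝ, E) p)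
      (contMDiffAt_constField hq v) (contMDiffAt_constField hq w))
  rw [(extChartAt 𝓘(ℝ, E) p₀).right_inv hx] at h
  exact h.contDiffWithinAt

end Metric

set_option synthInstance.maxHeartbeats 200000 in
lemma ContDiffAt.bilinearComp {U V W : Type*} [NormedAddCommGroup U] [NormedSpace ℝ U]
    [NormedAddCommGroup V] [NormedSpace ℝ V] [NormedAddCommGroup W] [NormedSpace ℝ W]
    {g : U → V →L[ℝ] V →L[ℝ] ℝ} {b : U → W →L[ℝ] V} {x : U} (hg : ContDiffAt ℝ ∞ g x)
    (hb : ContDiffAt ℝ ∞ b x) :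
    ContDiffAt ℝ ∞ (fun y ↦ (g y).bilinearComp (b y) (b y)) x := by
  have h0 : ContDiff ℝ ∞ (ContinuousLinearMap.compL ℝ W V ℝ).flip :=
    ContinuousLinearMap.contDiff (E := W →L[ℝ] V) (F := (V →L[ℝ] ℝ) →L[ℝ] W →L[ℝ] ℝ) _
  have h1 := h0.contDiffAt.comp x hb
  exact h1.clm_comp (hg.clm_comp hb)

lemma finrank_continuousDual (V : Type*) [NormedAddCommGroup V] [NormedSpace ℝ V]
    [FiniteDimensional ℝ V] : Module.finrank ℝ (V →L[ℝ] ℝ) = Module.finrank ℝ V := by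
  rw [← Subspace.dual_finrank_eq (K := ℝ) (V := V)]
  exact (LinearMap.toContinuousLinearMap : (V →ₗ[ℝ] ℝ) ≃ₗ[ℝ] V →L[ℝ] ℝ).finrank_eq.symm

/-- A finite-dimensional space and its dual have the same dimension, so a nondegenerate form is an
isomorphism between them. It is applied to the Gram matrix of the leaf directions. -/
lemma exists_continuousLinearEquiv_of_injective {V : Type*} [NormedAddCommGroup V]
    [NormedSpace ℝ V] [FiniteDimensional ℝ V] {G : V →L[ℝ] V →L[ℝ] ℝ}
    (hG : Function.Injective G) : ∃ e : V ≃L[ℝ] (V →L[ℝ] ℝ), (e : V →L[ℝ] V →L[ℝ] ℝ) = G := by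
  have hs : Function.Surjective (G : V →ₗ[ℝ] V →L[ℝ] ℝ) :=
    (LinearMap.injective_iff_surjective_of_finrank_eq_finrank (finrank_continuousDual V).symm).1 hG
  refine ⟨(LinearEquiv.ofBijective (G : V →ₗ[ℝ] V →L[ℝ] ℝ) ⟨hG, hs⟩).toContinuousLinearEquiv, ?_⟩
  ext v w
  rfl

namespace SmoothFoliation

variable {E' : Type*} [NormedAddCommGroup E'] [NormedSpace ℝ E']
  {E'' : Type*} [NormedAddCommGroup E''] [NormedSpace ℝ E'']
  {E : Type*} [NormedAddCommGroup E] [NormedSpace ℝ E] [FiniteDimensional ℝ E]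
  {M : Type*} [TopologicalSpace M] [ChartedSpace E M] [IsManifold 𝓘(ℝ, E) ∞ M]
  [RiemannianBundle (fun p : M ↦ TangentSpace 𝓘(ℝ, E) p)]
  (F : SmoothFoliation E' E'' E M) {p₀ q : M} {x : E}

lemma vertProj_mem (v : TangentSpace 𝓘(ℝ, E) q) : F.vertProj q v ∈ F.vert q := by
  have : FiniteDimensional ℝ (TangentSpace 𝓘(ℝ, E) q) := inferInstanceAs (FiniteDimensional ℝ E)
  have : CompleteSpace (F.vert q) := FiniteDimensional.complete ℝ (F.vert q)
  exact Submodule.starProjection_apply_mem (F.vert q) v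

lemma vertProj_eq_self_iff {v : TangentSpace 𝓘(ℝ, E) q} : F.vertProj q v = v ↔ v ∈ F.vert q := by
  have : FiniteDimensional ℝ (TangentSpace 𝓘(ℝ, E) q) := inferInstanceAs (FiniteDimensional ℝ E)
  have : CompleteSpace (F.vert q) := FiniteDimensional.complete ℝ (F.vert q)
  exact Submodule.starProjection_eq_self_iff

lemma vertProj_eq {u v : TangentSpace 𝓘(ℝ, E) q} (hv : v ∈ F.vert q)
    (h : ∀ w ∈ F.vert q, inner ℝ u w = (inner ℝ v w : ℝ)) : F.vertProj q u = v := by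
  have : FiniteDimensional ℝ (TangentSpace 𝓘(ℝ, E) q) := inferInstanceAs (FiniteDimensional ℝ E)
  have : CompleteSpace (F.vert q) := FiniteDimensional.complete ℝ (F.vert q)
  refine Submodule.eq_starProjection_of_mem_of_inner_eq_zero hv fun w hw ↦ ?_
  rw [inner_sub_left, h w hw, sub_self]

/-- The vertical projection in the coordinates of the chart at `p₀`. -/
def projRep (p₀ : M) (x : E) : E →L[ℝ] E :=
  (coordVec p₀ ((extChartAt 𝓘(ℝ, E) p₀).symm x)).comp
    ((F.vertProj ((extChartAt 𝓘(ℝ, E) p₀).symm x)).comp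
      (ofCoordVec p₀ ((extChartAt 𝓘(ℝ, E) p₀).symm x)))

lemma projRep_apply (hq : q ∈ (chartAt E p₀).source) (w : E) :
    F.projRep p₀ (extChartAt 𝓘(ℝ, E) p₀ q) w = coordVec p₀ q (F.vertProj q (ofCoordVec p₀ q w)) := by
  rw [projRep, extChartAt_left_inv hq]
  rfl

lemma coordVec_vertProj (hq : q ∈ (chartAt E p₀).source) (v : TangentSpace 𝓘(ℝ, E) q) :
    coordVec p₀ q (F.vertProj q v) = F.projRep p₀ (extChartAt 𝓘(ℝ, E) p₀ q) (coordVec p₀ q v) := by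
  rw [F.projRep_apply hq, ofCoordVec_coordVec hq]

lemma mem_vert_iff_projRep (hq : q ∈ (chartAt E p₀).source) {v : TangentSpace 𝓘(ℝ, E) q} :
    v ∈ F.vert q ↔
      F.projRep p₀ (extChartAt 𝓘(ℝ, E) p₀ q) (coordVec p₀ q v) = coordVec p₀ q v := by
  rw [← F.coordVec_vertProj hq, (coordVec_injective hq).eq_iff, F.vertProj_eq_self_iff]

lemma projRep_projRep (hx : x ∈ (extChartAt 𝓘(ℝ, E) p₀).target) (w : E) :
    F.projRep p₀ x (F.projRep p₀ x w) = F.projRep p₀ x w := by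
  have hq := extChartAt_symm_mem_source hx
  rw [← (extChartAt 𝓘(ℝ, E) p₀).right_inv hx, F.projRep_apply hq w, ← F.mem_vert_iff_projRep hq]
  exact F.vertProj_mem _

lemma fieldRep_vertProj (hx : x ∈ (extChartAt 𝓘(ℝ, E) p₀).target)
    (X : Π q : M, TangentSpace 𝓘(ℝ, E) q) :
    fieldRep p₀ (fun q ↦ F.vertProj q (X q)) x = F.projRep p₀ x (fieldRep p₀ X x) := by
  have hq := extChartAt_symm_mem_source hx
  rw [fieldRep, F.coordVec_vertProj hq, (extChartAt 𝓘(ℝ, E) p₀).right_inv hx, fieldRep]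

variable [FiniteDimensional ℝ E'']
  [IsContMDiffRiemannianBundle 𝓘(ℝ, E) ∞ E (fun p : M ↦ TangentSpace 𝓘(ℝ, E) p)]

/-- The vertical projection in terms of the metric and of the leaf directions `b` of a foliated
chart: `w ↦ b (G⁻¹ (v ↦ ⟪w, b v⟫))`, where `G` is the Gram matrix of `b`. -/
lemma projRep_eq_leafFrame {ψ : OpenPartialHomeomorph M (E' × E'')} (hψ : ψ ∈ F.charts)
    (hq : q ∈ (chartAt E p₀).source) (hqψ : q ∈ ψ.source) {x : E}
    (hx : x = extChartAt 𝓘(ℝ, E) p₀ q) :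
    ∃ e : E'' ≃L[ℝ] (E'' →L[ℝ] ℝ),
      (e : E'' →L[ℝ] E'' →L[ℝ] ℝ) = (metricRep p₀ x).bilinearComp
        (leafFrame p₀ ψ x) (leafFrame p₀ ψ x) ∧
      ∀ w, F.projRep p₀ x w =
        leafFrame p₀ ψ x (e.symm ((metricRep p₀ x w).comp (leafFrame p₀ ψ x))) := by
  -- The Gram matrix is nondegenerate because the metric is definite and the leaf frame is
  -- injective, the derivative of `toFoliated` giving back `(0, w)`.
  have hinj : Function.Injective ((metricRep p₀ x).bilinearComp
      (leafFrame p₀ ψ x) (leafFrame p₀ ψ x)) := by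
    refine (injective_iff_map_eq_zero _).2 fun w hw ↦ ?_
    have h1 := DFunLike.congr_fun hw w
    rw [ContinuousLinearMap.bilinearComp_apply, hx, metricRep_apply hq,
      _root_.zero_apply, inner_self_eq_zero] at h1
    have h2 := congrArg (coordVec p₀ q) h1
    rw [coordVec_ofCoordVec hq, map_zero] at h2
    have h3 := fderiv_toFoliated_leafFrame hψ hq hqψ w
    rw [h2, map_zero] at h3
    exact (congrArg Prod.snd h3).symm
  obtain ⟨e, he⟩ := exists_continuousLinearEquiv_of_injective hinj
  refine ⟨e, he, fun w ↦ ?_⟩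
  set u := e.symm ((metricRep p₀ x w).comp (leafFrame p₀ ψ x)) with hu
  have hGu : (metricRep p₀ x).bilinearComp (leafFrame p₀ ψ x) (leafFrame p₀ ψ x) u =
      (metricRep p₀ x w).comp (leafFrame p₀ ψ x) := by
    rw [← he, hu]
    exact e.apply_symm_apply _
  -- The normal equations: the candidate is vertical and has the same inner products with all
  -- vertical vectors as the vector being projected.
  have h : F.vertProj q (ofCoordVec p₀ q w) = ofCoordVec p₀ q (leafFrame p₀ ψ x u) := by
    refine F.vertProj_eq ((mem_vert_iff_leafFrame hψ hq hqψ).2 ⟨u, ?_⟩) fun z hz ↦ ?_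
    · rw [coordVec_ofCoordVec hq, hx]
    · obtain ⟨y, hy⟩ := (mem_vert_iff_leafFrame hψ hq hqψ).1 hz
      have h1 := DFunLike.congr_fun hGu y
      rw [ContinuousLinearMap.bilinearComp_apply, ContinuousLinearMap.comp_apply, hx, ← hy,
        metricRep_apply hq, metricRep_apply hq, ofCoordVec_coordVec hq, ← hx] at h1
      exact h1.symm
  rw [hx, F.projRep_apply hq, h, coordVec_ofCoordVec hq, hx]

/-- The Gram matrix formula holds on a whole neighbourhood with one foliated chart, the metric and
the leaf frame are smooth there, and inversion is smooth at an invertible operator. -/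
lemma contDiffOn_projRep (p₀ : M) :
    ContDiffOn ℝ ∞ (F.projRep p₀) (extChartAt 𝓘(ℝ, E) p₀).target := by
  refine contDiffOn_clm_apply.2 fun w x hx ↦ ?_
  have hq := extChartAt_symm_mem_source hx
  have hxq := ((extChartAt 𝓘(ℝ, E) p₀).right_inv hx).symm
  obtain ⟨ψ, hψ, hqψ⟩ := F.exists_mem_source ((extChartAt 𝓘(ℝ, E) p₀).symm x)
  have hb : ContDiffAt ℝ ∞ (leafFrame p₀ ψ) x := by
    have := contDiffAt_leafFrame hψ hq hqψ
    rwa [← hxq] at this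
  have hg : ContDiffAt ℝ ∞ (metricRep p₀) x :=
    (contDiffOn_metricRep p₀).contDiffAt ((isOpen_extChartAt_target p₀).mem_nhds hx)
  have hG : ContDiffAt ℝ ∞ (fun y ↦ (metricRep p₀ y).bilinearComp
      (leafFrame p₀ ψ y) (leafFrame p₀ ψ y)) x :=
    hg.bilinearComp hb
  obtain ⟨e, he, -⟩ := F.projRep_eq_leafFrame hψ hq hqψ hxq
  have hi : ContDiffAt ℝ ∞ (ContinuousLinearMap.inverse (R := ℝ) (M := E'') (M₂ := E'' →L[ℝ] ℝ))
      ((metricRep p₀ x).bilinearComp (leafFrame p₀ ψ x) (leafFrame p₀ ψ x)) := by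
    rw [← he]
    exact contDiffAt_map_inverse e
  have hmain := hb.clm_apply ((hi.comp x hG).clm_apply
    ((hg.clm_apply (contDiffAt_const (c := w))).clm_comp hb))
  refine (hmain.congr_of_eventuallyEq ?_).contDiffWithinAt
  have hev := eventually_symm_extChartAt_mem hq (ψ.open_source.mem_nhds hqψ)
  rw [← hxq] at hev
  filter_upwards [hev, (isOpen_extChartAt_target p₀).mem_nhds hx] with y hy hy'
  obtain ⟨e', he', h⟩ := F.projRep_eq_leafFrame hψ (extChartAt_symm_mem_source hy') hy
    ((extChartAt 𝓘(ℝ, E) p₀).right_inv hy').symm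
  rw [h, Function.comp_apply, ← he', ContinuousLinearMap.inverse_equiv]
  rfl

lemma contDiffAt_projRep (hq : q ∈ (chartAt E p₀).source) :
    ContDiffAt ℝ ∞ (F.projRep p₀) (extChartAt 𝓘(ℝ, E) p₀ q) :=
  (F.contDiffOn_projRep p₀).contDiffAt (extChartAt_target_mem_nhds_of_mem hq)

/-- Derivative of the identity `π ∘ π = π`. -/
lemma fderiv_projRep (hx : x ∈ (extChartAt 𝓘(ℝ, E) p₀).target) (v w : E) :
    fderiv ℝ (F.projRep p₀) x v w = fderiv ℝ (F.projRep p₀) x v (F.projRep p₀ x w) +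
      F.projRep p₀ x (fderiv ℝ (F.projRep p₀) x v w) := by
  have hnhds := (isOpen_extChartAt_target p₀).mem_nhds hx
  have hd := (((F.contDiffOn_projRep p₀).contDiffAt hnhds).differentiableAt (by simp)).hasFDerivAt
  have h1 := hd.clm_apply (hasFDerivAt_const w x)
  have h2 := hd.clm_apply h1
  have h3 : (fun y ↦ F.projRep p₀ y (F.projRep p₀ y w)) =ᶠ[𝓝 x] fun y ↦ F.projRep p₀ y w := by
    filter_upwards [hnhds] with y hy
    exact F.projRep_projRep hy w
  have h4 := h2.unique (h1.congr_of_eventuallyEq h3)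
  have h5 := DFunLike.congr_fun h4 v
  simp only [_root_.add_apply, ContinuousLinearMap.comp_apply, ContinuousLinearMap.flip_apply,
    _root_.zero_apply, map_zero, zero_add] at h5
  exact h5.symm.trans (add_comm _ _)

/-- Evaluation of `dP = dP P + P dP` at a vertical vector: the derivative of a projection maps its
image into its kernel. -/
lemma projRep_fderiv_projRep (hx : x ∈ (extChartAt 𝓘(ℝ, E) p₀).target) (v w : E) :
    F.projRep p₀ x (fderiv ℝ (F.projRep p₀) x v (F.projRep p₀ x w)) = 0 := by
  have h := F.fderiv_projRep hx v (F.projRep p₀ x w)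
  rw [F.projRep_projRep hx] at h
  simpa using h

/-- The Christoffel symbols of the adapted connection, in terms of those of `∇`. -/
def adaptedChristoffel (Γ : M → E → E →L[ℝ] E →L[ℝ] E) (p₀ : M) (x : E) : E →L[ℝ] E →L[ℝ] E :=
  -- The flips reconcile two orders of arguments: the derivative of the projection takes the
  -- direction first, and `Γ` takes the field first.
  (ContinuousLinearMap.compL ℝ E E E (F.projRep p₀ x)).comp
      ((fderiv ℝ (F.projRep p₀) x).flip + (Γ p₀ x).comp (F.projRep p₀ x)) +
    (ContinuousLinearMap.compL ℝ E E E (ContinuousLinearMap.id ℝ E - F.projRep p₀ x)).comp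
      ((Γ p₀ x).comp (ContinuousLinearMap.id ℝ E - F.projRep p₀ x)
        - (fderiv ℝ (F.projRep p₀) x).flip)

lemma adaptedChristoffel_apply (Γ : M → E → E →L[ℝ] E →L[ℝ] E) (p₀ : M) (x w v : E) :
    F.adaptedChristoffel Γ p₀ x w v =
      F.projRep p₀ x (fderiv ℝ (F.projRep p₀) x v w + Γ p₀ x (F.projRep p₀ x w) v) +
      ((Γ p₀ x (w - F.projRep p₀ x w) v - fderiv ℝ (F.projRep p₀) x v w) -
        F.projRep p₀ x (Γ p₀ x (w - F.projRep p₀ x w) v - fderiv ℝ (F.projRep p₀) x v w)) := rfl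

/-- The adapted connection is compatible with the vertical projection. -/
lemma projRep_adaptedChristoffel (Γ : M → E → E →L[ℝ] E →L[ℝ] E)
    (hx : x ∈ (extChartAt 𝓘(ℝ, E) p₀).target) (w v : E) :
    fderiv ℝ (F.projRep p₀) x v w + F.adaptedChristoffel Γ p₀ x (F.projRep p₀ x w) v =
      F.projRep p₀ x (F.adaptedChristoffel Γ p₀ x w v) := by
  have h1 := F.fderiv_projRep hx v w
  have h2 := F.projRep_fderiv_projRep hx v w
  rw [adaptedChristoffel_apply, adaptedChristoffel_apply, F.projRep_projRep hx w, sub_self]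
  simp only [map_add, map_sub, map_zero, _root_.zero_apply, F.projRep_projRep hx, h2]
  nth_rewrite 1 [h1]
  abel

/-- For a field with components `ξ`, the product rule on `P ξ` and `ξ - P ξ` produces the terms `P
ξ'` and `ξ' - P ξ'`, which add up to `ξ'`. All other terms are of order zero in `ξ` and form
`adaptedChristoffel`. -/
lemma hasChristoffel_adaptedConnection
    {nabla : CovariantDerivative 𝓘(ℝ, E) E (fun p : M ↦ TangentSpace 𝓘(ℝ, E) p)}
    {Γ : M → E → E →L[ℝ] E →L[ℝ] E} (h : HasChristoffel nabla.toFun Γ) :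
    HasChristoffel (F.adaptedConnection nabla) (F.adaptedChristoffel Γ) where
  smooth p₀ := by
    have hπ := F.contDiffOn_projRep p₀
    have hdπ := hπ.fderiv_of_isOpen (m := ∞) (isOpen_extChartAt_target p₀) (by simp)
    refine contDiffOn_clm_apply.2 fun w ↦ contDiffOn_clm_apply.2 fun v ↦ ?_
    have c (u : E) : ContDiffOn ℝ ∞ (fun _ : E ↦ u) (extChartAt 𝓘(ℝ, E) p₀).target :=
      contDiffOn_const
    have h1 := (hdπ.clm_apply (c v)).clm_apply (c w)
    have h2 := ((h.smooth p₀).clm_apply ((c w).sub (hπ.clm_apply (c w)))).clm_apply (c v)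
    exact (hπ.clm_apply (h1.add (((h.smooth p₀).clm_apply (hπ.clm_apply (c w))).clm_apply
      (c v)))).add ((h2.sub h1).sub (hπ.clm_apply (h2.sub h1)))
  coordVec_apply {p₀ q} hq X hX v := by
    have hx := extChartAt_mem_target hq
    have hnhds := extChartAt_target_mem_nhds_of_mem hq
    have hX' := (mdifferentiableAt_field_iff hq).1 hX
    have hπ := (F.contDiffAt_projRep hq).differentiableAt (by simp)
    have e1 : fieldRep p₀ (fun q ↦ F.vertProj q (X q)) =ᶠ[𝓝 (extChartAt 𝓘(ℝ, E) p₀ q)]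
        fun y ↦ F.projRep p₀ y (fieldRep p₀ X y) := by
      filter_upwards [hnhds] with y hy
      exact F.fieldRep_vertProj hy X
    have e2 : fieldRep p₀ (fun q ↦ F.horProj q (X q)) =ᶠ[𝓝 (extChartAt 𝓘(ℝ, E) p₀ q)]
        fun y ↦ fieldRep p₀ X y - F.projRep p₀ y (fieldRep p₀ X y) := by
      filter_upwards [hnhds] with y hy
      rw [← F.fieldRep_vertProj hy X]
      exact map_sub (coordVec p₀ _) _ _
    have d1 := hπ.clm_apply hX'
    have m1 := (mdifferentiableAt_field_iff hq).2 (d1.congr_of_eventuallyEq e1)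
    have m2 := (mdifferentiableAt_field_iff hq).2 ((hX'.sub d1).congr_of_eventuallyEq e2)
    have a1 := h.coordVec_apply hq m1 v
    have a2 := h.coordVec_apply hq m2 v
    have f1 := hπ.hasFDerivAt.clm_apply hX'.hasFDerivAt
    have f2 := hX'.hasFDerivAt.sub f1
    rw [e1.fderiv_eq, f1.fderiv, F.coordVec_vertProj hq] at a1
    have e3 : fderiv ℝ (fun y ↦ fieldRep p₀ X y - F.projRep p₀ y (fieldRep p₀ X y))
      (extChartAt 𝓘(ℝ, E) p₀ q) = _ := f2.fderiv
    have e4 : coordVec p₀ q (F.horProj q (X q)) = coordVec p₀ q (X q) -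
        F.projRep p₀ (extChartAt 𝓘(ℝ, E) p₀ q) (coordVec p₀ q (X q)) := by
      rw [← F.coordVec_vertProj hq]
      exact map_sub (coordVec p₀ _) _ _
    rw [e2.fderiv_eq, e3, e4] at a2
    have e5 : coordVec p₀ q (F.adaptedConnection nabla X q v) =
        F.projRep p₀ (extChartAt 𝓘(ℝ, E) p₀ q)
          (coordVec p₀ q (nabla (fun q ↦ F.vertProj q (X q)) q v)) +
        (coordVec p₀ q (nabla (fun q ↦ F.horProj q (X q)) q v) -
          F.projRep p₀ (extChartAt 𝓘(ℝ, E) p₀ q)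
            (coordVec p₀ q (nabla (fun q ↦ F.horProj q (X q)) q v))) := by
      rw [← F.coordVec_vertProj hq, ← F.coordVec_vertProj hq]
      exact (map_add (coordVec p₀ q) _ _).trans (congrArg _ (map_sub (coordVec p₀ q) _ _))
    rw [e5, a1, a2, F.adaptedChristoffel_apply, fieldRep_extChartAt hq]
    simp only [_root_.add_apply, _root_.sub_apply, ContinuousLinearMap.comp_apply,
      ContinuousLinearMap.flip_apply, map_add, map_sub, F.projRep_projRep hx]
    abel

end SmoothFoliation
end

noncomputable section

/-! ### The Jacobi equation in coordinates -/

section JacobiEquation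

variable {E : Type*} [NormedAddCommGroup E] [NormedSpace ℝ E]
  {M : Type*} [TopologicalSpace M] [ChartedSpace E M] [IsManifold 𝓘(ℝ, E) ∞ M]

/-- `X` is a smooth vector field along `γ : J → M`. -/
def SmoothAlong (J : Set ℝ) (γ : ℝ → M) (X : Π t, TangentSpace 𝓘(ℝ, E) (γ t)) : Prop :=
  ContMDiffOn 𝓘(ℝ, ℝ) 𝓘(ℝ, E).tangent ∞ (fun t ↦ (⟨γ t, X t⟩ : TangentBundle 𝓘(ℝ, E) M)) J

variable {J : Set ℝ} {γ : ℝ → M} {X Y : Π t, TangentSpace 𝓘(ℝ, E) (γ t)} {t : ℝ} {p₀ : M}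

namespace SmoothAlong

lemma of_eventuallyEq (hγ : ContMDiffOn 𝓘(ℝ, ℝ) 𝓘(ℝ, E) ∞ γ J)
    (h : ∀ t ∈ J, ∀ p₀ : M, γ t ∈ (chartAt E p₀).source → ∃ g : ℝ → E,
      alongRep p₀ γ X =ᶠ[𝓝[J] t] g ∧ ContDiffWithinAt ℝ ∞ g J t) : SmoothAlong J γ X := by
  intro t ht
  obtain ⟨g, hg, hg'⟩ := h t ht (γ t) (mem_chart_source E (γ t))
  exact (contMDiffWithinAt_along_iff (mem_chart_source E (γ t))).2
    ⟨hγ t ht, hg'.congr_of_eventuallyEq_of_mem hg ht⟩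

lemma contMDiffOn (hX : SmoothAlong J γ X) : ContMDiffOn 𝓘(ℝ, ℝ) 𝓘(ℝ, E) ∞ γ J := fun t ht ↦
  ((contMDiffWithinAt_along_iff (mem_chart_source E (γ t))).1 (hX t ht)).1

lemma contDiffWithinAt_alongRep (hX : SmoothAlong J γ X) (ht : t ∈ J)
    (hp : γ t ∈ (chartAt E p₀).source) : ContDiffWithinAt ℝ ∞ (alongRep p₀ γ X) J t :=
  ((contMDiffWithinAt_along_iff hp).1 (hX t ht)).2

lemma differentiableWithinAt_alongRep (hX : SmoothAlong J γ X) (ht : t ∈ J)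
    (hp : γ t ∈ (chartAt E p₀).source) : DifferentiableWithinAt ℝ (alongRep p₀ γ X) J t :=
  (hX.contDiffWithinAt_alongRep ht hp).differentiableWithinAt (by simp)

lemma sub (hX : SmoothAlong J γ X) (hY : SmoothAlong J γ Y) :
    SmoothAlong J γ (fun t ↦ X t - Y t) := by
  refine of_eventuallyEq hX.contMDiffOn fun t ht p₀ hp ↦ ⟨_, .of_forall fun s ↦ ?_,
    (hX.contDiffWithinAt_alongRep ht hp).sub (hY.contDiffWithinAt_alongRep ht hp)⟩
  exact map_sub _ _ _

lemma add (hX : SmoothAlong J γ X) (hY : SmoothAlong J γ Y) :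
    SmoothAlong J γ (fun t ↦ X t + Y t) := by
  refine of_eventuallyEq hX.contMDiffOn fun t ht p₀ hp ↦ ⟨_, .of_forall fun s ↦ ?_,
    (hX.contDiffWithinAt_alongRep ht hp).add (hY.contDiffWithinAt_alongRep ht hp)⟩
  exact map_add _ _ _

lemma const_smul (c : ℝ) (hX : SmoothAlong J γ X) : SmoothAlong J γ (fun t ↦ c • X t) := by
  refine of_eventuallyEq hX.contMDiffOn fun t ht p₀ hp ↦ ⟨_, .of_forall fun s ↦ ?_,
    (contDiffWithinAt_const (c := c)).smul (hX.contDiffWithinAt_alongRep ht hp)⟩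
  exact map_smul _ _ _

end SmoothAlong

lemma ContMDiffOn.contDiffWithinAt_mapRep {N : Type*} [NormedAddCommGroup N] [NormedSpace ℝ N]
    {f : N → M} {S : Set N} {z : N} (hf : ContMDiffOn 𝓘(ℝ, N) 𝓘(ℝ, E) ∞ f S) (hz : z ∈ S)
    (hp : f z ∈ (chartAt E p₀).source) : ContDiffWithinAt ℝ ∞ (mapRep E p₀ f) S z :=
  ((contMDiffWithinAt_iff_mapRep hp).1 (hf z hz)).2

lemma alongRep_curveVelocity_eventuallyEq (hJ : UniqueDiffOn ℝ J)
    (hγ : ContMDiffOn 𝓘(ℝ, ℝ) 𝓘(ℝ, E) ∞ γ J) (ht : t ∈ J) (hp : γ t ∈ (chartAt E p₀).source) :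
    alongRep p₀ γ (curveVelocity J γ) =ᶠ[𝓝[J] t] derivWithin (mapRep E p₀ γ) J := by
  filter_upwards [eventually_mem_chart_source (hγ t ht).continuousWithinAt hp,
    self_mem_nhdsWithin] with s hs hsJ
  exact coordVec_curveVelocity hs ((hγ s hsJ).mdifferentiableWithinAt (by simp)) (hJ s hsJ)

lemma smoothAlong_curveVelocity (hJ : UniqueDiffOn ℝ J)
    (hγ : ContMDiffOn 𝓘(ℝ, ℝ) 𝓘(ℝ, E) ∞ γ J) : SmoothAlong (E := E) J γ (curveVelocity J γ) :=
  .of_eventuallyEq hγ fun _ ht _ hp ↦ ⟨_, alongRep_curveVelocity_eventuallyEq hJ hγ ht hp,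
    (hγ.contDiffWithinAt_mapRep ht hp).derivWithin hJ (m := ∞) (by simp) ht⟩

/-- The field `∇_γ' X - T(γ', X)` along `γ`. -/
def jacobiMomentum (D : ConnectionOperator E M) (J : Set ℝ) (γ : ℝ → M)
    (X : Π t, TangentSpace 𝓘(ℝ, E) (γ t)) (t : ℝ) : TangentSpace 𝓘(ℝ, E) (γ t) :=
  covAlong D J γ X t - torsionTensor D (γ t) (curveVelocity J γ t) (X t)

/-- The left-hand side of the Jacobi equation. -/
def jacobiOperator (D : ConnectionOperator E M) (J : Set ℝ) (γ : ℝ → M)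
    (X : Π t, TangentSpace 𝓘(ℝ, E) (γ t)) (t : ℝ) : TangentSpace 𝓘(ℝ, E) (γ t) :=
  covAlong D J γ (covAlong D J γ X) t
    - curvatureTensor D (γ t) (curveVelocity J γ t) (X t) (curveVelocity J γ t)
    - covAlong D J γ (fun s ↦ torsionTensor D (γ s) (curveVelocity J γ s) (X s)) t

namespace HasChristoffel

variable {D : ConnectionOperator E M} {Γ : M → E → E →L[ℝ] E →L[ℝ] E}

lemma alongRep_covAlong_eventuallyEq (h : HasChristoffel D Γ) (hJ : UniqueDiffOn ℝ J)
    (hX : SmoothAlong J γ X) (ht : t ∈ J) (hp : γ t ∈ (chartAt E p₀).source) :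
    alongRep p₀ γ (covAlong D J γ X) =ᶠ[𝓝[J] t] fun s ↦ derivWithin (alongRep p₀ γ X) J s +
      Γ p₀ (mapRep E p₀ γ s) (alongRep p₀ γ X s) (derivWithin (mapRep E p₀ γ) J s) := by
  have hγ := hX.contMDiffOn
  filter_upwards [eventually_mem_chart_source (hγ t ht).continuousWithinAt hp,
    self_mem_nhdsWithin] with s hs hsJ
  exact h.coordVec_covAlong hs ((hγ s hsJ).mdifferentiableWithinAt (by simp)) (hJ s hsJ)
    (hX.differentiableWithinAt_alongRep hsJ hs)

lemma smoothAlong_covAlong (h : HasChristoffel D Γ) (hJ : UniqueDiffOn ℝ J)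
    (hX : SmoothAlong J γ X) : SmoothAlong J γ (covAlong D J γ X) := by
  have hγ := hX.contMDiffOn
  refine .of_eventuallyEq hγ fun t ht p₀ hp ↦
    ⟨_, h.alongRep_covAlong_eventuallyEq hJ hX ht hp, ?_⟩
  have hx := hγ.contDiffWithinAt_mapRep ht hp
  have hξ := hX.contDiffWithinAt_alongRep ht hp
  exact (hξ.derivWithin hJ (m := ∞) (by simp) ht).add
    ((((h.contDiffAt hp).comp_contDiffWithinAt t hx).clm_apply hξ).clm_apply
      (hx.derivWithin hJ (m := ∞) (by simp) ht))

lemma covAlong_sub (h : HasChristoffel D Γ) (hJ : UniqueDiffOn ℝ J)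
    (hX : SmoothAlong J γ X) (hY : SmoothAlong J γ Y) (ht : t ∈ J) :
    covAlong D J γ (fun s ↦ X s - Y s) t = covAlong D J γ X t - covAlong D J γ Y t := by
  have hp := mem_chart_source E (γ t)
  have hm := (hX.contMDiffOn t ht).mdifferentiableWithinAt (by simp)
  have dX := hX.differentiableWithinAt_alongRep ht hp
  have dY := hY.differentiableWithinAt_alongRep ht hp
  have e : alongRep (γ t) γ (fun s ↦ X s - Y s) = alongRep (γ t) γ X - alongRep (γ t) γ Y := by
    funext s
    exact map_sub _ _ _
  apply coordVec_injective hp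
  rw [map_sub, h.coordVec_covAlong hp hm (hJ t ht) dX, h.coordVec_covAlong hp hm (hJ t ht) dY,
    h.coordVec_covAlong hp hm (hJ t ht) (by rw [e]; exact dX.sub dY), e, derivWithin_sub dX dY]
  simp only [Pi.sub_apply, map_sub, _root_.sub_apply]
  abel

lemma covAlong_add (h : HasChristoffel D Γ) (hJ : UniqueDiffOn ℝ J)
    (hX : SmoothAlong J γ X) (hY : SmoothAlong J γ Y) (ht : t ∈ J) :
    covAlong D J γ (fun s ↦ X s + Y s) t = covAlong D J γ X t + covAlong D J γ Y t := by
  have h1 := h.covAlong_sub hJ (hX.add hY) hY ht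
  simp only [add_sub_cancel_right] at h1
  rw [h1, sub_add_cancel]

lemma covAlong_const_smul (h : HasChristoffel D Γ) (hJ : UniqueDiffOn ℝ J)
    (hX : SmoothAlong J γ X) (c : ℝ) (ht : t ∈ J) :
    covAlong D J γ (fun s ↦ c • X s) t = c • covAlong D J γ X t := by
  have hp := mem_chart_source E (γ t)
  have hm := (hX.contMDiffOn t ht).mdifferentiableWithinAt (by simp)
  have dX := hX.differentiableWithinAt_alongRep ht hp
  have e : alongRep (γ t) γ (fun s ↦ c • X s) = fun s ↦ c • alongRep (γ t) γ X s := by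
    funext s
    exact map_smul _ _ _
  apply coordVec_injective hp
  rw [map_smul, h.coordVec_covAlong hp hm (hJ t ht) dX,
    h.coordVec_covAlong hp hm (hJ t ht) (by rw [e]; exact dX.const_smul c), e,
    derivWithin_fun_const_smul c dX]
  simp only [map_smul, smul_add, _root_.smul_apply]

section Torsion

variable [CompleteSpace E]

lemma smoothAlong_torsionTensor (h : HasChristoffel D Γ) (hX : SmoothAlong J γ X)
    (hY : SmoothAlong J γ Y) : SmoothAlong J γ (fun s ↦ torsionTensor D (γ s) (X s) (Y s)) := by
  have hγ := hX.contMDiffOn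
  refine .of_eventuallyEq hγ fun t ht p₀ hp ↦ ⟨fun s ↦
    Γ p₀ (mapRep E p₀ γ s) (alongRep p₀ γ Y s) (alongRep p₀ γ X s) -
      Γ p₀ (mapRep E p₀ γ s) (alongRep p₀ γ X s) (alongRep p₀ γ Y s), ?_, ?_⟩
  · filter_upwards [eventually_mem_chart_source (hγ t ht).continuousWithinAt hp] with s hs
    exact h.coordVec_torsionTensor hs _ _
  · have hΓ := (h.contDiffAt hp).comp_contDiffWithinAt t (hγ.contDiffWithinAt_mapRep ht hp)
    have hξ := hX.contDiffWithinAt_alongRep ht hp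
    have hη := hY.contDiffWithinAt_alongRep ht hp
    exact ((hΓ.clm_apply hη).clm_apply hξ).sub ((hΓ.clm_apply hξ).clm_apply hη)

lemma smoothAlong_jacobiMomentum (h : HasChristoffel D Γ) (hJ : UniqueDiffOn ℝ J)
    (hX : SmoothAlong J γ X) : SmoothAlong J γ (jacobiMomentum D J γ X) :=
  (h.smoothAlong_covAlong hJ hX).sub
    (h.smoothAlong_torsionTensor (smoothAlong_curveVelocity hJ hX.contMDiffOn) hX)

/-- The two derivatives along the curve combine into one derivative of the momentum. The Jacobi
equation thereby becomes a first-order system for `X` and its momentum, without derivatives of the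
torsion. -/
lemma jacobiOperator_eq (h : HasChristoffel D Γ) (hJ : UniqueDiffOn ℝ J)
    (hX : SmoothAlong J γ X) (ht : t ∈ J) :
    jacobiOperator D J γ X t = covAlong D J γ (jacobiMomentum D J γ X) t
      - curvatureTensor D (γ t) (curveVelocity J γ t) (X t) (curveVelocity J γ t) := by
  have h1 : covAlong D J γ (jacobiMomentum D J γ X) t = _ :=
    h.covAlong_sub hJ (h.smoothAlong_covAlong hJ hX)
      (h.smoothAlong_torsionTensor (smoothAlong_curveVelocity hJ hX.contMDiffOn) hX) ht
  rw [h1, jacobiOperator]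
  abel

/-- Subtracting the torsion exchanges the two arguments of `Γ`. In the result the velocity is the
differentiated field and `X` the direction, as in `∇_s ∂_t f` for a variation. -/
lemma coordVec_jacobiMomentum (h : HasChristoffel D Γ) (hJ : UniqueDiffOn ℝ J)
    (hX : SmoothAlong J γ X) (ht : t ∈ J) (hp : γ t ∈ (chartAt E p₀).source) :
    coordVec p₀ (γ t) (jacobiMomentum D J γ X t) = derivWithin (alongRep p₀ γ X) J t +
      Γ p₀ (mapRep E p₀ γ t) (derivWithin (mapRep E p₀ γ) J t) (alongRep p₀ γ X t) := by
  have hm := (hX.contMDiffOn t ht).mdifferentiableWithinAt (by simp)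
  rw [jacobiMomentum, map_sub, h.coordVec_covAlong hp hm (hJ t ht)
    (hX.differentiableWithinAt_alongRep ht hp), h.coordVec_torsionTensor hp,
    coordVec_curveVelocity hp hm (hJ t ht), alongRep, mapRep]
  abel

lemma coordVec_jacobiOperator (h : HasChristoffel D Γ) (hJ : UniqueDiffOn ℝ J)
    (hX : SmoothAlong J γ X) (ht : t ∈ J) (hp : γ t ∈ (chartAt E p₀).source) :
    coordVec p₀ (γ t) (jacobiOperator D J γ X t) =
      derivWithin (alongRep p₀ γ (jacobiMomentum D J γ X)) J t +
      Γ p₀ (mapRep E p₀ γ t) (alongRep p₀ γ (jacobiMomentum D J γ X) t)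
        (derivWithin (mapRep E p₀ γ) J t) -
      christoffelCurvature (Γ p₀) (mapRep E p₀ γ t) (derivWithin (mapRep E p₀ γ) J t)
        (alongRep p₀ γ X t) (derivWithin (mapRep E p₀ γ) J t) := by
  have hm := (hX.contMDiffOn t ht).mdifferentiableWithinAt (by simp)
  rw [h.jacobiOperator_eq hJ hX ht, map_sub, h.coordVec_curvatureTensor hp,
    coordVec_curveVelocity hp hm (hJ t ht), h.coordVec_covAlong hp hm (hJ t ht)
    ((h.smoothAlong_jacobiMomentum hJ hX).differentiableWithinAt_alongRep ht hp)]
  rfl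

end Torsion

/-- The geodesic equation in coordinates. -/
lemma coordVec_covAlong_curveVelocity (h : HasChristoffel D Γ) (hJ : UniqueDiffOn ℝ J)
    (hγ : ContMDiffOn 𝓘(ℝ, ℝ) 𝓘(ℝ, E) ∞ γ J) (ht : t ∈ J) (hp : γ t ∈ (chartAt E p₀).source) :
    coordVec p₀ (γ t) (covAlong D J γ (curveVelocity J γ) t) =
      derivWithin (derivWithin (mapRep E p₀ γ) J) J t +
      Γ p₀ (mapRep E p₀ γ t) (derivWithin (mapRep E p₀ γ) J t)
        (derivWithin (mapRep E p₀ γ) J t) := by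
  have e := alongRep_curveVelocity_eventuallyEq hJ hγ ht hp
  rw [h.coordVec_covAlong hp ((hγ t ht).mdifferentiableWithinAt (by simp)) (hJ t ht)
    ((smoothAlong_curveVelocity hJ hγ).differentiableWithinAt_alongRep ht hp),
    e.derivWithin_eq (e.eq_of_nhdsWithin ht), e.eq_of_nhdsWithin ht]

end HasChristoffel

end JacobiEquation
end

noncomputable section

/-! ### Uniqueness for linear differential equations along curves -/

section Linear

variable {F : Type*} [NormedAddCommGroup F] [NormedSpace ℝ F]

lemma eq_zero_of_norm_deriv_le_right {y y' : ℝ → F} {c d K : ℝ}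
    (hy : ∀ t ∈ Icc c d, HasDerivWithinAt y (y' t) (Icc c d) t)
    (hb : ∀ t ∈ Icc c d, ‖y' t‖ ≤ K * ‖y t‖) (hc : y c = 0) : ∀ t ∈ Icc c d, y t = 0 :=
  eq_zero_of_abs_deriv_le_mul_abs_self_of_eq_zero_right (f' := y')
    (fun t ht ↦ (hy t ht).continuousWithinAt)
    (fun t ht ↦ (hy t (Ico_subset_Icc_self ht)).mono_of_mem_nhdsWithin (Icc_mem_nhdsGE_of_mem ht))
    hc fun t ht ↦ hb t (Ico_subset_Icc_self ht)

/-- Grönwall's inequality works forward in time; the part before `s` is treated by reflecting time.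
-/
lemma eq_zero_of_norm_deriv_le {y y' : ℝ → F} {c d K : ℝ}
    (hy : ∀ t ∈ Icc c d, HasDerivWithinAt y (y' t) (Icc c d) t)
    (hb : ∀ t ∈ Icc c d, ‖y' t‖ ≤ K * ‖y t‖) {s : ℝ} (hs : s ∈ Icc c d) (hys : y s = 0) :
    ∀ t ∈ Icc c d, y t = 0 := by
  intro t ht
  rcases le_total s t with hst | hst
  · have hsub : Icc s d ⊆ Icc c d := Icc_subset_Icc_left hs.1
    exact eq_zero_of_norm_deriv_le_right (fun r hr ↦ (hy r (hsub hr)).mono hsub)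
      (fun r hr ↦ hb r (hsub hr)) hys t ⟨hst, ht.2⟩
  · have hmaps : MapsTo (fun r : ℝ ↦ -r) (Icc (-s) (-c)) (Icc c d) := fun r hr ↦
      ⟨by linarith [hr.2], by linarith [hr.1, hs.2]⟩
    have h := eq_zero_of_norm_deriv_le_right (y := fun r ↦ y (-r)) (y' := fun r ↦ -y' (-r))
      (c := -s) (d := -c) (K := K)
      (fun r hr ↦ by
        have := (hy (-r) (hmaps hr)).scomp r ((hasDerivAt_neg r).hasDerivWithinAt) hmaps
        simpa [Function.comp_def] using this)
      (fun r hr ↦ by simpa using hb (-r) (hmaps hr)) (by simpa using hys) (-t)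
      ⟨by linarith, by linarith [ht.1]⟩
    simpa using h

/-- The zeros of a solution of a linear differential equation are open and closed. -/
lemma eventually_eq_zero_iff_of_norm_deriv_le {y y' : ℝ → F} {a b s K : ℝ} (hs : s ∈ Icc a b)
    (h : ∀ᶠ t in 𝓝[Icc a b] s, HasDerivWithinAt y (y' t) (Icc a b) t ∧ ‖y' t‖ ≤ K * ‖y t‖) :
    ∀ᶠ t in 𝓝[Icc a b] s, (y s = 0 ↔ y t = 0) := by
  obtain ⟨ε, hε, hball⟩ := Metric.mem_nhdsWithin_iff.1 h
  -- Half the radius gives a closed interval inside the open ball. There zeros propagate from `s` to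
  -- `t` and from `t` to `s`.
  have hsub : Icc (max a (s - ε / 2)) (min b (s + ε / 2)) ⊆ Metric.ball s ε ∩ Icc a b := by
    intro t ht
    have h1 := max_le_iff.1 ht.1
    have h2 := le_min_iff.1 ht.2
    refine ⟨?_, h1.1, h2.1⟩
    rw [Metric.mem_ball, Real.dist_eq, abs_lt]
    constructor <;> linarith
  have hmem : s ∈ Icc (max a (s - ε / 2)) (min b (s + ε / 2)) :=
    ⟨max_le hs.1 (by linarith), le_min hs.2 (by linarith)⟩
  have hd : ∀ t ∈ Icc (max a (s - ε / 2)) (min b (s + ε / 2)),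
      HasDerivWithinAt y (y' t) (Icc (max a (s - ε / 2)) (min b (s + ε / 2))) t := fun t ht ↦
    (hball (hsub ht)).1.mono fun r hr ↦ (hsub hr).2
  have hb : ∀ t ∈ Icc (max a (s - ε / 2)) (min b (s + ε / 2)), ‖y' t‖ ≤ K * ‖y t‖ := fun t ht ↦
    (hball (hsub ht)).2
  have hnear : ∀ᶠ t in 𝓝 s, t ∈ Icc (s - ε / 2) (s + ε / 2) :=
    Icc_mem_nhds (by linarith) (by linarith)
  filter_upwards [self_mem_nhdsWithin, mem_nhdsWithin_of_mem_nhds hnear] with t ht ht'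
  have htm : t ∈ Icc (max a (s - ε / 2)) (min b (s + ε / 2)) :=
    ⟨max_le ht.1 ht'.1, le_min ht.2 ht'.2⟩
  exact ⟨fun h0 ↦ eq_zero_of_norm_deriv_le hd hb hmem h0 t htm,
    fun h0 ↦ eq_zero_of_norm_deriv_le hd hb htm h0 s hmem⟩

/-- A locally constant property on `[a, b]` that holds at `a` holds on `[a, b]`. -/
lemma forall_mem_Icc_of_eventually_iff {a b : ℝ} {Q : ℝ → Prop}
    (h : ∀ s ∈ Icc a b, ∀ᶠ t in 𝓝[Icc a b] s, (Q s ↔ Q t)) (ha : Q a) : ∀ t ∈ Icc a b, Q t :=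
  fun t ht ↦ (isPreconnected_Icc.induction₂ (fun r u ↦ (Q r ↔ Q u)) h
    (fun _ _ _ _ _ _ h1 h2 ↦ h1.trans h2) (fun _ _ _ _ h1 ↦ h1.symm)
    (left_mem_Icc.2 (ht.1.trans ht.2)) ht).1 ha

/-- Bounds a continuous coefficient near a point by the single constant that the local criterion for
zeros asks for. -/
lemma ContinuousWithinAt.eventually_le_add_one {f : ℝ → ℝ} {s : Set ℝ} {t : ℝ}
    (hf : ContinuousWithinAt f s t) : ∀ᶠ r in 𝓝[s] t, f r ≤ f t + 1 :=
  (hf.eventually (gt_mem_nhds (lt_add_one (f t)))).mono fun _ h ↦ h.le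

lemma norm_christoffelCurvature_le (Γ : F → F →L[ℝ] F →L[ℝ] F) (x u v w : F) :
    ‖christoffelCurvature Γ x u v w‖ ≤
      2 * (‖fderiv ℝ Γ x‖ + ‖Γ x‖ * ‖Γ x‖) * ‖u‖ * ‖v‖ * ‖w‖ := by
  have h1 (u v w : F) : ‖fderiv ℝ Γ x u w v‖ ≤ ‖fderiv ℝ Γ x‖ * ‖u‖ * ‖w‖ * ‖v‖ :=
    ((fderiv ℝ Γ x u).le_opNorm₂ w v).trans (by gcongr; exact (fderiv ℝ Γ x).le_opNorm u)
  have h2 (u v w : F) : ‖Γ x (Γ x w v) u‖ ≤ ‖Γ x‖ * (‖Γ x‖ * ‖w‖ * ‖v‖) * ‖u‖ :=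
    ((Γ x).le_opNorm₂ _ u).trans (by gcongr; exact (Γ x).le_opNorm₂ w v)
  calc ‖christoffelCurvature Γ x u v w‖
      ≤ ‖fderiv ℝ Γ x u w v‖ + ‖fderiv ℝ Γ x v w u‖ + ‖Γ x (Γ x w v) u‖ + ‖Γ x (Γ x w u) v‖ :=
        (norm_sub_le _ _).trans (by
          gcongr
          exact (norm_add_le _ _).trans (by gcongr; exact norm_sub_le _ _))
    _ ≤ ‖fderiv ℝ Γ x‖ * ‖u‖ * ‖w‖ * ‖v‖ + ‖fderiv ℝ Γ x‖ * ‖v‖ * ‖w‖ * ‖u‖ +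
        ‖Γ x‖ * (‖Γ x‖ * ‖w‖ * ‖v‖) * ‖u‖ + ‖Γ x‖ * (‖Γ x‖ * ‖w‖ * ‖u‖) * ‖v‖ := by
        gcongr
        exacts [h1 u v w, h1 v u w, h2 u v w, h2 v u w]
    _ = _ := by ring

end Linear

/-! ### Uniqueness of Jacobi fields. -/

section Uniqueness

variable {E : Type*} [NormedAddCommGroup E] [NormedSpace ℝ E]
  {M : Type*} [TopologicalSpace M] [ChartedSpace E M] [IsManifold 𝓘(ℝ, E) ∞ M]
  {D : ConnectionOperator E M} {Γ : M → E → E →L[ℝ] E →L[ℝ] E} {a b : ℝ} {γ : ℝ → M}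

namespace HasChristoffel

/-- A Jacobi field is determined by its value and its momentum at one endpoint. -/
lemma eq_zero_of_jacobiOperator_eq_zero [CompleteSpace E] (h : HasChristoffel D Γ) (hab : a < b)
    {X : Π t, TangentSpace 𝓘(ℝ, E) (γ t)} (hX : SmoothAlong (Icc a b) γ X)
    (hJac : ∀ t ∈ Icc a b, jacobiOperator D (Icc a b) γ X t = 0)
    (h0 : X a = 0) (h1 : jacobiMomentum D (Icc a b) γ X a = 0) : ∀ t ∈ Icc a b, X t = 0 := by
  have hJ := uniqueDiffOn_Icc hab
  have hγ := hX.contMDiffOn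
  have hZ := h.smoothAlong_jacobiMomentum hJ hX
  -- Vanishing of the pair does not depend on a chart, so it can be propagated locally, with a chart
  -- chosen around each time `s`. There the pair solves a linear first-order system.
  suffices ∀ t ∈ Icc a b, X t = 0 ∧ jacobiMomentum D (Icc a b) γ X t = 0 from
    fun t ht ↦ (this t ht).1
  refine forall_mem_Icc_of_eventually_iff (fun s hs ↦ ?_) ⟨h0, h1⟩
  set p₀ := γ s
  have hp : γ s ∈ (chartAt E p₀).source := mem_chart_source E (γ s)
  set x := mapRep E p₀ γ
  set x' := derivWithin x (Icc a b)
  set ξ := alongRep p₀ γ X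
  set ζ := alongRep p₀ γ (jacobiMomentum D (Icc a b) γ X)
  have hx := hγ.contDiffWithinAt_mapRep hs hp
  have hx' : ContinuousWithinAt x' (Icc a b) s :=
    (hx.derivWithin hJ (m := ∞) (by simp) hs).continuousWithinAt
  have hΓ : ContinuousWithinAt (fun t ↦ Γ p₀ (x t)) (Icc a b) s :=
    ((h.contDiffAt hp).comp_contDiffWithinAt s hx).continuousWithinAt
  have hΓ' : ContinuousWithinAt (fun t ↦ fderiv ℝ (Γ p₀) (x t)) (Icc a b) s :=
    (((h.contDiffAt hp).fderiv_right (m := ∞) (by simp)).comp_contDiffWithinAt s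
      hx).continuousWithinAt
  -- A common bound for both components of the system: `1` for `ζ` in the equation for `ξ'`, then
  -- the Christoffel terms, then the curvature term. It is not sharp.
  set κ : ℝ → ℝ := fun t ↦ 1 + 2 * (‖Γ p₀ (x t)‖ * ‖x' t‖) +
    2 * (‖fderiv ℝ (Γ p₀) (x t)‖ + ‖Γ p₀ (x t)‖ * ‖Γ p₀ (x t)‖) * ‖x' t‖ * ‖x' t‖ with hκ
  have hκc : ContinuousWithinAt κ (Icc a b) s := by
    have c2 := hΓ.norm
    have c3 := hx'.norm
    exact (continuousWithinAt_const.add (continuousWithinAt_const.mul (c2.mul c3))).add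
      (((continuousWithinAt_const.mul (hΓ'.norm.add (c2.mul c2))).mul c3).mul c3)
  have hsrc := eventually_mem_chart_source (hγ s hs).continuousWithinAt hp
  have hzero (t : ℝ) (ht : γ t ∈ (chartAt E p₀).source) :
      (X t = 0 ∧ jacobiMomentum D (Icc a b) γ X t = 0) ↔ (ξ t, ζ t) = 0 := by
    rw [Prod.mk_eq_zero]
    refine and_congr ?_ ?_ <;> exact ((map_eq_zero_iff _ (coordVec_injective ht))).symm
  have hmain := eventually_eq_zero_iff_of_norm_deriv_le (y := fun t ↦ (ξ t, ζ t))
    (y' := fun t ↦ (derivWithin ξ (Icc a b) t, derivWithin ζ (Icc a b) t)) (K := κ s + 1) hs (by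
      filter_upwards [hsrc, self_mem_nhdsWithin, hκc.eventually_le_add_one] with t ht htJ htκ
      refine ⟨(hX.differentiableWithinAt_alongRep htJ ht).hasDerivWithinAt.prodMk
        (hZ.differentiableWithinAt_alongRep htJ ht).hasDerivWithinAt, ?_⟩
      have e1 : ζ t = derivWithin ξ (Icc a b) t + Γ p₀ (x t) (x' t) (ξ t) :=
        h.coordVec_jacobiMomentum hJ hX htJ ht
      have e2 := h.coordVec_jacobiOperator hJ hX htJ ht
      rw [hJac t htJ, map_zero] at e2
      have e1' : derivWithin ξ (Icc a b) t = ζ t - Γ p₀ (x t) (x' t) (ξ t) := by rw [e1]; abel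
      have e2' : derivWithin ζ (Icc a b) t =
          christoffelCurvature (Γ p₀) (x t) (x' t) (ξ t) (x' t) - Γ p₀ (x t) (ζ t) (x' t) :=
        eq_sub_of_add_eq (sub_eq_zero.1 e2.symm)
      have n1 : ‖ξ t‖ ≤ ‖(ξ t, ζ t)‖ := norm_fst_le (ξ t, ζ t)
      have n2 : ‖ζ t‖ ≤ ‖(ξ t, ζ t)‖ := norm_snd_le (ξ t, ζ t)
      set n := ‖(ξ t, ζ t)‖
      have hn : 0 ≤ n := (norm_nonneg _).trans n1
      refine le_trans ?_ (mul_le_mul_of_nonneg_right htκ hn)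
      have g1 : 0 ≤ ‖Γ p₀ (x t)‖ * ‖x' t‖ * n := by positivity
      have g2 : 0 ≤ 2 * (‖fderiv ℝ (Γ p₀) (x t)‖ + ‖Γ p₀ (x t)‖ * ‖Γ p₀ (x t)‖) * ‖x' t‖ *
        ‖x' t‖ * n := by positivity
      rw [Prod.norm_def, max_le_iff]
      constructor
      · calc ‖derivWithin ξ (Icc a b) t‖ ≤ ‖ζ t‖ + ‖Γ p₀ (x t) (x' t) (ξ t)‖ := by
              rw [e1']; exact norm_sub_le _ _
          _ ≤ n + ‖Γ p₀ (x t)‖ * ‖x' t‖ * n := by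
              gcongr
              exact ((Γ p₀ (x t)).le_opNorm₂ _ _).trans (by gcongr)
          _ ≤ κ t * n := by
              rw [hκ]
              linarith
      · calc ‖derivWithin ζ (Icc a b) t‖
            ≤ ‖christoffelCurvature (Γ p₀) (x t) (x' t) (ξ t) (x' t)‖ +
              ‖Γ p₀ (x t) (ζ t) (x' t)‖ := by
              rw [e2']; exact norm_sub_le _ _
          _ ≤ 2 * (‖fderiv ℝ (Γ p₀) (x t)‖ + ‖Γ p₀ (x t)‖ * ‖Γ p₀ (x t)‖) * ‖x' t‖ * n * ‖x' t‖ +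
              ‖Γ p₀ (x t)‖ * n * ‖x' t‖ := by
              gcongr
              · exact (norm_christoffelCurvature_le _ _ _ _ _).trans (by gcongr)
              · exact ((Γ p₀ (x t)).le_opNorm₂ _ _).trans (by gcongr)
          _ ≤ κ t * n := by
              rw [hκ]
              nlinarith)
  filter_upwards [hmain, hsrc] with t ht hts
  rw [hzero s hp, hzero t hts]
  exact ht

end HasChristoffel

end Uniqueness

/-! ### Geodesics of the adapted connection with vertical initial velocity. -/

namespace SmoothFoliation

variable {E' : Type*} [NormedAddCommGroup E'] [NormedSpace ℝ E']
  {E'' : Type*} [NormedAddCommGroup E''] [NormedSpace ℝ E''] [FiniteDimensional ℝ E'']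
  {E : Type*} [NormedAddCommGroup E] [NormedSpace ℝ E] [FiniteDimensional ℝ E]
  {M : Type*} [TopologicalSpace M] [ChartedSpace E M] [IsManifold 𝓘(ℝ, E) ∞ M]
  [RiemannianBundle (fun p : M ↦ TangentSpace 𝓘(ℝ, E) p)]
  [IsContMDiffRiemannianBundle 𝓘(ℝ, E) ∞ E (fun p : M ↦ TangentSpace 𝓘(ℝ, E) p)]

/-- The connection `D` has Christoffel symbols `Γ` and preserves the vertical bundle and its
orthogonal complement. -/
structure HasAdaptedChristoffel (F : SmoothFoliation E' E'' E M) (D : ConnectionOperator E M)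
    (Γ : M → E → E →L[ℝ] E →L[ℝ] E) : Prop extends HasChristoffel D Γ where
  -- The coordinate form of `∇P = 0`.
  projRep_christoffel : ∀ {p₀ : M} {x : E}, x ∈ (extChartAt 𝓘(ℝ, E) p₀).target → ∀ w v : E,
    fderiv ℝ (F.projRep p₀) x v w + Γ p₀ x (F.projRep p₀ x w) v =
      F.projRep p₀ x (Γ p₀ x w v)

variable {F : SmoothFoliation E' E'' E M} {D : ConnectionOperator E M}
  {Γ : M → E → E →L[ℝ] E →L[ℝ] E}

lemma hasAdaptedChristoffel_adaptedConnection
    {nabla : CovariantDerivative 𝓘(ℝ, E) E (fun p : M ↦ TangentSpace 𝓘(ℝ, E) p)}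
    (h : HasChristoffel nabla.toFun Γ) :
    F.HasAdaptedChristoffel (F.adaptedConnection nabla) (F.adaptedChristoffel Γ) where
  toHasChristoffel := F.hasChristoffel_adaptedConnection h
  projRep_christoffel hx w v := F.projRep_adaptedChristoffel Γ hx w v

set_option maxHeartbeats 1000000 in
/-- A geodesic that starts tangent to a leaf remains vertical. -/
lemma HasAdaptedChristoffel.curveVelocity_mem_vert (h : F.HasAdaptedChristoffel D Γ) {a b : ℝ}
    (hab : a < b) {γ : ℝ → M} (hγ : ContMDiffOn 𝓘(ℝ, ℝ) 𝓘(ℝ, E) ∞ γ (Icc a b))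
    (hgeo : ∀ t ∈ Icc a b, covAlong D (Icc a b) γ (curveVelocity (Icc a b) γ) t = 0)
    (h0 : curveVelocity (Icc a b) γ a ∈ F.vert (γ a)) :
    ∀ t ∈ Icc a b, curveVelocity (Icc a b) γ t ∈ F.vert (γ t) := by
  have hJ := uniqueDiffOn_Icc hab
  refine forall_mem_Icc_of_eventually_iff (fun s hs ↦ ?_) h0
  set p₀ := γ s
  have hp : γ s ∈ (chartAt E p₀).source := mem_chart_source E (γ s)
  set x := mapRep E p₀ γ with hxdef
  set x' := derivWithin x (Icc a b)
  have hx := hγ.contDiffWithinAt_mapRep hs hp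
  have hx' : ContinuousWithinAt x' (Icc a b) s :=
    (hx.derivWithin hJ (m := ∞) (by simp) hs).continuousWithinAt
  have hΓ : ContinuousWithinAt (fun t ↦ Γ p₀ (x t)) (Icc a b) s :=
    ((h.contDiffAt hp).comp_contDiffWithinAt s hx).continuousWithinAt
  have hκc : ContinuousWithinAt (fun t ↦ ‖Γ p₀ (x t)‖ * ‖x' t‖) (Icc a b) s :=
    hΓ.norm.mul hx'.norm
  have hsrc := eventually_mem_chart_source (hγ s hs).continuousWithinAt hp
  -- The horizontal part of the velocity. Since `P` is parallel and the velocity is parallel, `y` is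
  -- parallel too: `y' = -Γ(y, x')`. Verticality is thus the vanishing of a solution of a linear
  -- equation.
  set y : ℝ → E := fun t ↦ x' t - F.projRep p₀ (x t) (x' t) with hy
  have hzero (t : ℝ) (htJ : t ∈ Icc a b) (ht : γ t ∈ (chartAt E p₀).source) :
      curveVelocity (Icc a b) γ t ∈ F.vert (γ t) ↔ y t = 0 := by
    rw [F.mem_vert_iff_projRep ht, coordVec_curveVelocity ht
      ((hγ t htJ).mdifferentiableWithinAt (by simp)) (hJ t htJ), hy, sub_eq_zero, eq_comm]
    rfl
  have hmain := eventually_eq_zero_iff_of_norm_deriv_le (y := y)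
    (y' := fun t ↦ -Γ p₀ (x t) (y t) (x' t)) (K := ‖Γ p₀ (x s)‖ * ‖x' s‖ + 1) hs (by
      filter_upwards [hsrc, self_mem_nhdsWithin, hκc.eventually_le_add_one] with t ht htJ htκ
      have hxt := hγ.contDiffWithinAt_mapRep htJ ht
      have hd1 := (hxt.differentiableWithinAt (by simp)).hasDerivWithinAt
      have hd2 : HasDerivWithinAt x' _ (Icc a b) t := ((hxt.derivWithin hJ (m := ∞) (by simp)
        htJ).differentiableWithinAt (by simp)).hasDerivWithinAt
      have hπ := ((F.contDiffAt_projRep ht).differentiableAt (by simp)).hasFDerivAt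
      have hd3 := hd2.sub ((hπ.comp_hasDerivWithinAt t hd1).clm_apply hd2)
      refine ⟨?_, ?_⟩
      · refine HasDerivWithinAt.congr_deriv hd3 ?_
        have e1 := h.coordVec_covAlong_curveVelocity hJ hγ htJ ht
        rw [hgeo t htJ, map_zero] at e1
        have e2 : derivWithin x' (Icc a b) t = -Γ p₀ (x t) (x' t) (x' t) :=
          eq_neg_of_add_eq_zero_left e1.symm
        have e3 := eq_sub_of_add_eq (h.projRep_christoffel (extChartAt_mem_target ht) (x' t) (x' t))
        have e4 : fderiv ℝ (F.projRep p₀) (x t) (x' t) (x' t) =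
          F.projRep p₀ (x t) (Γ p₀ (x t) (x' t) (x' t)) -
            Γ p₀ (x t) (F.projRep p₀ (x t) (x' t)) (x' t) := e3
        have e5 : derivWithin x' (Icc a b) t - (fderiv ℝ (F.projRep p₀) (x t) (x' t) (x' t) +
            F.projRep p₀ (x t) (derivWithin x' (Icc a b) t)) = -Γ p₀ (x t) (y t) (x' t) := by
          rw [e4, e2, hy]
          simp only [map_neg, map_sub, _root_.sub_apply]
          abel
        exact e5
      · rw [norm_neg]
        refine ((Γ p₀ (x t)).le_opNorm₂ _ _).trans ?_
        refine le_trans (le_of_eq ?_) (mul_le_mul_of_nonneg_right htκ (norm_nonneg (y t)))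
        ring)
  filter_upwards [hmain, hsrc, self_mem_nhdsWithin] with t ht hts htJ
  rw [hzero s hs hp, hzero t htJ hts]
  exact ht

end SmoothFoliation
end

/-! ### Vertical curves and leaves. -/

noncomputable section

namespace SmoothFoliation

variable {E' : Type*} [NormedAddCommGroup E'] [NormedSpace ℝ E']
  {E'' : Type*} [NormedAddCommGroup E''] [NormedSpace ℝ E'']
  {E : Type*} [NormedAddCommGroup E] [NormedSpace ℝ E]
  {M : Type*} [TopologicalSpace M] [ChartedSpace E M] [IsManifold 𝓘(ℝ, E) ∞ M]
  {F : SmoothFoliation E' E'' E M}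

/-- A vertical curve stays in a leaf. -/
lemma mem_leaf_of_curveVelocity_mem_vert {a b : ℝ} (hab : a < b) {γ : ℝ → M}
    (hγ : ContMDiffOn 𝓘(ℝ, ℝ) 𝓘(ℝ, E) ∞ γ (Icc a b))
    (hv : ∀ t ∈ Icc a b, curveVelocity (E := E) (Icc a b) γ t ∈ F.vert (γ t)) :
    ∀ t ∈ Icc a b, γ t ∈ F.leaf (γ a) := by
  have hJ := uniqueDiffOn_Icc hab
  refine forall_mem_Icc_of_eventually_iff (fun s hs ↦ ?_) (Relation.EqvGen.refl _)
  obtain ⟨ψ, hψ, hsψ⟩ := F.exists_mem_source (γ s)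
  have hcont := (hγ s hs).continuousWithinAt
  have hsrc := eventually_mem_chart_source hcont (mem_chart_source E (γ s))
  have hsrcψ : ∀ᶠ t in 𝓝[Icc a b] s, γ t ∈ ψ.source :=
    hcont.preimage_mem_nhdsWithin (ψ.open_source.mem_nhds hsψ)
  -- The transverse coordinate has zero derivative along a vertical curve. The case `K = 0` of the
  -- linear criterion makes it locally constant, so nearby points of the curve share a plaque.
  have hmain := eventually_eq_zero_iff_of_norm_deriv_le
    (y := fun t ↦ (toFoliated (γ s) ψ (mapRep E (γ s) γ t)).1 -
      (toFoliated (γ s) ψ (mapRep E (γ s) γ s)).1) (y' := fun _ ↦ 0) (K := 0) hs (by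
    filter_upwards [hsrc, hsrcψ, self_mem_nhdsWithin] with t ht htψ htJ
    refine ⟨?_, by simp⟩
    have h1 := ((hγ.contDiffWithinAt_mapRep htJ ht).differentiableWithinAt
      (by simp)).hasDerivWithinAt
    have h2 := ((contDiffAt_toFoliated hψ ht htψ).differentiableAt (by simp)).hasFDerivAt
    have h3 := (ContinuousLinearMap.fst ℝ E' E'').hasFDerivAt.comp_hasDerivWithinAt t
      (h2.comp_hasDerivWithinAt t h1)
    have h4 := (mem_vert_iff_fst hψ ht htψ).1 (hv t htJ)
    rw [coordVec_curveVelocity ht ((hγ t htJ).mdifferentiableWithinAt (by simp)) (hJ t htJ)] at h4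
    exact HasDerivWithinAt.congr_deriv (h3.sub_const _) h4)
  filter_upwards [hmain, hsrc, hsrcψ] with t ht hts htψ
  have h5 : (ψ (γ t)).1 = (ψ (γ s)).1 := by
    have := ht.1 (sub_self _)
    rw [mapRep, mapRep, toFoliated_extChartAt hts,
      toFoliated_extChartAt (mem_chart_source E (γ s))] at this
    exact sub_eq_zero.1 this
  have h6 : Relation.EqvGen F.SamePlaque (γ s) (γ t) := .rel _ _ ⟨ψ, hψ, hsψ, htψ, h5.symm⟩
  exact ⟨fun h ↦ h.trans _ _ _ h6, fun h ↦ h.trans _ _ _ h6.symm⟩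

end SmoothFoliation
end

noncomputable section

/-! ### Calculus with two-parameter maps -/

section TwoParameter

variable {E : Type*} [NormedAddCommGroup E] [NormedSpace ℝ E]
  {V : Type*} [NormedAddCommGroup V] [NormedSpace ℝ V]
  {S : Set (ℝ × ℝ)} {u : ℝ × ℝ → E} {z : ℝ × ℝ}

/-- The partial derivative within `S` in the direction `v`. -/
def partialWithin (S : Set (ℝ × ℝ)) (u : ℝ × ℝ → V) (v z : ℝ × ℝ) : V := fderivWithin ℝ u S z v

lemma ContDiffOn.partialWithin {u : ℝ × ℝ → V} (hu : ContDiffOn ℝ ∞ u S) (hS : UniqueDiffOn ℝ S)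
    (v : ℝ × ℝ) : ContDiffOn ℝ ∞ (partialWithin S u v) S :=
  (hu.fderivWithin hS (m := ∞) (by simp)).clm_apply contDiffOn_const

/-- Second derivatives are symmetric also at boundary points, as limits from the interior; this is
needed on the edges `t = a` and `t = b`. -/
lemma partialWithin_comm {u : ℝ × ℝ → V} (hu : ContDiffOn ℝ ∞ u S) (hS : UniqueDiffOn ℝ S)
    (hcl : S ⊆ closure (interior S)) (hz : z ∈ S) (v w : ℝ × ℝ) :
    partialWithin S (partialWithin S u v) w z = partialWithin S (partialWithin S u w) v z := by
  have hd : DifferentiableWithinAt ℝ (fderivWithin ℝ u S) S z :=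
    ((hu.fderivWithin hS (m := ∞) (by simp)) z hz).differentiableWithinAt (by simp)
  have h (v w : ℝ × ℝ) : partialWithin S (partialWithin S u v) w z =
      fderivWithin ℝ (fderivWithin ℝ u S) S z w v := by
    have h1 := (hd.hasFDerivWithinAt.clm_apply (hasFDerivWithinAt_const v z S)).fderivWithin (hS z hz)
    have h2 : fderivWithin ℝ (_root_.partialWithin S u v) S z = _ := h1
    rw [_root_.partialWithin, h2]
    simp
  rw [h, h]
  exact ((hu z hz).isSymmSndFDerivWithinAt minSmoothness_two_le_infty hS (hcl hz) hz).eq _ _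

lemma partialWithin_christoffel {Γ : E → E →L[ℝ] E →L[ℝ] E} {A B : ℝ × ℝ → E}
    (hu : ContDiffOn ℝ ∞ u S) (hS : UniqueDiffOn ℝ S) (hΓ : ContDiffAt ℝ ∞ Γ (u z))
    (hA : ContDiffOn ℝ ∞ A S) (hB : ContDiffOn ℝ ∞ B S) (hz : z ∈ S) (v : ℝ × ℝ) :
    partialWithin S (fun y ↦ Γ (u y) (A y) (B y)) v z =
      fderiv ℝ Γ (u z) (partialWithin S u v z) (A z) (B z) + Γ (u z) (partialWithin S A v z) (B z) +
        Γ (u z) (A z) (partialWithin S B v z) := by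
  have d {V : Type _} [NormedAddCommGroup V] [NormedSpace ℝ V] {g : ℝ × ℝ → V}
      (hg : ContDiffOn ℝ ∞ g S) : HasFDerivWithinAt g (fderivWithin ℝ g S z) S z :=
    ((hg z hz).differentiableWithinAt (by simp)).hasFDerivWithinAt
  have h1 := ((((hΓ.differentiableAt (by simp)).hasFDerivAt.comp_hasFDerivWithinAt z
    (d hu)).clm_apply (d hA)).clm_apply (d hB)).fderivWithin (hS z hz)
  have h2 : fderivWithin ℝ (fun y ↦ Γ (u y) (A y) (B y)) S z = _ := h1
  rw [partialWithin, h2]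
  simp only [_root_.add_apply, ContinuousLinearMap.comp_apply, ContinuousLinearMap.flip_apply,
    Function.comp_apply, partialWithin]
  abel

lemma contDiffOn_christoffel {Γ : E → E →L[ℝ] E →L[ℝ] E} {A B : ℝ × ℝ → E}
    (hu : ContDiffOn ℝ ∞ u S) (hΓ : ∀ z ∈ S, ContDiffAt ℝ ∞ Γ (u z))
    (hA : ContDiffOn ℝ ∞ A S) (hB : ContDiffOn ℝ ∞ B S) :
    ContDiffOn ℝ ∞ (fun y ↦ Γ (u y) (A y) (B y)) S := fun z hz ↦
  (((hΓ z hz).comp_contDiffWithinAt z (hu z hz)).clm_apply (hA z hz)).clm_apply (hB z hz)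

lemma partialWithin_add {g h : ℝ × ℝ → V} (hg : ContDiffOn ℝ ∞ g S) (hh : ContDiffOn ℝ ∞ h S)
    (hS : UniqueDiffOn ℝ S) (hz : z ∈ S) (v : ℝ × ℝ) :
    partialWithin S (fun y ↦ g y + h y) v z = partialWithin S g v z + partialWithin S h v z := by
  rw [partialWithin, fderivWithin_fun_add (hS z hz) ((hg z hz).differentiableWithinAt (by simp))
    ((hh z hz).differentiableWithinAt (by simp))]
  rfl

/-- For a variation through geodesics, the variation field solves the Jacobi equation. -/
lemma jacobi_of_geodesic_variation {Γ : E → E →L[ℝ] E →L[ℝ] E} (hS : UniqueDiffOn ℝ S)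
    (hcl : S ⊆ closure (interior S)) (hu : ContDiffOn ℝ ∞ u S)
    (hΓ : ∀ z ∈ S, ContDiffAt ℝ ∞ Γ (u z))
    (hgeo : ∀ z ∈ S, partialWithin S (partialWithin S u (1, 0)) (1, 0) z +
      Γ (u z) (partialWithin S u (1, 0) z) (partialWithin S u (1, 0) z) = 0) (hz : z ∈ S) :
    partialWithin S (fun y ↦ partialWithin S (partialWithin S u (0, 1)) (1, 0) y +
        Γ (u y) (partialWithin S u (1, 0) y) (partialWithin S u (0, 1) y)) (1, 0) z +
      Γ (u z) (partialWithin S (partialWithin S u (0, 1)) (1, 0) z +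
        Γ (u z) (partialWithin S u (1, 0) z) (partialWithin S u (0, 1) z))
        (partialWithin S u (1, 0) z) =
      christoffelCurvature Γ (u z) (partialWithin S u (1, 0) z) (partialWithin S u (0, 1) z)
        (partialWithin S u (1, 0) z) := by
  set A := partialWithin S u (1, 0) with hAdef
  set B := partialWithin S u (0, 1) with hBdef
  have hA : ContDiffOn ℝ ∞ A S := hu.partialWithin hS _
  have hB : ContDiffOn ℝ ∞ B S := hu.partialWithin hS _
  have hBt : partialWithin S B (1, 0) z = partialWithin S A (0, 1) z :=
    partialWithin_comm hu hS hcl hz _ _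
  -- Two exchanges turn `∂_t ∂_t ∂_s u` into `∂_s ∂_t ∂_t u`. The inner one must hold on all of `S`,
  -- since it is differentiated once more.
  have hBtt : partialWithin S (partialWithin S B (1, 0)) (1, 0) z =
      partialWithin S (partialWithin S A (1, 0)) (0, 1) z := by
    rw [partialWithin_comm hA hS hcl hz]
    have : partialWithin S (partialWithin S B (1, 0)) (1, 0) z =
        partialWithin S (partialWithin S A (0, 1)) (1, 0) z := by
      rw [partialWithin, partialWithin, fderivWithin_congr
        (fun y hy ↦ partialWithin_comm hu hS hcl hy _ _) hBt]
    exact this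
  have e1 := partialWithin_add (hB.partialWithin hS (1, 0)) (contDiffOn_christoffel hu hΓ hA hB) hS
    hz (1, 0)
  have e2 := partialWithin_add (hA.partialWithin hS (1, 0)) (contDiffOn_christoffel hu hΓ hA hA) hS
    hz (0, 1)
  -- The geodesic equation holds for every parameter, so its `s`-derivative vanishes too. This
  -- replaces `∂_s ∂_t ∂_t u` by terms in `Γ`, and the curvature remains.
  have e3 : partialWithin S (fun y ↦ partialWithin S A (1, 0) y + Γ (u y) (A y) (A y)) (0, 1) z
      = 0 := by
    rw [partialWithin, fderivWithin_congr (f := fun _ ↦ (0 : E)) hgeo (hgeo z hz)]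
    simp
  rw [partialWithin_christoffel hu hS (hΓ z hz) hA hB hz, hBtt, hBt, ← hAdef] at e1
  rw [e3, partialWithin_christoffel hu hS (hΓ z hz) hA hA hz, ← hBdef] at e2
  have e4 := eq_neg_of_add_eq_zero_left (hgeo z hz)
  have e5 := eq_neg_of_add_eq_zero_left e2.symm
  rw [e1, hBt, e4, e5, christoffelCurvature]
  simp only [map_add, map_neg, _root_.add_apply, _root_.neg_apply]
  abel

/-- If `P` is parallel for `Γ` and preserves `A`, it preserves the covariant derivatives of `A`. -/
lemma proj_partialWithin_add_christoffel {Γ : E → E →L[ℝ] E →L[ℝ] E} {P : E → E →L[ℝ] E}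
    {A : ℝ × ℝ → E} (hS : UniqueDiffOn ℝ S) (hu : ContDiffOn ℝ ∞ u S) (hA : ContDiffOn ℝ ∞ A S)
    (hz : z ∈ S) (hP : DifferentiableAt ℝ P (u z)) (hPA : ∀ y ∈ S, P (u y) (A y) = A y)
    (hPΓ : ∀ w v, fderiv ℝ P (u z) v w + Γ (u z) (P (u z) w) v = P (u z) (Γ (u z) w v))
    (v : ℝ × ℝ) :
    P (u z) (partialWithin S A v z + Γ (u z) (A z) (partialWithin S u v z)) =
      partialWithin S A v z + Γ (u z) (A z) (partialWithin S u v z) := by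
  have d {g : ℝ × ℝ → E} (hg : ContDiffOn ℝ ∞ g S) :
      HasFDerivWithinAt g (fderivWithin ℝ g S z) S z :=
    ((hg z hz).differentiableWithinAt (by simp)).hasFDerivWithinAt
  -- Differentiating `P A = A` produces a term with the derivative of `P`, which the parallelism of
  -- `P` trades for the commutator of `P` with `Γ`.
  have h1 := ((hP.hasFDerivAt.comp_hasFDerivWithinAt z (d hu)).clm_apply (d hA)).congr
    (fun y hy ↦ (hPA y hy).symm) (hPA z hz).symm
  have h2 := (hS z hz).eq h1 (d hA)
  have h3 := DFunLike.congr_fun h2 v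
  simp only [_root_.add_apply, ContinuousLinearMap.comp_apply, ContinuousLinearMap.flip_apply,
    Function.comp_apply] at h3
  have h4 := hPΓ (A z) (partialWithin S u v z)
  rw [hPA z hz] at h4
  rw [map_add, ← h4, ← add_assoc]
  exact congrArg (· + _) h3

end TwoParameter
end

noncomputable section

/-! ### Variation fields are Jacobi fields -/

section VariationDomain

variable {V : Type*} [NormedAddCommGroup V] [NormedSpace ℝ V] {a b ε : ℝ} {O : Set (ℝ × ℝ)}

/-- A relatively open subset of `[a, b] × (-ε, ε)`. -/
def variationDomain (a b ε : ℝ) (O : Set (ℝ × ℝ)) : Set (ℝ × ℝ) := (Icc a b ×ˢ Ioo (-ε) ε) ∩ O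

lemma uniqueDiffOn_variationDomain (hab : a < b) (hO : IsOpen O) :
    UniqueDiffOn ℝ (variationDomain a b ε O) :=
  ((uniqueDiffOn_Icc hab).prod isOpen_Ioo.uniqueDiffOn).inter hO

lemma variationDomain_subset_closure_interior (hab : a < b) (hO : IsOpen O) :
    variationDomain a b ε O ⊆ closure (interior (variationDomain a b ε O)) := by
  rintro z ⟨⟨hz1, hz2⟩, hzO⟩
  have h1 : z ∈ closure (Ioo a b ×ˢ Ioo (-ε) ε) := by
    rw [closure_prod_eq, closure_Ioo hab.ne]
    exact ⟨hz1, subset_closure hz2⟩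
  have h2 : (Ioo a b ×ˢ Ioo (-ε) ε) ∩ O ⊆ interior (variationDomain a b ε O) :=
    interior_maximal (inter_subset_inter_left _ (prod_mono_left Ioo_subset_Icc_self))
      ((isOpen_Ioo.prod isOpen_Ioo).inter hO)
  refine closure_mono h2 ?_
  rw [inter_comm]
  exact hO.inter_closure ⟨hzO, h1⟩

lemma eventually_mem_variationDomain (hO : IsOpen O) {t s : ℝ}
    (h : (t, s) ∈ variationDomain a b ε O) :
    ∀ᶠ r in 𝓝[Icc a b] t, (r, s) ∈ variationDomain a b ε O := by
  have hc : Continuous fun r : ℝ ↦ (r, s) := by fun_prop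
  filter_upwards [self_mem_nhdsWithin,
    mem_nhdsWithin_of_mem_nhds (hc.continuousAt.preimage_mem_nhds (hO.mem_nhds h.2))] with r hr hr'
  exact ⟨⟨hr, h.1.2⟩, hr'⟩

lemma eventually_mem_variationDomain_right (hO : IsOpen O) {t s : ℝ}
    (h : (t, s) ∈ variationDomain a b ε O) :
    ∀ᶠ r in 𝓝 s, (t, r) ∈ variationDomain a b ε O := by
  have hc : Continuous fun r : ℝ ↦ (t, r) := by fun_prop
  filter_upwards [isOpen_Ioo.mem_nhds h.1.2, hc.continuousAt.preimage_mem_nhds (hO.mem_nhds h.2)]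
    with r hr hr'
  exact ⟨⟨h.1.1, hr⟩, hr'⟩

/-- The horizontal slice of the domain is relatively open in `[a, b]`, so the partial derivative
within the domain is the derivative within `[a, b]`, one-sided at the endpoints. -/
lemma hasDerivWithinAt_slice (hO : IsOpen O) {g : ℝ × ℝ → V} {t s : ℝ}
    (h : (t, s) ∈ variationDomain a b ε O) (hg : ContDiffOn ℝ ∞ g (variationDomain a b ε O)) :
    HasDerivWithinAt (fun r ↦ g (r, s)) (partialWithin (variationDomain a b ε O) g (1, 0) (t, s))
      (Icc a b) t := by
  have h1 := ((hg _ h).differentiableWithinAt (by simp)).hasFDerivWithinAt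
  have h2 : HasDerivWithinAt (fun r : ℝ ↦ (r, s)) (1, 0)
      {r | (r, s) ∈ variationDomain a b ε O} t :=
    ((hasDerivAt_id t).prodMk (hasDerivAt_const t s)).hasDerivWithinAt
  have h3 := h1.comp_hasDerivWithinAt t h2 fun r hr ↦ hr
  exact h3.mono_of_mem_nhdsWithin (eventually_mem_variationDomain hO h)

lemma hasDerivAt_slice (hO : IsOpen O) {g : ℝ × ℝ → V} {t s : ℝ}
    (h : (t, s) ∈ variationDomain a b ε O) (hg : ContDiffOn ℝ ∞ g (variationDomain a b ε O)) :
    HasDerivAt (fun r ↦ g (t, r)) (partialWithin (variationDomain a b ε O) g (0, 1) (t, s)) s := by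
  have h1 := ((hg _ h).differentiableWithinAt (by simp)).hasFDerivWithinAt
  have h2 : HasDerivWithinAt (fun r : ℝ ↦ (t, r)) (0, 1)
      {r | (t, r) ∈ variationDomain a b ε O} s :=
    ((hasDerivAt_const s t).prodMk (hasDerivAt_id s)).hasDerivWithinAt
  have h3 := h1.comp_hasDerivWithinAt s h2 fun r hr ↦ hr
  exact h3.hasDerivAt (eventually_mem_variationDomain_right hO h)

lemma contDiffWithinAt_slice (hO : IsOpen O) {g : ℝ × ℝ → V} {t s : ℝ}
    (h : (t, s) ∈ variationDomain a b ε O) (hg : ContDiffOn ℝ ∞ g (variationDomain a b ε O)) :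
    ContDiffWithinAt ℝ ∞ (fun r ↦ g (r, s)) (Icc a b) t := by
  have h2 : ContDiff ℝ ∞ (fun r : ℝ ↦ (r, s)) := by fun_prop
  have h3 := (hg (t, s) h).comp t
    (h2.contDiffWithinAt (s := {r | (r, s) ∈ variationDomain a b ε O})) fun r hr ↦ hr
  exact h3.mono_of_mem_nhdsWithin (eventually_mem_variationDomain hO h)

end VariationDomain

section Variation

variable {E : Type*} [NormedAddCommGroup E] [NormedSpace ℝ E]
  {M : Type*} [TopologicalSpace M] [ChartedSpace E M] [IsManifold 𝓘(ℝ, E) ∞ M]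
  {D : ConnectionOperator E M} {Γ : M → E → E →L[ℝ] E →L[ℝ] E}
  {a b ε : ℝ} {f : ℝ × ℝ → M} {O : Set (ℝ × ℝ)} {p₀ : M} {γ : ℝ → M}

lemma exists_variationDomain_chart
    (hf : ContMDiffOn 𝓘(ℝ, ℝ × ℝ) 𝓘(ℝ, E) ∞ f (Icc a b ×ˢ Ioo (-ε) ε)) {z : ℝ × ℝ}
    (hz : z ∈ Icc a b ×ˢ Ioo (-ε) ε) (hp : f z ∈ (chartAt E p₀).source) :
    ∃ O : Set (ℝ × ℝ), IsOpen O ∧ z ∈ variationDomain a b ε O ∧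
      ∀ y ∈ variationDomain a b ε O, f y ∈ (chartAt E p₀).source := by
  obtain ⟨O, hO, hO'⟩ := continuousOn_iff'.1 hf.continuousOn _ (chartAt E p₀).open_source
  refine ⟨O, hO, ⟨hz, ?_⟩, fun y hy ↦ ?_⟩
  · have : z ∈ f ⁻¹' (chartAt E p₀).source ∩ Icc a b ×ˢ Ioo (-ε) ε := ⟨hp, hz⟩
    rw [hO'] at this
    exact this.1
  · have : y ∈ O ∩ Icc a b ×ˢ Ioo (-ε) ε := ⟨hy.2, hy.1⟩
    rw [← hO'] at this
    exact this.1

lemma contDiffOn_mapRep_variationDomain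
    (hf : ContMDiffOn 𝓘(ℝ, ℝ × ℝ) 𝓘(ℝ, E) ∞ f (Icc a b ×ˢ Ioo (-ε) ε))
    (hsrc : ∀ y ∈ variationDomain a b ε O, f y ∈ (chartAt E p₀).source) :
    ContDiffOn ℝ ∞ (mapRep E p₀ f) (variationDomain a b ε O) := fun z hz ↦
  (hf.contDiffWithinAt_mapRep hz.1 (hsrc z hz)).mono inter_subset_left

lemma ContMDiffOn.variation_slice
    (hf : ContMDiffOn 𝓘(ℝ, ℝ × ℝ) 𝓘(ℝ, E) ∞ f (Icc a b ×ˢ Ioo (-ε) ε)) {s : ℝ}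
    (hs : s ∈ Ioo (-ε) ε) : ContMDiffOn 𝓘(ℝ, ℝ) 𝓘(ℝ, E) ∞ (fun t ↦ f (t, s)) (Icc a b) := by
  have h2 : ContDiff ℝ ∞ (fun r : ℝ ↦ (r, s)) := by fun_prop
  exact hf.comp h2.contMDiff.contMDiffOn fun t ht ↦ ⟨ht, hs⟩

/-- The geodesic equation of the curves `f(·, s)` in coordinates. -/
lemma HasChristoffel.geodesic_variation (h : HasChristoffel D Γ) (hab : a < b)
    (hf : ContMDiffOn 𝓘(ℝ, ℝ × ℝ) 𝓘(ℝ, E) ∞ f (Icc a b ×ˢ Ioo (-ε) ε))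
    (hgeo : ∀ s ∈ Ioo (-ε) ε, ∀ t ∈ Icc a b, covAlong D (Icc a b) (fun t ↦ f (t, s))
      (curveVelocity (Icc a b) (fun t ↦ f (t, s))) t = 0) (hO : IsOpen O)
    (hsrc : ∀ y ∈ variationDomain a b ε O, f y ∈ (chartAt E p₀).source)
    {z : ℝ × ℝ} (hz : z ∈ variationDomain a b ε O) :
    partialWithin (variationDomain a b ε O) (partialWithin (variationDomain a b ε O)
      (mapRep E p₀ f) (1, 0)) (1, 0) z +
      Γ p₀ (mapRep E p₀ f z) (partialWithin (variationDomain a b ε O) (mapRep E p₀ f) (1, 0) z)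
        (partialWithin (variationDomain a b ε O) (mapRep E p₀ f) (1, 0) z) = 0 := by
  obtain ⟨t, s⟩ := z
  have hJ := uniqueDiffOn_Icc hab
  have hu := contDiffOn_mapRep_variationDomain hf hsrc
  have hA := hu.partialWithin (uniqueDiffOn_variationDomain hab hO) (1, 0)
  have h1 := h.coordVec_covAlong_curveVelocity hJ (hf.variation_slice hz.1.2) hz.1.1 (hsrc _ hz)
  rw [hgeo s hz.1.2 t hz.1.1, map_zero] at h1
  have e1 : derivWithin (mapRep E p₀ fun t ↦ f (t, s)) (Icc a b) =ᶠ[𝓝[Icc a b] t] fun r ↦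
      partialWithin (variationDomain a b ε O) (mapRep E p₀ f) (1, 0) (r, s) := by
    filter_upwards [eventually_mem_variationDomain hO hz] with r hr
    exact (hasDerivWithinAt_slice hO hr hu).derivWithin (hJ r hr.1.1)
  have e2 := e1.eq_of_nhdsWithin hz.1.1
  rw [e1.derivWithin_eq e2, e2, (hasDerivWithinAt_slice hO hz hA).derivWithin (hJ t hz.1.1)] at h1
  exact h1.symm

section Field

variable {X : Π t : Icc a b, TangentSpace 𝓘(ℝ, E) (γ t)}

lemma extendField_of_mem {t : ℝ} (ht : t ∈ Icc a b) : extendField X t = X ⟨t, ht⟩ := dif_pos ht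

/-- The points `γ t` and `f (t, 0)` are equal but their tangent spaces are distinct types. Reading
the equality in the tangent bundle through a trivialization avoids any transport of vectors. -/
lemma alongRep_variationField
    (hf : ContMDiffOn 𝓘(ℝ, ℝ × ℝ) 𝓘(ℝ, E) ∞ f (Icc a b ×ˢ Ioo (-ε) ε))
    (hfγ : ∀ t ∈ Icc a b, f (t, 0) = γ t) (hX : SmoothFoliation.IsVariationField f X)
    (hO : IsOpen O) (hsrc : ∀ y ∈ variationDomain a b ε O, f y ∈ (chartAt E p₀).source)
    {t : ℝ} (ht : (t, (0 : ℝ)) ∈ variationDomain a b ε O) :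
    alongRep p₀ γ (extendField X) t =
      partialWithin (variationDomain a b ε O) (mapRep E p₀ f) (0, 1) (t, 0) := by
  have hp := hsrc _ ht
  have hp' : γ t ∈ (chartAt E p₀).source := by rwa [← hfγ t ht.1.1]
  have hm : MDifferentiableAt 𝓘(ℝ, ℝ) 𝓘(ℝ, E) (fun s : ℝ ↦ f (t, s)) 0 := by
    have h2 : ContDiff ℝ ∞ (fun r : ℝ ↦ (t, r)) := by fun_prop
    have h3 : ContMDiffOn 𝓘(ℝ, ℝ) 𝓘(ℝ, E) ∞ (fun s : ℝ ↦ f (t, s)) (Ioo (-ε) ε) :=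
      hf.comp h2.contMDiff.contMDiffOn fun s hs ↦ ⟨ht.1.1, hs⟩
    exact (h3.contMDiffAt (isOpen_Ioo.mem_nhds ht.1.2)).mdifferentiableAt (by simp)
  have e1 := hX ⟨t, ht.1.1⟩
  have e2 : alongRep p₀ γ (extendField X) t = coordVec p₀ (f (t, 0))
      (mfderiv 𝓘(ℝ, ℝ) 𝓘(ℝ, E) (fun s : ℝ ↦ f (t, s)) 0 (1 : ℝ)) := by
    rw [alongRep, extendField_of_mem ht.1.1, coordVec_apply hp', coordVec_apply hp, e1]
  have e3 := coordVec_mfderivWithin (f := fun s : ℝ ↦ f (t, s)) (z := (0 : ℝ)) (S := univ) hp hm.mdifferentiableWithinAt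
    uniqueDiffWithinAt_univ (1 : ℝ)
  rw [mfderivWithin_univ, fderivWithin_univ] at e3
  rw [e2]
  exact e3.trans (hasDerivAt_slice hO ht (contDiffOn_mapRep_variationDomain hf hsrc)).deriv

variable (hab : a < b) (hε : 0 < ε)
    (hf : ContMDiffOn 𝓘(ℝ, ℝ × ℝ) 𝓘(ℝ, E) ∞ f (Icc a b ×ˢ Ioo (-ε) ε))
    (hfγ : ∀ t ∈ Icc a b, f (t, 0) = γ t) (hX : SmoothFoliation.IsVariationField f X)
    (hγ : ContMDiffOn 𝓘(ℝ, ℝ) 𝓘(ℝ, E) ∞ γ (Icc a b))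

include hab hε hf hfγ hX hγ

lemma smoothAlong_variationField : SmoothAlong (Icc a b) γ (extendField X) := by
  refine .of_eventuallyEq hγ fun t ht p₀ hp ↦ ?_
  have hz : (t, (0 : ℝ)) ∈ Icc a b ×ˢ Ioo (-ε) ε := ⟨ht, by simpa using hε⟩
  obtain ⟨O, hO, hzO, hsrc⟩ := exists_variationDomain_chart (p₀ := p₀) hf hz (by rwa [hfγ t ht])
  refine ⟨_, ?_, contDiffWithinAt_slice hO hzO
    ((contDiffOn_mapRep_variationDomain hf hsrc).partialWithin
      (uniqueDiffOn_variationDomain hab hO) (0, 1))⟩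
  filter_upwards [eventually_mem_variationDomain hO hzO] with r hr
  exact alongRep_variationField hf hfγ hX hO hsrc hr

/-- Once the two partial derivatives are exchanged, the right side is `∇_s ∂_t f` at `s = 0`. -/
lemma coordVec_jacobiMomentum_variationField [CompleteSpace E] (h : HasChristoffel D Γ)
    (hO : IsOpen O) (hsrc : ∀ y ∈ variationDomain a b ε O, f y ∈ (chartAt E p₀).source)
    {t : ℝ} (ht : (t, (0 : ℝ)) ∈ variationDomain a b ε O) :
    alongRep p₀ γ (jacobiMomentum D (Icc a b) γ (extendField X)) t =
      partialWithin (variationDomain a b ε O) (partialWithin (variationDomain a b ε O)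
        (mapRep E p₀ f) (0, 1)) (1, 0) (t, 0) +
      Γ p₀ (mapRep E p₀ f (t, 0))
        (partialWithin (variationDomain a b ε O) (mapRep E p₀ f) (1, 0) (t, 0))
        (partialWithin (variationDomain a b ε O) (mapRep E p₀ f) (0, 1) (t, 0)) := by
  have hJ := uniqueDiffOn_Icc hab
  have hp' : γ t ∈ (chartAt E p₀).source := by rw [← hfγ t ht.1.1]; exact hsrc _ ht
  have hu := contDiffOn_mapRep_variationDomain hf hsrc
  have hB := hu.partialWithin (uniqueDiffOn_variationDomain hab hO) (0, 1)
  have e1 : alongRep p₀ γ (extendField X) =ᶠ[𝓝[Icc a b] t] fun r ↦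
      partialWithin (variationDomain a b ε O) (mapRep E p₀ f) (0, 1) (r, 0) := by
    filter_upwards [eventually_mem_variationDomain hO ht] with r hr
    exact alongRep_variationField hf hfγ hX hO hsrc hr
  have e2 : mapRep E p₀ γ =ᶠ[𝓝[Icc a b] t] fun r ↦ mapRep E p₀ f (r, 0) := by
    filter_upwards [self_mem_nhdsWithin] with r hr
    rw [mapRep, mapRep, hfγ r hr]
  have e1' := e1.eq_of_nhdsWithin ht.1.1
  have e2' := e2.eq_of_nhdsWithin ht.1.1
  refine (h.coordVec_jacobiMomentum hJ (smoothAlong_variationField hab hε hf hfγ hX hγ)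
    ht.1.1 hp').trans ?_
  rw [e1.derivWithin_eq e1', e2.derivWithin_eq e2', e1', e2',
    (hasDerivWithinAt_slice hO ht hB).derivWithin (hJ t ht.1.1),
    (hasDerivWithinAt_slice hO ht hu).derivWithin (hJ t ht.1.1)]

lemma jacobiOperator_variationField [CompleteSpace E] (h : HasChristoffel D Γ)
    (hgeo : ∀ s ∈ Ioo (-ε) ε, ∀ t ∈ Icc a b, covAlong D (Icc a b) (fun t ↦ f (t, s))
      (curveVelocity (Icc a b) (fun t ↦ f (t, s))) t = 0) {t : ℝ} (ht : t ∈ Icc a b) :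
    jacobiOperator D (Icc a b) γ (extendField X) t = 0 := by
  have hJ := uniqueDiffOn_Icc hab
  set p₀ := γ t
  have hp' : γ t ∈ (chartAt E p₀).source := mem_chart_source E (γ t)
  have hz : (t, (0 : ℝ)) ∈ Icc a b ×ˢ Ioo (-ε) ε := ⟨ht, by simpa using hε⟩
  obtain ⟨O, hO, hzO, hsrc⟩ := exists_variationDomain_chart (p₀ := p₀) hf hz (by rwa [hfγ t ht])
  have hu := contDiffOn_mapRep_variationDomain hf hsrc
  have hS := uniqueDiffOn_variationDomain (ε := ε) hab hO
  have hcl := variationDomain_subset_closure_interior (ε := ε) hab hO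
  have hΓ : ∀ z ∈ variationDomain a b ε O, ContDiffAt ℝ ∞ (Γ p₀) (mapRep E p₀ f z) :=
    fun z hz ↦ h.contDiffAt (hsrc z hz)
  have hA := hu.partialWithin hS (1, 0)
  have hB := hu.partialWithin hS (0, 1)
  have key := jacobi_of_geodesic_variation hS hcl hu hΓ
    (fun z hz ↦ h.geodesic_variation hab hf hgeo hO hsrc hz) hzO
  have e1 := alongRep_variationField hf hfγ hX hO hsrc hzO
  have e2 : mapRep E p₀ γ =ᶠ[𝓝[Icc a b] t] fun r ↦ mapRep E p₀ f (r, 0) := by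
    filter_upwards [self_mem_nhdsWithin] with r hr
    rw [mapRep, mapRep, hfγ r hr]
  have e2' := e2.eq_of_nhdsWithin ht
  have e3 : alongRep p₀ γ (jacobiMomentum D (Icc a b) γ (extendField X)) =ᶠ[𝓝[Icc a b] t]
      fun r ↦ partialWithin (variationDomain a b ε O) (partialWithin (variationDomain a b ε O)
        (mapRep E p₀ f) (0, 1)) (1, 0) (r, 0) + Γ p₀ (mapRep E p₀ f (r, 0))
          (partialWithin (variationDomain a b ε O) (mapRep E p₀ f) (1, 0) (r, 0))
          (partialWithin (variationDomain a b ε O) (mapRep E p₀ f) (0, 1) (r, 0)) := by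
    filter_upwards [eventually_mem_variationDomain hO hzO] with r hr
    exact coordVec_jacobiMomentum_variationField hab hε hf hfγ hX hγ h hO hsrc hr
  have e3' := e3.eq_of_nhdsWithin ht
  apply coordVec_injective hp'
  rw [map_zero, h.coordVec_jacobiOperator hJ (smoothAlong_variationField hab hε hf hfγ hX hγ) ht
    hp', e3.derivWithin_eq e3', e2.derivWithin_eq e2', e3', e2', e1,
    (hasDerivWithinAt_slice hO hzO ((hB.partialWithin hS (1, 0)).add
      (contDiffOn_christoffel hu hΓ hA hB))).derivWithin (hJ t ht),
    (hasDerivWithinAt_slice hO hzO hu).derivWithin (hJ t ht)]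
  exact sub_eq_zero.2 key

end Field

end Variation

namespace SmoothFoliation

variable {E' : Type*} [NormedAddCommGroup E'] [NormedSpace ℝ E']
  {E'' : Type*} [NormedAddCommGroup E''] [NormedSpace ℝ E''] [FiniteDimensional ℝ E'']
  {E : Type*} [NormedAddCommGroup E] [NormedSpace ℝ E] [FiniteDimensional ℝ E]
  {M : Type*} [TopologicalSpace M] [ChartedSpace E M] [IsManifold 𝓘(ℝ, E) ∞ M]
  [RiemannianBundle (fun p : M ↦ TangentSpace 𝓘(ℝ, E) p)]
  [IsContMDiffRiemannianBundle 𝓘(ℝ, E) ∞ E (fun p : M ↦ TangentSpace 𝓘(ℝ, E) p)]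
  {F : SmoothFoliation E' E'' E M} {D : ConnectionOperator E M}
  {Γ : M → E → E →L[ℝ] E →L[ℝ] E} {a b ε : ℝ} {f : ℝ × ℝ → M} {γ : ℝ → M}
  {X : Π t : Icc a b, TangentSpace 𝓘(ℝ, E) (γ t)}

/-- The momentum is `∇_s ∂_t f`. All the curves are tangent to leaves, so `∂_t f` is vertical for
every `s`, and a connection for which `P` is parallel keeps vertical fields vertical. -/
lemma HasAdaptedChristoffel.jacobiMomentum_variationField_mem_vert
    (h : F.HasAdaptedChristoffel D Γ) (hab : a < b) (hε : 0 < ε)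
    (hγ : ContMDiffOn 𝓘(ℝ, ℝ) 𝓘(ℝ, E) ∞ γ (Icc a b))
    (hf : F.IsLeafwiseGeodesicVariation D a b γ ε f) (hX : IsVariationField f X) :
    jacobiMomentum D (Icc a b) γ (extendField X) a ∈ F.vert (γ a) := by
  have : CompleteSpace E := FiniteDimensional.complete ℝ E
  have hJ := uniqueDiffOn_Icc hab
  have ha : a ∈ Icc a b := left_mem_Icc.2 hab.le
  have hfγ := hf.eq_curve
  set p₀ := γ a
  have hp' : γ a ∈ (chartAt E p₀).source := mem_chart_source E (γ a)
  have hz : (a, (0 : ℝ)) ∈ Icc a b ×ˢ Ioo (-ε) ε := ⟨ha, by simpa using hε⟩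
  obtain ⟨O, hO, hzO, hsrc⟩ := exists_variationDomain_chart (p₀ := p₀) hf.smooth hz
    (by rwa [hfγ a ha])
  have hu := contDiffOn_mapRep_variationDomain hf.smooth hsrc
  have hS := uniqueDiffOn_variationDomain (ε := ε) hab hO
  have hcl := variationDomain_subset_closure_interior (ε := ε) hab hO
  have hA := hu.partialWithin hS (1, 0)
  rw [F.mem_vert_iff_projRep hp']
  have e := coordVec_jacobiMomentum_variationField hab hε hf.smooth hfγ hX hγ
    h.toHasChristoffel hO hsrc hzO
  rw [partialWithin_comm hu hS hcl hzO] at e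
  have e' : coordVec p₀ (γ a) (jacobiMomentum D (Icc a b) γ (extendField X) a) = _ := e
  have hx : extChartAt 𝓘(ℝ, E) p₀ (γ a) = mapRep E p₀ f (a, 0) := by rw [mapRep, hfγ a ha]
  rw [e', hx]
  refine proj_partialWithin_add_christoffel hS hu hA hzO
    ((F.contDiffAt_projRep (hsrc _ hzO)).differentiableAt (by simp)) ?_
    (fun w v ↦ h.projRep_christoffel (extChartAt_mem_target (hsrc _ hzO)) w v) (0, 1)
  rintro ⟨t, s⟩ hy
  have h1 := (hf.leafwise s hy.1.2).tangent t hy.1.1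
  have h2 := hf.smooth.variation_slice hy.1.2
  rw [F.mem_vert_iff_projRep (hsrc _ hy), coordVec_curveVelocity (hsrc _ hy)
    ((h2 t hy.1.1).mdifferentiableWithinAt (by simp)) (hJ t hy.1.1)] at h1
  have h3 : derivWithin (mapRep E p₀ fun t ↦ f (t, s)) (Icc a b) t = _ :=
    (hasDerivWithinAt_slice hO hy hu).derivWithin (hJ t hy.1.1)
  rw [h3] at h1
  exact h1

/-- Variation fields of leafwise geodesic variations are adapted Jacobi fields. -/
lemma HasAdaptedChristoffel.variationField_mem_adaptedJacobiFields
    (h : F.HasAdaptedChristoffel D Γ) (hab : a < b) (hε : 0 < ε)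
    (hγ : ContMDiffOn 𝓘(ℝ, ℝ) 𝓘(ℝ, E) ∞ γ (Icc a b))
    (hf : F.IsLeafwiseGeodesicVariation D a b γ ε f) (hX : IsVariationField f X) :
    X ∈ F.adaptedJacobiFields D a b γ := by
  have : CompleteSpace E := FiniteDimensional.complete ℝ E
  exact ⟨smoothAlong_variationField hab hε hf.smooth hf.eq_curve hX hγ,
    fun t ht ↦ jacobiOperator_variationField hab hε hf.smooth hf.eq_curve hX hγ h.toHasChristoffel
      (fun s hs ↦ (hf.leafwise s hs).geodesic) ht,
    h.jacobiMomentum_variationField_mem_vert hab hε hγ hf hX⟩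

end SmoothFoliation
end

noncomputable section

/-! ### The geodesic flow in a chart -/

section Spray

variable {E : Type*} [NormedAddCommGroup E] [NormedSpace ℝ E]

/-- The second-order vector field whose integral curves are the geodesics and their velocities. -/
def geodesicSpray (G : E → E →L[ℝ] E →L[ℝ] E) (z : E × E) : E × E := (z.2, -G z.1 z.2 z.2)

lemma contDiffAt_geodesicSpray {G : E → E →L[ℝ] E →L[ℝ] E} {z : E × E}
    (hG : ContDiffAt ℝ ∞ G z.1) : ContDiffAt ℝ ∞ (geodesicSpray G) z := by
  have h1 : ContDiffAt ℝ ∞ (fun z : E × E ↦ G z.1) z := hG.comp z contDiffAt_fst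
  exact contDiffAt_snd.prodMk ((h1.clm_apply contDiffAt_snd).clm_apply contDiffAt_snd).neg

/-- `Φ` is a smooth local flow of the spray of `G`; it stays in a region `Ω` over `T` in which the
spray is Lipschitz. -/
structure IsGeodesicFlow (G : E → E →L[ℝ] E →L[ℝ] E) (T : Set E) (z₀ : E × E) (Ω : Set (E × E))
    (K : NNReal) (δ : ℝ) (Φ : ℝ × (E × E) → E × E) : Prop where
  pos : 0 < δ
  isOpen : IsOpen Ω
  mem : z₀ ∈ Ω
  fst_mem : ∀ z ∈ Ω, z.1 ∈ T
  lipschitz : LipschitzOnWith K (geodesicSpray G) Ω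
  smooth : ∀ q ∈ Ioo (-δ) δ ×ˢ Metric.ball z₀ δ, ContDiffAt ℝ ∞ Φ q
  zero : ∀ z ∈ Metric.ball z₀ δ, Φ (0, z) = z
  hasDerivAt : ∀ z ∈ Metric.ball z₀ δ, ∀ t ∈ Ioo (-δ) δ,
    HasDerivAt (fun t ↦ Φ (t, z)) (geodesicSpray G (Φ (t, z))) t
  mem_region : ∀ z ∈ Metric.ball z₀ δ, ∀ t ∈ Ioo (-δ) δ, Φ (t, z) ∈ Ω

lemma exists_isGeodesicFlow [FiniteDimensional ℝ E] {G : E → E →L[ℝ] E →L[ℝ] E} {T : Set E}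
    (hT : IsOpen T) (hG : ContDiffOn ℝ ∞ G T) {z₀ : E × E} (hz : z₀.1 ∈ T) :
    ∃ Ω K δ Φ, IsGeodesicFlow G T z₀ Ω K δ Φ := by
  have hs : ∀ z : E × E, z.1 ∈ T → ContDiffAt ℝ ∞ (geodesicSpray G) z := fun z hz ↦
    contDiffAt_geodesicSpray (hG.contDiffAt (hT.mem_nhds hz))
  obtain ⟨K, N, hN, hK⟩ := ((hs z₀ hz).of_le (m := 1) (by simp)).exists_lipschitzOnWith
  have hTo : IsOpen (Prod.fst ⁻¹' T : Set (E × E)) := hT.preimage continuous_fst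
  -- Being smooth, the spray is Lipschitz near `z₀`. The flow is confined to such a region so that
  -- uniqueness of solutions can be used later.
  set Ω := interior (N ∩ Prod.fst ⁻¹' T) with hΩ
  have hΩN : Ω ∈ 𝓝 z₀ := interior_mem_nhds.2 (inter_mem hN (hTo.mem_nhds hz))
  have hΩT : ∀ z ∈ Ω, z.1 ∈ T := fun z hz ↦ (interior_subset hz).2
  obtain ⟨δ, hδ, Φ, h1, h2⟩ := exists_contDiffOn_flow hΩN
    (G := geodesicSpray G) fun z hz ↦ (hs z (hΩT z hz)).contDiffWithinAt
  exact ⟨Ω, K, δ, Φ, hδ, isOpen_interior, mem_of_mem_nhds hΩN, hΩT,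
    hK.mono fun z hz ↦ (interior_subset hz).1, h1, fun z hz ↦ (h2 z hz).1,
    fun z hz t ht ↦ ((h2 z hz).2 t ht).1, fun z hz t ht ↦ ((h2 z hz).2 t ht).2⟩

end Spray

section GeodesicState

variable {E : Type*} [NormedAddCommGroup E] [NormedSpace ℝ E]
  {M : Type*} [TopologicalSpace M] [ChartedSpace E M] [IsManifold 𝓘(ℝ, E) ∞ M]
  {D : ConnectionOperator E M} {Γ : M → E → E →L[ℝ] E →L[ℝ] E}
  {J : Set ℝ} {c c' : ℝ → M} {p₀ : M} {t : ℝ}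

/-- Position and velocity of a curve, in the chart at `p₀`. -/
def stateRep (p₀ : M) (J : Set ℝ) (c : ℝ → M) (t : ℝ) : E × E :=
  (mapRep E p₀ c t, derivWithin (mapRep E p₀ c) J t)

lemma contDiffWithinAt_stateRep (hJ : UniqueDiffOn ℝ J)
    (hc : ContMDiffOn 𝓘(ℝ, ℝ) 𝓘(ℝ, E) ∞ c J) (ht : t ∈ J) (hp : c t ∈ (chartAt E p₀).source) :
    ContDiffWithinAt ℝ ∞ (stateRep (E := E) p₀ J c) J t :=
  (hc.contDiffWithinAt_mapRep ht hp).prodMk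
    ((hc.contDiffWithinAt_mapRep ht hp).derivWithin hJ (m := ∞) (by simp) ht)

lemma HasChristoffel.hasDerivWithinAt_stateRep (h : HasChristoffel D Γ) (hJ : UniqueDiffOn ℝ J)
    (hc : ContMDiffOn 𝓘(ℝ, ℝ) 𝓘(ℝ, E) ∞ c J) (ht : t ∈ J) (hp : c t ∈ (chartAt E p₀).source)
    (hgeo : covAlong D J c (curveVelocity J c) t = 0) :
    HasDerivWithinAt (stateRep p₀ J c) (geodesicSpray (Γ p₀) (stateRep p₀ J c t)) J t := by
  have hx := hc.contDiffWithinAt_mapRep ht hp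
  have h1 := (hx.differentiableWithinAt (by simp)).hasDerivWithinAt
  have h2 : HasDerivWithinAt (derivWithin (mapRep E p₀ c) J) _ J t := ((hx.derivWithin hJ (m := ∞)
    (by simp) ht).differentiableWithinAt (by simp)).hasDerivWithinAt
  have e := h.coordVec_covAlong_curveVelocity hJ hc ht hp
  rw [hgeo, map_zero] at e
  rw [eq_neg_of_add_eq_zero_left e.symm] at h2
  exact h1.prodMk h2

lemma HasChristoffel.covAlong_eq_zero (h : HasChristoffel D Γ) (hJ : UniqueDiffOn ℝ J)
    (hc : ContMDiffOn 𝓘(ℝ, ℝ) 𝓘(ℝ, E) ∞ c J) (ht : t ∈ J) (hp : c t ∈ (chartAt E p₀).source)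
    (hs : HasDerivWithinAt (stateRep p₀ J c) (geodesicSpray (Γ p₀) (stateRep p₀ J c t)) J t) :
    covAlong D J c (curveVelocity J c) t = 0 := by
  have h2 : HasDerivWithinAt (derivWithin (mapRep E p₀ c) J)
      (-Γ p₀ (mapRep E p₀ c t) (derivWithin (mapRep E p₀ c) J t)
        (derivWithin (mapRep E p₀ c) J t)) J t := hs.snd
  apply coordVec_injective hp
  rw [map_zero, h.coordVec_covAlong_curveVelocity hJ hc ht hp, h2.derivWithin (hJ t ht),
    neg_add_cancel]

/-- Families of geodesics are constructed over open time intervals, where they can be glued, while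
the claims concern `[a, b]`. For a curve smooth beyond the endpoints the two notions of velocity
agree. -/
lemma stateRep_eq_univ {J' : Set ℝ} (hJ' : IsOpen J') (hJ : UniqueDiffOn ℝ J) (hJJ : J ⊆ J')
    (hc : ContMDiffOn 𝓘(ℝ, ℝ) 𝓘(ℝ, E) ∞ c J') (ht : t ∈ J) (hp : c t ∈ (chartAt E p₀).source) :
    stateRep (E := E) p₀ J c t = stateRep p₀ univ c t := by
  have hd : DifferentiableAt ℝ (mapRep E p₀ c) t :=
    ((hc.contDiffWithinAt_mapRep (hJJ ht) hp).contDiffAt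
      (hJ'.mem_nhds (hJJ ht))).differentiableAt (by simp)
  rw [stateRep, stateRep, derivWithin_univ, hd.derivWithin (hJ t ht)]

lemma stateRep_eventuallyEq_univ {J' : Set ℝ} (hJ' : IsOpen J') (hJ : UniqueDiffOn ℝ J)
    (hJJ : J ⊆ J') (hc : ContMDiffOn 𝓘(ℝ, ℝ) 𝓘(ℝ, E) ∞ c J') (ht : t ∈ J)
    (hp : c t ∈ (chartAt E p₀).source) :
    stateRep (E := E) p₀ J c =ᶠ[𝓝[J] t] stateRep p₀ univ c := by
  filter_upwards [eventually_mem_chart_source ((hc.mono hJJ) t ht).continuousWithinAt hp,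
    self_mem_nhdsWithin] with r hr hrJ
  exact stateRep_eq_univ hJ' hJ hJJ hc hrJ hr

/-- The geodesic equation at the time `t`, in all charts. -/
def IsGeodesicAt (Γ : M → E → E →L[ℝ] E →L[ℝ] E) (c : ℝ → M) (t : ℝ) : Prop :=
  ∀ p₀ : M, c t ∈ (chartAt E p₀).source →
    HasDerivAt (stateRep p₀ univ c) (geodesicSpray (Γ p₀) (stateRep p₀ univ c t)) t

lemma stateRep_congr (h : c =ᶠ[𝓝 t] c') :
    stateRep (E := E) p₀ univ c =ᶠ[𝓝 t] stateRep p₀ univ c' := by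
  have h1 : mapRep E p₀ c =ᶠ[𝓝 t] mapRep E p₀ c' := h.mono fun r hr ↦ by rw [mapRep, mapRep, hr]
  filter_upwards [h1, h1.deriv] with r hr hr'
  rw [stateRep, stateRep, derivWithin_univ, derivWithin_univ, hr, hr']

lemma IsGeodesicAt.congr (hc : IsGeodesicAt Γ c t) (h : c =ᶠ[𝓝 t] c') : IsGeodesicAt Γ c' t := by
  intro p₀ hp
  rw [← h.eq_of_nhds] at hp
  have e := stateRep_congr (E := E) (p₀ := p₀) h
  have := (hc p₀ hp).congr_of_eventuallyEq e.symm
  rwa [e.eq_of_nhds] at this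

lemma IsGeodesicAt.covAlong_eq_zero (h : HasChristoffel D Γ) {J' : Set ℝ} (hJ' : IsOpen J')
    (hJ : UniqueDiffOn ℝ J) (hJJ : J ⊆ J') (hc : ContMDiffOn 𝓘(ℝ, ℝ) 𝓘(ℝ, E) ∞ c J') (ht : t ∈ J)
    (hg : IsGeodesicAt Γ c t) : covAlong D J c (curveVelocity J c) t = 0 := by
  have hp := mem_chart_source E (c t)
  have e := stateRep_eventuallyEq_univ hJ' hJ hJJ hc ht hp
  refine h.covAlong_eq_zero hJ (hc.mono hJJ) ht hp ?_
  rw [e.eq_of_nhdsWithin ht]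
  exact (hg _ hp).hasDerivWithinAt.congr_of_eventuallyEq e (e.eq_of_nhdsWithin ht)

/-- Independence of the chart: in each chart the equation expresses the vanishing of `covAlong` of
the velocity, in which no chart is chosen. -/
lemma HasChristoffel.isGeodesicAt (h : HasChristoffel D Γ) (hJ : IsOpen J)
    (hc : ContMDiffOn 𝓘(ℝ, ℝ) 𝓘(ℝ, E) ∞ c J) (ht : t ∈ J) (hp : c t ∈ (chartAt E p₀).source)
    (hs : HasDerivAt (stateRep p₀ univ c) (geodesicSpray (Γ p₀) (stateRep p₀ univ c t)) t) :
    IsGeodesicAt Γ c t := by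
  have hJ' := hJ.uniqueDiffOn (𝕜 := ℝ)
  have e := stateRep_eventuallyEq_univ hJ hJ' Subset.rfl hc ht hp
  have h1 : covAlong D J c (curveVelocity J c) t = 0 := by
    refine h.covAlong_eq_zero hJ' hc ht hp ?_
    rw [e.eq_of_nhdsWithin ht]
    exact hs.hasDerivWithinAt.congr_of_eventuallyEq e (e.eq_of_nhdsWithin ht)
  intro p₁ hp₁
  have e1 := stateRep_eventuallyEq_univ hJ hJ' Subset.rfl hc ht hp₁
  have h2 := h.hasDerivWithinAt_stateRep hJ' hc ht hp₁ h1
  rw [e1.eq_of_nhdsWithin ht] at h2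
  exact (h2.congr_of_eventuallyEq e1.symm (e1.eq_of_nhdsWithin ht).symm).hasDerivAt
    (hJ.mem_nhds ht)

/-- A smooth family of geodesics, over the time interval `(α, β)` and the parameters `(-ε, ε)`. -/
structure IsGeodesicFamily (Γ : M → E → E →L[ℝ] E →L[ℝ] E) (α β ε : ℝ) (f : ℝ × ℝ → M) :
    Prop where
  smooth : ContMDiffOn 𝓘(ℝ, ℝ × ℝ) 𝓘(ℝ, E) ∞ f (Ioo α β ×ˢ Ioo (-ε) ε)
  geodesic : ∀ t ∈ Ioo α β, ∀ s ∈ Ioo (-ε) ε, IsGeodesicAt Γ (fun t ↦ f (t, s)) t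

lemma ContMDiffOn.slice_of_prod {I S : Set ℝ} {f : ℝ × ℝ → M}
    (hf : ContMDiffOn 𝓘(ℝ, ℝ × ℝ) 𝓘(ℝ, E) ∞ f (I ×ˢ S)) {s : ℝ} (hs : s ∈ S) :
    ContMDiffOn 𝓘(ℝ, ℝ) 𝓘(ℝ, E) ∞ (fun t ↦ f (t, s)) I := by
  have h2 : ContDiff ℝ ∞ (fun r : ℝ ↦ (r, s)) := by fun_prop
  exact hf.comp h2.contMDiff.contMDiffOn fun t ht ↦ ⟨ht, hs⟩

section Flow

variable {z₀ : E × E} {Ω : Set (E × E)} {K : NNReal} {δ ε τ : ℝ} {Φ : ℝ × (E × E) → E × E}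
  {Z : ℝ → E × E}

/-- The curves in `M` given by a geodesic flow in the chart at `p₀`, with initial states `Z s` at
the time `τ`. -/
def flowFamily (p₀ : M) (Φ : ℝ × (E × E) → E × E) (τ : ℝ) (Z : ℝ → E × E) (q : ℝ × ℝ) : M :=
  (extChartAt 𝓘(ℝ, E) p₀).symm (Φ (q.1 - τ, Z q.2)).1

lemma IsGeodesicFlow.flowFamily_mem_source
    (hΦ : IsGeodesicFlow (Γ p₀) (extChartAt 𝓘(ℝ, E) p₀).target z₀ Ω K δ Φ) {t s : ℝ}
    (hs : Z s ∈ Metric.ball z₀ δ) (ht : t ∈ Ioo (τ - δ) (τ + δ)) :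
    flowFamily p₀ Φ τ Z (t, s) ∈ (chartAt E p₀).source :=
  extChartAt_symm_mem_source (hΦ.fst_mem _ (hΦ.mem_region _ hs _
    ⟨by linarith [ht.1], by linarith [ht.2]⟩))

/-- For the spray, the second component of the flow is the derivative of the first, so the states of
the projected curves are the flow itself. -/
lemma IsGeodesicFlow.stateRep_flowFamily
    (hΦ : IsGeodesicFlow (Γ p₀) (extChartAt 𝓘(ℝ, E) p₀).target z₀ Ω K δ Φ) {t s : ℝ}
    (hs : Z s ∈ Metric.ball z₀ δ) (ht : t ∈ Ioo (τ - δ) (τ + δ)) :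
    stateRep p₀ univ (fun t ↦ flowFamily p₀ Φ τ Z (t, s)) t = Φ (t - τ, Z s) := by
  have e (r : ℝ) (hr : r ∈ Ioo (τ - δ) (τ + δ)) :
      mapRep E p₀ (fun t ↦ flowFamily p₀ Φ τ Z (t, s)) r = (Φ (r - τ, Z s)).1 :=
    (extChartAt 𝓘(ℝ, E) p₀).right_inv (hΦ.fst_mem _ (hΦ.mem_region _ hs _
      ⟨by linarith [hr.1], by linarith [hr.2]⟩))
  have e' : mapRep E p₀ (fun t ↦ flowFamily p₀ Φ τ Z (t, s)) =ᶠ[𝓝 t]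
      fun r ↦ (Φ (r - τ, Z s)).1 := by
    filter_upwards [isOpen_Ioo.mem_nhds ht] with r hr using e r hr
  have hd : HasDerivAt (fun r ↦ Φ (r - τ, Z s)) (geodesicSpray (Γ p₀) (Φ (t - τ, Z s))) t :=
    (hΦ.hasDerivAt _ hs (t - τ) ⟨by linarith [ht.1], by linarith [ht.2]⟩).comp_sub_const t τ
  rw [stateRep, derivWithin_univ, e'.deriv_eq, e t ht]
  have hd' : HasDerivAt (fun r ↦ (Φ (r - τ, Z s)).1) (Φ (t - τ, Z s)).2 t := hd.fst
  exact Prod.ext rfl hd'.deriv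

lemma IsGeodesicFlow.isGeodesicFamily (h : HasChristoffel D Γ)
    (hΦ : IsGeodesicFlow (Γ p₀) (extChartAt 𝓘(ℝ, E) p₀).target z₀ Ω K δ Φ)
    (hZ : ContDiffOn ℝ ∞ Z (Ioo (-ε) ε)) (hZb : ∀ s ∈ Ioo (-ε) ε, Z s ∈ Metric.ball z₀ δ) :
    IsGeodesicFamily Γ (τ - δ) (τ + δ) ε (flowFamily p₀ Φ τ Z) := by
  have hmem : ∀ q ∈ Ioo (τ - δ) (τ + δ) ×ˢ Ioo (-ε) ε,
      (q.1 - τ, Z q.2) ∈ Ioo (-δ) δ ×ˢ Metric.ball z₀ δ := fun q hq ↦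
    ⟨⟨by linarith [hq.1.1], by linarith [hq.1.2]⟩, hZb _ hq.2⟩
  have hsm : ContMDiffOn 𝓘(ℝ, ℝ × ℝ) 𝓘(ℝ, E) ∞ (flowFamily p₀ Φ τ Z)
      (Ioo (τ - δ) (τ + δ) ×ˢ Ioo (-ε) ε) := by
    intro q hq
    have h1 : ContDiffWithinAt ℝ ∞ (fun q : ℝ × ℝ ↦ (q.1 - τ, Z q.2))
        (Ioo (τ - δ) (τ + δ) ×ˢ Ioo (-ε) ε) q :=
      (contDiffWithinAt_fst.sub contDiffWithinAt_const).prodMk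
        ((hZ _ hq.2).comp q contDiffWithinAt_snd fun r hr ↦ hr.2)
    have h2 : ContDiffWithinAt ℝ ∞ (fun q : ℝ × ℝ ↦ (Φ (q.1 - τ, Z q.2)).1)
        (Ioo (τ - δ) (τ + δ) ×ˢ Ioo (-ε) ε) q :=
      ((hΦ.smooth _ (hmem q hq)).comp_contDiffWithinAt q h1).fst
    exact (contMDiffAt_extChartAt_symm (hΦ.fst_mem _ (hΦ.mem_region _ (hmem q hq).2 _
      (hmem q hq).1))).comp_contMDiffWithinAt q h2.contMDiffWithinAt
  refine ⟨hsm, fun t ht s hs ↦ h.isGeodesicAt isOpen_Ioo (hsm.slice_of_prod hs) ht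
    (hΦ.flowFamily_mem_source (hZb s hs) ht) ?_⟩
  have e : stateRep p₀ univ (fun t ↦ flowFamily p₀ Φ τ Z (t, s)) =ᶠ[𝓝 t]
      fun r ↦ Φ (r - τ, Z s) := by
    filter_upwards [isOpen_Ioo.mem_nhds ht] with r hr using hΦ.stateRep_flowFamily (hZb s hs) hr
  rw [e.eq_of_nhds]
  exact ((hΦ.hasDerivAt _ (hZb s hs) (t - τ) ⟨by linarith [ht.1], by linarith [ht.2]⟩).comp_sub_const
    t τ).congr_of_eventuallyEq e

end Flow

end GeodesicState
end

noncomputable section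

/-! ### Continuation of families of geodesics -/

section Continuation

variable {E : Type*} [NormedAddCommGroup E] [NormedSpace ℝ E]
  {M : Type*} [TopologicalSpace M] [ChartedSpace E M] [IsManifold 𝓘(ℝ, E) ∞ M]
  {D : ConnectionOperator E M} {Γ : M → E → E →L[ℝ] E →L[ℝ] E}
  {z₀ : E × E} {Ω : Set (E × E)} {K : NNReal} {δ ε τ : ℝ} {Φ : ℝ × (E × E) → E × E}
  {Z : ℝ → E × E} {a b : ℝ} {γ : ℝ → M} {p₀ : M}

lemma eventually_state_mem {a b : ℝ} (hab : a < b)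
    (hγ : ContMDiffOn 𝓘(ℝ, ℝ) 𝓘(ℝ, E) ∞ γ (Icc a b)) {τ₀ : ℝ} (hτ : τ₀ ∈ Icc a b)
    (hp : γ τ₀ ∈ (chartAt E p₀).source) {N : Set (E × E)}
    (hN : N ∈ 𝓝 (stateRep p₀ (Icc a b) γ τ₀)) :
    ∃ ρ > 0, ∀ t ∈ Icc a b, |t - τ₀| < ρ →
      γ t ∈ (chartAt E p₀).source ∧ stateRep p₀ (Icc a b) γ t ∈ N := by
  have h1 := eventually_mem_chart_source (hγ τ₀ hτ).continuousWithinAt hp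
  have h2 := (contDiffWithinAt_stateRep (uniqueDiffOn_Icc hab) hγ hτ hp).continuousWithinAt.eventually
    hN
  obtain ⟨ρ, hρ, h⟩ := Metric.mem_nhdsWithin_iff.1 (h1.and h2)
  exact ⟨ρ, hρ, fun t ht htρ ↦ h ⟨by rwa [Metric.mem_ball, Real.dist_eq], ht⟩⟩

/-- A geodesic whose states stay in the domain of a flow is given by the flow. -/
lemma IsGeodesicFlow.eq_stateRep (h : HasChristoffel D Γ)
    (hΦ : IsGeodesicFlow (Γ p₀) (extChartAt 𝓘(ℝ, E) p₀).target z₀ Ω K δ Φ) (hab : a < b)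
    (hγ : ContMDiffOn 𝓘(ℝ, ℝ) 𝓘(ℝ, E) ∞ γ (Icc a b))
    (hgeo : ∀ t ∈ Icc a b, covAlong D (Icc a b) γ (curveVelocity (Icc a b) γ) t = 0)
    {τ₁ τ₂ : ℝ} (h1 : a ≤ τ₁) (h12 : τ₁ ≤ τ₂) (h2 : τ₂ ≤ b) (hδ : τ₂ - τ₁ < δ)
    (hmem : ∀ t ∈ Icc τ₁ τ₂, γ t ∈ (chartAt E p₀).source ∧ stateRep (E := E) p₀ (Icc a b) γ t ∈ Ω)
    (hball : stateRep p₀ (Icc a b) γ τ₁ ∈ Metric.ball z₀ δ) :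
    Φ (τ₂ - τ₁, stateRep p₀ (Icc a b) γ τ₁) = stateRep (E := E) p₀ (Icc a b) γ τ₂ := by
  set z : E × E := stateRep p₀ (Icc a b) γ τ₁
  have hδ0 := hΦ.pos
  have hsub : Icc τ₁ τ₂ ⊆ Icc a b := Icc_subset_Icc h1 h2
  have hd1 : ∀ t ∈ Icc τ₁ τ₂, HasDerivAt (fun r ↦ Φ (r - τ₁, z))
      (geodesicSpray (Γ p₀) (Φ (t - τ₁, z))) t := fun t ht ↦
    (hΦ.hasDerivAt _ hball (t - τ₁) ⟨by linarith [ht.1], by linarith [ht.2]⟩).comp_sub_const t τ₁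
  have hd2 : ∀ t ∈ Icc τ₁ τ₂, HasDerivWithinAt (stateRep p₀ (Icc a b) γ)
      (geodesicSpray (Γ p₀) (stateRep p₀ (Icc a b) γ t)) (Icc a b) t := fun t ht ↦
    h.hasDerivWithinAt_stateRep (uniqueDiffOn_Icc hab) hγ (hsub ht) (hmem t ht).1 (hgeo t (hsub ht))
  -- Both curves stay in the Lipschitz region `Ω`. The right-sided form is used because `γ` has only
  -- one-sided derivatives at the ends of `[a, b]`.
  refine ODE_solution_unique_of_mem_Icc_right (v := fun _ ↦ geodesicSpray (Γ p₀)) (s := fun _ ↦ Ω)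
    (K := K) (f := fun r ↦ Φ (r - τ₁, z)) (fun t ht ↦ hΦ.lipschitz)
    (HasDerivAt.continuousOn hd1) (fun t ht ↦ (hd1 t ⟨ht.1, ht.2.le⟩).hasDerivWithinAt)
    (fun t ht ↦ hΦ.mem_region _ hball _ ⟨by linarith [ht.1], by linarith [ht.2]⟩)
    (fun t ht ↦ ((hd2 t ht).continuousWithinAt).mono hsub)
    (fun t ht ↦ (hd2 t ⟨ht.1, ht.2.le⟩).mono_of_mem_nhdsWithin ?_)
    (fun t ht ↦ (hmem t ⟨ht.1, ht.2.le⟩).2) ?_ (right_mem_Icc.2 h12)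
  · exact mem_of_superset (Icc_mem_nhdsGE (ht.2.trans_le h2)) (Icc_subset_Icc_left (h1.trans ht.1))
  · simp only [sub_self]
    exact hΦ.zero _ hball

/-- States of a family of geodesics are smooth. -/
lemma IsGeodesicFamily.contDiffAt_stateRep {α β : ℝ} {f : ℝ × ℝ → M}
    (hf : IsGeodesicFamily Γ α β ε f) {t s : ℝ} (ht : t ∈ Ioo α β) (hs : s ∈ Ioo (-ε) ε)
    (hp : f (t, s) ∈ (chartAt E p₀).source) :
    ContDiffAt ℝ ∞ (fun q : ℝ × ℝ ↦ stateRep (E := E) p₀ univ (fun t ↦ f (t, q.2)) q.1) (t, s) := by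
  have hO : IsOpen (Ioo α β ×ˢ Ioo (-ε) ε) := isOpen_Ioo.prod isOpen_Ioo
  have hsrc : ∀ᶠ q in 𝓝 (t, s), q ∈ Ioo α β ×ˢ Ioo (-ε) ε ∧ f q ∈ (chartAt E p₀).source :=
    (hO.eventually_mem (show (t, s) ∈ _ from ⟨ht, hs⟩)).and
      (((hf.smooth.continuousOn _ ⟨ht, hs⟩).continuousAt (hO.mem_nhds ⟨ht, hs⟩)).preimage_mem_nhds
        ((chartAt E p₀).open_source.mem_nhds hp))
  have hu : ∀ q, q ∈ Ioo α β ×ˢ Ioo (-ε) ε ∧ f q ∈ (chartAt E p₀).source →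
      ContDiffAt ℝ ∞ (mapRep E p₀ f) q := fun q hq ↦
    (hf.smooth.contDiffWithinAt_mapRep hq.1 hq.2).contDiffAt (hO.mem_nhds hq.1)
  have h1 : ContDiffAt ℝ ∞ (fun q ↦ fderiv ℝ (mapRep E p₀ f) q (1, 0)) (t, s) :=
    ((hu _ hsrc.self_of_nhds).fderiv_right (m := ∞) (by simp)).clm_apply contDiffAt_const
  refine ((hu _ hsrc.self_of_nhds).prodMk h1).congr_of_eventuallyEq ?_
  filter_upwards [hsrc] with q hq
  have h2 : HasDerivAt (fun r : ℝ ↦ (r, q.2)) (1, 0) q.1 :=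
    (hasDerivAt_id q.1).prodMk (hasDerivAt_const q.1 q.2)
  have h3 : HasDerivAt (mapRep E p₀ fun t ↦ f (t, q.2)) (fderiv ℝ (mapRep E p₀ f) q (1, 0)) q.1 :=
    HasFDerivAt.comp_hasDerivAt (l := mapRep E p₀ f) q.1
      ((hu q hq).differentiableAt (by simp)).hasFDerivAt h2
  rw [stateRep, derivWithin_univ, h3.deriv]
  rfl

lemma IsGeodesicFamily.mono {α β α' β' ε' : ℝ} {f : ℝ × ℝ → M} (hf : IsGeodesicFamily Γ α β ε f)
    (h1 : α ≤ α') (h2 : β' ≤ β) (h3 : ε' ≤ ε) : IsGeodesicFamily Γ α' β' ε' f := by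
  have e1 : Ioo α' β' ⊆ Ioo α β := Ioo_subset_Ioo h1 h2
  have e2 : Ioo (-ε') ε' ⊆ Ioo (-ε) ε := Ioo_subset_Ioo (by linarith) h3
  exact ⟨hf.smooth.mono (prod_mono e1 e2), fun t ht s hs ↦ hf.geodesic t (e1 ht) s (e2 hs)⟩

/-- A family of geodesics agrees near the time `τ` with the flow of its states at the time `τ`. -/
lemma IsGeodesicFamily.exists_eq_flowFamily {α β : ℝ} {f : ℝ × ℝ → M}
    (hf : IsGeodesicFamily Γ α β ε f) (hε : 0 < ε)
    (hΦ : IsGeodesicFlow (Γ p₀) (extChartAt 𝓘(ℝ, E) p₀).target z₀ Ω K δ Φ)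
    (hτ : τ ∈ Ioo α β) (hp : f (τ, 0) ∈ (chartAt E p₀).source)
    (hz : stateRep p₀ univ (fun t ↦ f (t, 0)) τ ∈ Ω ∩ Metric.ball z₀ δ) :
    ∃ ε' > 0, ε' ≤ ε ∧ ∃ η > 0, α ≤ τ - η ∧ τ + η ≤ β ∧
      ContDiffOn ℝ ∞ (fun s ↦ stateRep (E := E) p₀ univ (fun t ↦ f (t, s)) τ) (Ioo (-ε') ε') ∧
      (∀ s ∈ Ioo (-ε') ε', stateRep p₀ univ (fun t ↦ f (t, s)) τ ∈ Metric.ball z₀ δ) ∧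
      ∀ t ∈ Ioo (τ - η) (τ + η), ∀ s ∈ Ioo (-ε') ε',
        flowFamily p₀ Φ τ (fun s ↦ stateRep p₀ univ (fun t ↦ f (t, s)) τ) (t, s) = f (t, s) := by
  have h0 : (0 : ℝ) ∈ Ioo (-ε) ε := by simpa using hε
  have hO : IsOpen (Ioo α β ×ˢ Ioo (-ε) ε) := isOpen_Ioo.prod isOpen_Ioo
  set S : ℝ × ℝ → E × E := fun q ↦ stateRep p₀ univ (fun t ↦ f (t, q.2)) q.1 with hS
  have hSc : ContinuousAt S (τ, 0) := (hf.contDiffAt_stateRep hτ h0 hp).continuousAt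
  have hev : ∀ᶠ q in 𝓝 (τ, (0 : ℝ)), (q ∈ Ioo α β ×ˢ Ioo (-ε) ε ∧ f q ∈ (chartAt E p₀).source) ∧
      S q ∈ Ω ∩ Metric.ball z₀ δ :=
    ((hO.eventually_mem (show (τ, (0 : ℝ)) ∈ _ from ⟨hτ, h0⟩)).and
      (((hf.smooth.continuousOn _ ⟨hτ, h0⟩).continuousAt (hO.mem_nhds ⟨hτ, h0⟩)).preimage_mem_nhds
        ((chartAt E p₀).open_source.mem_nhds hp))).and
      (hSc.preimage_mem_nhds ((hΦ.isOpen.inter Metric.isOpen_ball).mem_nhds hz))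
  obtain ⟨r, hr, hball⟩ := Metric.eventually_nhds_iff_ball.1 hev
  have hδ := hΦ.pos
  -- One radius for time and for parameter: `r` keeps the states of `f` in the region of the flow,
  -- and `δ` is the lifetime of the flow.
  set η := min r δ with hη
  have hη0 : 0 < η := lt_min hr hδ
  have hmem : ∀ t ∈ Ioo (τ - η) (τ + η), ∀ s ∈ Ioo (-η) η, (t, s) ∈ Metric.ball (τ, (0 : ℝ)) r := by
    intro t ht s hs
    rw [← ball_prod_same]
    refine ⟨?_, ?_⟩
    · rw [Metric.mem_ball, Real.dist_eq, abs_lt]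
      constructor <;> linarith [ht.1, ht.2, min_le_left r δ]
    · rw [Metric.mem_ball, Real.dist_eq, abs_lt]
      constructor <;> linarith [hs.1, hs.2, min_le_left r δ]
  have hττ : τ ∈ Ioo (τ - η) (τ + η) := ⟨by linarith, by linarith⟩
  have hsub : Ioo (τ - η) (τ + η) ⊆ Ioo α β := fun t ht ↦
    (hball _ (hmem t ht 0 ⟨by linarith, hη0⟩)).1.1.1
  have hsub' : Ioo (-η) η ⊆ Ioo (-ε) ε := fun s hs ↦ (hball _ (hmem τ hττ s hs)).1.1.2
  have hlt : τ - η < τ + η := by linarith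
  have hb1 := (Ioo_subset_Ioo_iff hlt).1 hsub
  have hb2 := (Ioo_subset_Ioo_iff (by linarith : -η < η)).1 hsub'
  refine ⟨η, hη0, hb2.2, η, hη0, hb1.1, hb1.2, ?_, ?_, ?_⟩
  · intro s hs
    have h1 := hball _ (hmem τ hττ s hs)
    have h2 : ContDiffAt ℝ ∞ (fun s : ℝ ↦ (τ, s)) s := by fun_prop
    exact ((hf.contDiffAt_stateRep h1.1.1.1 h1.1.1.2 h1.1.2).comp s h2).contDiffWithinAt
  · exact fun s hs ↦ (hball _ (hmem τ hττ s hs)).2.2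
  · intro t ht s hs
    have hZ : S (τ, s) ∈ Metric.ball z₀ δ := (hball _ (hmem τ hττ s hs)).2.2
    have key : EqOn (fun t ↦ Φ (t - τ, S (τ, s))) (fun t ↦ S (t, s)) (Ioo (τ - η) (τ + η)) := by
      refine ODE_solution_unique_of_mem_Ioo (v := fun _ ↦ geodesicSpray (Γ p₀)) (s := fun _ ↦ Ω)
        (K := K) (fun _ _ ↦ hΦ.lipschitz) hττ (fun t ht ↦ ?_) (fun t ht ↦ ?_) ?_
      · have ht' : t - τ ∈ Ioo (-δ) δ := by
          constructor <;> linarith [ht.1, ht.2, min_le_right r δ]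
        exact ⟨(hΦ.hasDerivAt _ hZ _ ht').comp_sub_const t τ, hΦ.mem_region _ hZ _ ht'⟩
      · have h1 := hball _ (hmem t ht s hs)
        exact ⟨hf.geodesic t h1.1.1.1 s h1.1.1.2 p₀ h1.1.2, h1.2.1⟩
      · simp only [sub_self]
        exact hΦ.zero _ hZ
    have e : Φ (t - τ, S (τ, s)) = S (t, s) := key ht
    have h1 := hball _ (hmem t ht s hs)
    change (extChartAt 𝓘(ℝ, E) p₀).symm (Φ (t - τ, S (τ, s))).1 = f (t, s)
    rw [e]
    exact extChartAt_left_inv h1.1.2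

/-- Extension of a family of geodesics by the flow of its states at the time `τ`. -/
lemma IsGeodesicFamily.glue {α β β' η : ℝ} {f g : ℝ × ℝ → M}
    (hf : IsGeodesicFamily Γ α β ε f) (hη : 0 < η) (hβ : τ ≤ β)
    (hg : IsGeodesicFamily Γ (τ - η) β' ε g)
    (hfg : ∀ t ∈ Ioo (τ - η) (τ + η), ∀ s ∈ Ioo (-ε) ε, g (t, s) = f (t, s)) :
    IsGeodesicFamily Γ α β' ε (fun q ↦ if q.1 < τ then f q else g q) := by
  classical
  -- Near a point before the time `τ` the glued map is `f`. Near any other point it is `g`, because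
  -- `g` and `f` agree on the strip around `τ`. Both conditions are local.
  set k : ℝ × ℝ → M := fun q ↦ if q.1 < τ then f q else g q with hk
  have e1 : ∀ q : ℝ × ℝ, q.1 < τ → k =ᶠ[𝓝 q] f := fun q hq ↦ by
    filter_upwards [(isOpen_Iio.preimage continuous_fst).mem_nhds hq] with r hr
    exact if_pos hr
  have e2 : ∀ q : ℝ × ℝ, τ ≤ q.1 → q.2 ∈ Ioo (-ε) ε → k =ᶠ[𝓝 q] g := fun q hq hq2 ↦ by
    have hq1 : q.1 ∈ Ioi (τ - η) := by rw [mem_Ioi]; linarith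
    filter_upwards [(isOpen_Ioi.preimage continuous_fst).mem_nhds hq1,
      (isOpen_Ioo.preimage continuous_snd).mem_nhds hq2] with r hr hr2
    by_cases h : r.1 < τ
    · rw [hk]
      simp only [if_pos h]
      exact (hfg r.1 ⟨hr, by linarith⟩ r.2 hr2).symm
    · exact if_neg h
  have hO : IsOpen (Ioo α β ×ˢ Ioo (-ε) ε) := isOpen_Ioo.prod isOpen_Ioo
  have hO' : IsOpen (Ioo (τ - η) β' ×ˢ Ioo (-ε) ε) := isOpen_Ioo.prod isOpen_Ioo
  have sl : ∀ {u v : ℝ × ℝ → M} {t s : ℝ}, u =ᶠ[𝓝 (t, s)] v →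
      (fun r ↦ u (r, s)) =ᶠ[𝓝 t] fun r ↦ v (r, s) := fun {u v t s} huv ↦
    (show ContinuousAt (fun r : ℝ ↦ (r, s)) t by fun_prop).tendsto.eventually huv
  constructor
  · rintro q ⟨hq1, hq2⟩
    refine ContMDiffAt.contMDiffWithinAt ?_
    rcases lt_or_ge q.1 τ with h | h
    · exact (hf.smooth.contMDiffAt (hO.mem_nhds ⟨⟨hq1.1, by linarith⟩, hq2⟩)).congr_of_eventuallyEq
        (e1 q h)
    · exact (hg.smooth.contMDiffAt (hO'.mem_nhds ⟨⟨by linarith, hq1.2⟩, hq2⟩)).congr_of_eventuallyEq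
        (e2 q h hq2)
  · intro t ht s hs
    rcases lt_or_ge t τ with h | h
    · exact (hf.geodesic t ⟨ht.1, by linarith⟩ s hs).congr (sl (e1 (t, s) h)).symm
    · exact (hg.geodesic t ⟨by linarith, ht.2⟩ s hs).congr (sl (e2 (t, s) h hs)).symm

/-- A family of geodesics, defined up to the time `β`, that contains `γ` and agrees with `f₀` at the
initial time. -/
structure IsGeodesicExtension (Γ : M → E → E →L[ℝ] E →L[ℝ] E) (f₀ : ℝ × ℝ → M) (a b : ℝ)
    (γ : ℝ → M) (α β ε : ℝ) (f : ℝ × ℝ → M) : Prop where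
  family : IsGeodesicFamily Γ α β ε f
  eq_curve : ∀ t ∈ Icc a b, t < β → f (t, 0) = γ t
  init : ∀ s ∈ Ioo (-ε) ε, (fun t ↦ f (t, s)) =ᶠ[𝓝 a] fun t ↦ f₀ (t, s)

lemma IsGeodesicExtension.stateRep_eq {f₀ f : ℝ × ℝ → M} {α β : ℝ}
    (hf : IsGeodesicExtension Γ f₀ a b γ α β ε f) (hε : 0 < ε) (hab : a < b) (hα : α < a)
    {t : ℝ} (ht : t ∈ Icc a b) (htβ : t < β) (hp : γ t ∈ (chartAt E p₀).source) :
    stateRep (E := E) p₀ univ (fun t ↦ f (t, 0)) t = stateRep p₀ (Icc a b) γ t := by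
  have h0 : (0 : ℝ) ∈ Ioo (-ε) ε := by simpa using hε
  have htα : t ∈ Ioo α β := ⟨hα.trans_le ht.1, htβ⟩
  have hp' : f (t, 0) ∈ (chartAt E p₀).source := by rwa [hf.eq_curve t ht htβ]
  have hd : DifferentiableAt ℝ (mapRep E p₀ fun t ↦ f (t, 0)) t :=
    (((hf.family.smooth.slice_of_prod h0).contDiffWithinAt_mapRep htα hp').contDiffAt
      (isOpen_Ioo.mem_nhds htα)).differentiableAt (by simp)
  have e : mapRep E p₀ (fun t ↦ f (t, 0)) =ᶠ[𝓝[Icc a b] t] mapRep E p₀ γ := by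
    filter_upwards [self_mem_nhdsWithin, mem_nhdsWithin_of_mem_nhds (Iio_mem_nhds htβ)] with r hr hr'
    rw [mapRep, mapRep, hf.eq_curve r hr hr']
  have e' := e.eq_of_nhdsWithin ht
  rw [stateRep, stateRep, e', derivWithin_univ, ← e.derivWithin_eq e',
    hd.derivWithin (uniqueDiffOn_Icc hab t ht)]

variable [FiniteDimensional ℝ E]

/-- A family of geodesics around `γ` near the time `a` can be continued along `γ`. -/
theorem HasChristoffel.exists_isGeodesicExtension (h : HasChristoffel D Γ) (hab : a < b)
    (hγ : ContMDiffOn 𝓘(ℝ, ℝ) 𝓘(ℝ, E) ∞ γ (Icc a b))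
    (hgeo : ∀ t ∈ Icc a b, covAlong D (Icc a b) γ (curveVelocity (Icc a b) γ) t = 0)
    {f₀ : ℝ × ℝ → M} {α₀ β₀ ε₀ : ℝ} (hα₀ : α₀ < a) (hβ₀ : a < β₀) (hε₀ : 0 < ε₀)
    (hf₀ : IsGeodesicFamily Γ α₀ β₀ ε₀ f₀) (hf₀γ : ∀ t ∈ Icc a b, t < β₀ → f₀ (t, 0) = γ t) :
    ∃ α < a, ∃ β > b, ∃ ε > 0, ∃ f, IsGeodesicExtension Γ f₀ a b γ α β ε f := by
  classical
  -- Continuation past `τ` is shown to be a locally constant property of `τ`, so compactness is not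
  -- used. The parameter interval may shrink at each restart.
  suffices H : ∀ τ ∈ Icc a b, ∃ α < a, ∃ β > τ, ∃ ε > 0, ∃ f,
      IsGeodesicExtension Γ f₀ a b γ α β ε f from H b (right_mem_Icc.2 hab.le)
  refine forall_mem_Icc_of_eventually_iff (fun τ₀ hτ₀ ↦ ?_)
    ⟨α₀, hα₀, β₀, hβ₀, ε₀, hε₀, f₀, hf₀, hf₀γ, fun s _ ↦ .rfl⟩
  set p₀ := γ τ₀
  have hp : γ τ₀ ∈ (chartAt E p₀).source := mem_chart_source E (γ τ₀)
  set z₀ : E × E := stateRep p₀ (Icc a b) γ τ₀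
  obtain ⟨Ω, K, δ, Φ, hΦ⟩ := exists_isGeodesicFlow (z₀ := z₀) (isOpen_extChartAt_target p₀)
    (h.smooth p₀) (extChartAt_mem_target hp)
  have hδ := hΦ.pos
  obtain ⟨ρ', hρ', hmem⟩ := eventually_state_mem hab hγ hτ₀ hp
    (inter_mem (hΦ.isOpen.mem_nhds hΦ.mem) (Metric.ball_mem_nhds z₀ hδ))
  -- With `ρ ≤ δ / 2`, a flow of lifetime `δ` restarted at any `τ₁` within `ρ` of `τ₀` lasts beyond
  -- any such `τ₂`. The step is therefore symmetric in `τ₁` and `τ₂`.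
  set ρ := min ρ' (δ / 2) with hρdef
  have hρ : 0 < ρ := lt_min hρ' (by linarith)
  have hρ1 : ρ ≤ ρ' := min_le_left _ _
  have hρ2 : ρ ≤ δ / 2 := min_le_right _ _
  have step : ∀ τ₁ ∈ Icc a b, |τ₁ - τ₀| < ρ → ∀ τ₂ ∈ Icc a b, |τ₂ - τ₀| < ρ →
      (∃ α < a, ∃ β > τ₁, ∃ ε > 0, ∃ f, IsGeodesicExtension Γ f₀ a b γ α β ε f) →
      ∃ α < a, ∃ β > τ₂, ∃ ε > 0, ∃ f, IsGeodesicExtension Γ f₀ a b γ α β ε f := by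
    rintro τ₁ hτ₁ h1 τ₂ hτ₂ h2 ⟨α, hα, β, hβ, ε, hε, f, hf⟩
    rw [abs_lt] at h2
    have h1' := abs_lt.1 h1
    obtain ⟨hsrc, hΩ⟩ := hmem τ₁ hτ₁ (h1.trans_le hρ1)
    have hτα : τ₁ ∈ Ioo α β := ⟨hα.trans_le hτ₁.1, hβ⟩
    have hst := hf.stateRep_eq (p₀ := p₀) hε hab hα hτ₁ hβ hsrc
    obtain ⟨ε', hε', hεε, η, hη, hη1, hη2, hZ, hZb, hagree⟩ :=
      hf.family.exists_eq_flowFamily hε hΦ hτα (by rwa [hf.eq_curve τ₁ hτ₁ hβ]) (by rwa [hst])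
    set Z : ℝ → E × E := fun s ↦ stateRep p₀ univ (fun t ↦ f (t, s)) τ₁
    have hfam := hΦ.isGeodesicFamily (τ := τ₁) h hZ hZb
    set η' := min η δ
    have hη' : 0 < η' := lt_min hη hδ
    have hη'1 : η' ≤ η := min_le_left _ _
    have hη'2 : η' ≤ δ := min_le_right _ _
    have hagree' : ∀ t ∈ Ioo (τ₁ - η') (τ₁ + η'), ∀ s ∈ Ioo (-ε') ε',
        flowFamily p₀ Φ τ₁ Z (t, s) = f (t, s) := fun t ht s hs ↦
      hagree t ⟨by linarith [ht.1], by linarith [ht.2]⟩ s hs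
    refine ⟨α, hα, τ₀ + ρ, by linarith [h2.2], ε', hε',
      fun q ↦ if q.1 < τ₁ then f q else flowFamily p₀ Φ τ₁ Z q, ?_, ?_, ?_⟩
    · exact (hf.family.mono le_rfl le_rfl hεε).glue hη' hβ.le
        (hfam.mono (by linarith) (by linarith) le_rfl) hagree'
    · intro t ht htβ
      by_cases htτ : t < τ₁
      · simp only [if_pos htτ]
        exact hf.eq_curve t ht (htτ.trans hβ)
      · simp only [if_neg htτ]
        rw [not_lt] at htτ
        have hm : ∀ r ∈ Icc τ₁ t, γ r ∈ (chartAt E p₀).source ∧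
            stateRep p₀ (Icc a b) γ r ∈ Ω ∩ Metric.ball z₀ δ := fun r hr ↦
          hmem r ⟨hτ₁.1.trans hr.1, hr.2.trans ht.2⟩
            (abs_lt.2 ⟨by linarith [hr.1], by linarith [hr.2]⟩)
        have e := hΦ.eq_stateRep h hab hγ hgeo hτ₁.1 htτ ht.2 (by linarith)
          (fun r hr ↦ ⟨(hm r hr).1, (hm r hr).2.1⟩) hΩ.2
        change (extChartAt 𝓘(ℝ, E) p₀).symm (Φ (t - τ₁, Z 0)).1 = γ t
        have e0 : Z 0 = stateRep p₀ (Icc a b) γ τ₁ := hst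
        rw [e0, e]
        exact extChartAt_left_inv (hm t (right_mem_Icc.2 htτ)).1
    · intro s hs
      refine EventuallyEq.trans ?_ (hf.init s (Ioo_subset_Ioo (by linarith) hεε hs))
      -- If the cut is at `a` itself, a neighbourhood of `a` meets both pieces, and the agreement of
      -- the pieces there preserves the initial germ.
      rcases hτ₁.1.lt_or_eq with h3 | h3
      · filter_upwards [Iio_mem_nhds h3] with t ht
        exact if_pos ht
      · filter_upwards [Ioo_mem_nhds (by linarith : τ₁ - η' < a) (by linarith : a < τ₁ + η')]
          with t ht
        by_cases htτ : t < τ₁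
        · exact if_pos htτ
        · simp only [if_neg htτ]
          exact hagree' t ht s hs
  have hN : ∀ᶠ t in 𝓝[Icc a b] τ₀, |t - τ₀| < ρ :=
    mem_nhdsWithin_of_mem_nhds (by
      filter_upwards [Metric.ball_mem_nhds τ₀ hρ] with t ht
      rwa [Metric.mem_ball, Real.dist_eq] at ht)
  filter_upwards [self_mem_nhdsWithin, hN] with t ht htρ
  have h00 : |τ₀ - τ₀| < ρ := by simpa using hρ
  exact ⟨step τ₀ hτ₀ h00 t ht htρ, step t ht htρ τ₀ hτ₀ h00⟩

end Continuation
end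

noncomputable section

/-! ### Geodesic variations with prescribed initial data -/

section Existence

variable {E : Type*} [NormedAddCommGroup E] [NormedSpace ℝ E] [FiniteDimensional ℝ E]
  {M : Type*} [TopologicalSpace M] [ChartedSpace E M] [IsManifold 𝓘(ℝ, E) ∞ M]
  {D : ConnectionOperator E M} {Γ : M → E → E →L[ℝ] E →L[ℝ] E}
  {a b : ℝ} {γ : ℝ → M} {p₀ : M}

/-- A geodesic has a geodesic variation with prescribed initial states. -/
theorem HasChristoffel.exists_geodesic_variation (h : HasChristoffel D Γ) (hab : a < b)
    (hγ : ContMDiffOn 𝓘(ℝ, ℝ) 𝓘(ℝ, E) ∞ γ (Icc a b))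
    (hgeo : ∀ t ∈ Icc a b, covAlong D (Icc a b) γ (curveVelocity (Icc a b) γ) t = 0)
    (hp : γ a ∈ (chartAt E p₀).source) {Z : ℝ → E × E} (hZ : ∀ᶠ s in 𝓝 0, ContDiffAt ℝ ∞ Z s)
    (hZ0 : Z 0 = stateRep p₀ (Icc a b) γ a) :
    ∃ ε > 0, ∃ f : ℝ × ℝ → M, ContMDiffOn 𝓘(ℝ, ℝ × ℝ) 𝓘(ℝ, E) ∞ f (Icc a b ×ˢ Ioo (-ε) ε) ∧
      (∀ s ∈ Ioo (-ε) ε, ∀ t ∈ Icc a b, covAlong D (Icc a b) (fun t ↦ f (t, s))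
        (curveVelocity (Icc a b) (fun t ↦ f (t, s))) t = 0) ∧
      (∀ t ∈ Icc a b, f (t, 0) = γ t) ∧
      ∀ s ∈ Ioo (-ε) ε, f (a, s) ∈ (chartAt E p₀).source ∧
        stateRep p₀ (Icc a b) (fun t ↦ f (t, s)) a = Z s := by
  have ha : a ∈ Icc a b := left_mem_Icc.2 hab.le
  have hJ := uniqueDiffOn_Icc hab
  -- A flow around the initial state of `γ` gives the family for a short time, on both sides of `a`;
  -- the continuation theorem then extends it along `γ`.
  obtain ⟨Ω, K, δ, Φ, hΦ⟩ := exists_isGeodesicFlow (z₀ := Z 0) (isOpen_extChartAt_target p₀)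
    (h.smooth p₀) (by rw [hZ0]; exact extChartAt_mem_target hp)
  have hδ := hΦ.pos
  obtain ⟨ρ', hρ', hmem⟩ := eventually_state_mem (p₀ := p₀) (N := Ω ∩ Metric.ball (Z 0) δ) hab hγ ha
    hp (by rw [← hZ0]; exact inter_mem (hΦ.isOpen.mem_nhds hΦ.mem) (Metric.ball_mem_nhds _ hδ))
  set ρ := min ρ' δ
  have hρ : 0 < ρ := lt_min hρ' hδ
  have hρ1 : ρ ≤ ρ' := min_le_left _ _
  have hρ2 : ρ ≤ δ := min_le_right _ _
  obtain ⟨ε₀, hε₀, hε₀Z⟩ := Metric.eventually_nhds_iff_ball.1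
    (hZ.and (hZ.self_of_nhds.continuousAt.preimage_mem_nhds (Metric.ball_mem_nhds _ hδ)))
  have hε₀Z' : ∀ s ∈ Ioo (-ε₀) ε₀, ContDiffAt ℝ ∞ Z s ∧ Z s ∈ Metric.ball (Z 0) δ := fun s hs ↦
    hε₀Z s (by rwa [Metric.mem_ball, Real.dist_eq, sub_zero, abs_lt])
  have hfam := hΦ.isGeodesicFamily (τ := a) h (fun s hs ↦ (hε₀Z' s hs).1.contDiffWithinAt)
    fun s hs ↦ (hε₀Z' s hs).2
  have hcurve : ∀ t ∈ Icc a b, t < a + ρ → flowFamily p₀ Φ a Z (t, 0) = γ t := by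
    intro t ht htρ
    have hm : ∀ r ∈ Icc a t, γ r ∈ (chartAt E p₀).source ∧
        stateRep p₀ (Icc a b) γ r ∈ Ω ∩ Metric.ball (Z 0) δ := fun r hr ↦
      hmem r ⟨hr.1, hr.2.trans ht.2⟩ (abs_lt.2 ⟨by linarith [hr.1], by linarith [hr.2]⟩)
    have e := hΦ.eq_stateRep h hab hγ hgeo le_rfl ht.1 ht.2 (by linarith)
      (fun r hr ↦ ⟨(hm r hr).1, (hm r hr).2.1⟩) (hm a ⟨le_rfl, ht.1⟩).2.2
    change (extChartAt 𝓘(ℝ, E) p₀).symm (Φ (t - a, Z 0)).1 = γ t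
    rw [hZ0, e]
    exact extChartAt_left_inv (hm t (right_mem_Icc.2 ht.1)).1
  obtain ⟨α, hα, β, hβ, ε', hε', f, hf⟩ := h.exists_isGeodesicExtension hab hγ hgeo
    (by linarith : a - δ < a) (by linarith : a < a + ρ) hε₀ (hfam.mono le_rfl (by linarith) le_rfl)
    hcurve
  set ε := min ε₀ ε'
  have hεs : ∀ s ∈ Ioo (-ε) ε, s ∈ Ioo (-ε₀) ε₀ ∧ s ∈ Ioo (-ε') ε' := fun s hs ↦
    ⟨⟨by linarith [hs.1, min_le_left ε₀ ε'], hs.2.trans_le (min_le_left _ _)⟩,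
      ⟨by linarith [hs.1, min_le_right ε₀ ε'], hs.2.trans_le (min_le_right _ _)⟩⟩
  have hsub : Icc a b ⊆ Ioo α β := fun t ht ↦ ⟨hα.trans_le ht.1, ht.2.trans_lt hβ⟩
  refine ⟨ε, lt_min hε₀ hε', f, hf.family.smooth.mono (prod_mono hsub fun s hs ↦ (hεs s hs).2),
    fun s hs t ht ↦ (hf.family.geodesic t (hsub ht) s (hεs s hs).2).covAlong_eq_zero h isOpen_Ioo hJ
      hsub (hf.family.smooth.slice_of_prod (hεs s hs).2) ht,
    fun t ht ↦ hf.eq_curve t ht (ht.2.trans_lt hβ), fun s hs ↦ ?_⟩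
  have e := hf.init s (hεs s hs).2
  have haδ : a ∈ Ioo (a - δ) (a + δ) := ⟨by linarith, by linarith⟩
  have hb := (hε₀Z' s (hεs s hs).1).2
  have hs' : f (a, s) ∈ (chartAt E p₀).source := by
    have e0 : f (a, s) = flowFamily p₀ Φ a Z (a, s) := e.eq_of_nhds
    rw [e0]
    exact hΦ.flowFamily_mem_source hb haδ
  refine ⟨hs', ?_⟩
  rw [stateRep_eq_univ isOpen_Ioo hJ hsub (hf.family.smooth.slice_of_prod (hεs s hs).2) ha hs',
    (stateRep_congr e).eq_of_nhds, hΦ.stateRep_flowFamily hb haδ, sub_self, hΦ.zero _ hb]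

end Existence

namespace SmoothFoliation

variable {E' : Type*} [NormedAddCommGroup E'] [NormedSpace ℝ E']
  {E'' : Type*} [NormedAddCommGroup E''] [NormedSpace ℝ E''] [FiniteDimensional ℝ E'']
  {E : Type*} [NormedAddCommGroup E] [NormedSpace ℝ E] [FiniteDimensional ℝ E]
  {M : Type*} [TopologicalSpace M] [ChartedSpace E M] [IsManifold 𝓘(ℝ, E) ∞ M]
  [RiemannianBundle (fun p : M ↦ TangentSpace 𝓘(ℝ, E) p)]
  [IsContMDiffRiemannianBundle 𝓘(ℝ, E) ∞ E (fun p : M ↦ TangentSpace 𝓘(ℝ, E) p)]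
  {F : SmoothFoliation E' E'' E M} {D : ConnectionOperator E M}
  {Γ : M → E → E →L[ℝ] E →L[ℝ] E} {a b : ℝ} {γ : ℝ → M}

/-- The `s`-derivative lives over `f (t, 0)`; it is moved to the fibre over `γ t` by substituting
the equality of base points. -/
lemma exists_isVariationField {f : ℝ × ℝ → M} (hf : ∀ t ∈ Icc a b, f (t, 0) = γ t) :
    ∃ X : Π t : Icc a b, TangentSpace 𝓘(ℝ, E) (γ t), IsVariationField f X := by
  have H : ∀ (p q : M) (v : TangentSpace 𝓘(ℝ, E) q), q = p → ∃ w : TangentSpace 𝓘(ℝ, E) p,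
      (⟨p, w⟩ : TangentBundle 𝓘(ℝ, E) M) = ⟨q, v⟩ := by
    rintro p q v rfl
    exact ⟨v, rfl⟩
  choose X hX using fun t : Icc a b ↦ H (γ t) (f (t, 0))
    (mfderiv 𝓘(ℝ, ℝ) 𝓘(ℝ, E) (fun s : ℝ ↦ f (t, s)) 0 (1 : ℝ)) (hf t t.2)
  exact ⟨X, hX⟩

/-- There is a leafwise geodesic variation whose variation field has prescribed initial data. -/
theorem HasAdaptedChristoffel.exists_variationField (h : F.HasAdaptedChristoffel D Γ) (hab : a < b)
    (hγ : F.IsLeafwiseGeodesic D a b γ) (u : TangentSpace 𝓘(ℝ, E) (γ a))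
    {w : TangentSpace 𝓘(ℝ, E) (γ a)} (hw : w ∈ F.vert (γ a)) :
    ∃ ε > 0, ∃ f : ℝ × ℝ → M, F.IsLeafwiseGeodesicVariation D a b γ ε f ∧
      ∃ X : Π t : Icc a b, TangentSpace 𝓘(ℝ, E) (γ t), IsVariationField f X ∧
        extendField X a = u ∧ jacobiInitial D X a = w := by
  have : CompleteSpace E := FiniteDimensional.complete ℝ E
  have ha : a ∈ Icc a b := left_mem_Icc.2 hab.le
  have hJ := uniqueDiffOn_Icc hab
  obtain ⟨p₀, hp⟩ : ∃ p₀ : M, γ a ∈ (chartAt E p₀).source := ⟨γ a, mem_chart_source E (γ a)⟩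
  set x₀ : E := mapRep E p₀ γ a
  have hx₀ : x₀ ∈ (extChartAt 𝓘(ℝ, E) p₀).target := extChartAt_mem_target hp
  set v₀ : E := derivWithin (mapRep E p₀ γ) (Icc a b) a
  set u' : E := coordVec p₀ (γ a) u
  set w' : E := coordVec p₀ (γ a) w
  have hw' : F.projRep p₀ x₀ w' = w' := (F.mem_vert_iff_projRep hp).1 hw
  have hv₀ : F.projRep p₀ x₀ v₀ = v₀ := by
    have h1 := (F.mem_vert_iff_projRep hp).1 (hγ.tangent a ha)
    rwa [coordVec_curveVelocity hp ((hγ.smooth a ha).mdifferentiableWithinAt (by simp))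
      (hJ a ha)] at h1
  -- The momentum at `a` is `∂_s ∂_t f + Γ(v₀, u')` in coordinates, so `k` is the `s`-derivative of
  -- the velocity that would produce `w'`.
  set k : E := w' - Γ p₀ x₀ v₀ u'
  set xs : ℝ → E := fun s ↦ x₀ + s • u'
  have hxs : ContDiff ℝ ∞ xs := by fun_prop
  have hxs0 : xs 0 = x₀ := by simp [xs]
  have hπ : ContDiffAt ℝ ∞ (F.projRep p₀) x₀ := F.contDiffAt_projRep hp
  -- The projection makes the initial velocity vertical at the moving base point. It also changes
  -- the `s`-derivative, from `k` to `dP(u') v₀ + P k`.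
  set ys : ℝ → E := fun s ↦ F.projRep p₀ (xs s) (v₀ + s • k)
  have hxsT : ∀ᶠ s in 𝓝 0, xs s ∈ (extChartAt 𝓘(ℝ, E) p₀).target :=
    hxs.continuous.continuousAt.preimage_mem_nhds
      (by rw [hxs0]; exact (isOpen_extChartAt_target p₀).mem_nhds hx₀)
  have hZ : ∀ᶠ s in 𝓝 0, ContDiffAt ℝ ∞ (fun s ↦ (xs s, ys s)) s := by
    filter_upwards [hxsT] with s hs
    have h1 : ContDiffAt ℝ ∞ (F.projRep p₀) (xs s) :=
      (F.contDiffOn_projRep p₀).contDiffAt ((isOpen_extChartAt_target p₀).mem_nhds hs)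
    have h2 : ContDiff ℝ ∞ (fun s : ℝ ↦ v₀ + s • k) := by fun_prop
    exact hxs.contDiffAt.prodMk ((h1.comp s hxs.contDiffAt).clm_apply h2.contDiffAt)
  have hZ0 : (xs 0, ys 0) = stateRep p₀ (Icc a b) γ a := by
    refine Prod.ext hxs0 ?_
    change F.projRep p₀ (xs 0) (v₀ + (0 : ℝ) • k) = v₀
    rw [hxs0, zero_smul, add_zero, hv₀]
  obtain ⟨ε, hε, f, hf, hfgeo, hfγ, hfst⟩ := h.exists_geodesic_variation hab hγ.smooth hγ.geodesic
    hp hZ hZ0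
  have hslice : ∀ s ∈ Ioo (-ε) ε, ContMDiffOn 𝓘(ℝ, ℝ) 𝓘(ℝ, E) ∞ (fun t ↦ f (t, s)) (Icc a b) :=
    fun s hs ↦ hf.variation_slice hs
  have hfa : ∀ s ∈ Ioo (-ε) ε, mapRep E p₀ f (a, s) = xs s ∧
      derivWithin (mapRep E p₀ fun t ↦ f (t, s)) (Icc a b) a = ys s := fun s hs ↦
    ⟨congrArg Prod.fst (hfst s hs).2, congrArg Prod.snd (hfst s hs).2⟩
  have hvert : ∀ s ∈ Ioo (-ε) ε, ∀ t ∈ Icc a b,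
      curveVelocity (E := E) (Icc a b) (fun t ↦ f (t, s)) t ∈ F.vert (f (t, s)) := by
    intro s hs
    -- Only the initial velocity has to be vertical, and it lies in the image of the projection by
    -- construction.
    refine h.curveVelocity_mem_vert hab (hslice s hs) (hfgeo s hs) ?_
    have hsrc := (hfst s hs).1
    rw [F.mem_vert_iff_projRep hsrc, coordVec_curveVelocity hsrc
      ((hslice s hs a ha).mdifferentiableWithinAt (by simp)) (hJ a ha), (hfa s hs).2]
    have e1 : extChartAt 𝓘(ℝ, E) p₀ (f (a, s)) = xs s := (hfa s hs).1
    rw [e1]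
    exact F.projRep_projRep (e1 ▸ extChartAt_mem_target hsrc) _
  have hvar : F.IsLeafwiseGeodesicVariation D a b γ ε f := ⟨hf, fun s hs ↦ ⟨hslice s hs,
    ⟨_, mem_leaf_of_curveVelocity_mem_vert hab (hslice s hs) (hvert s hs)⟩, hvert s hs,
    hfgeo s hs⟩, hfγ⟩
  obtain ⟨X, hX⟩ := exists_isVariationField (E := E) hfγ
  refine ⟨ε, hε, f, hvar, X, hX, ?_⟩
  have h0 : (0 : ℝ) ∈ Ioo (-ε) ε := by simpa using hε
  obtain ⟨O, hO, hzO, hsrc⟩ := exists_variationDomain_chart (p₀ := p₀) hf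
    (show (a, (0 : ℝ)) ∈ Icc a b ×ˢ Ioo (-ε) ε from ⟨ha, h0⟩) (by rwa [hfγ a ha])
  have hu := contDiffOn_mapRep_variationDomain hf hsrc
  have hS := uniqueDiffOn_variationDomain (ε := ε) hab hO
  have hcl := variationDomain_subset_closure_interior (ε := ε) hab hO
  have hA := hu.partialWithin hS (1, 0)
  have eu : partialWithin (variationDomain a b ε O) (mapRep E p₀ f) (0, 1) (a, 0) = u' := by
    have h1 := hasDerivAt_slice hO hzO hu
    have h2 : HasDerivAt (fun s ↦ mapRep E p₀ f (a, s)) u' 0 := by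
      have h3 : HasDerivAt xs u' 0 := by
        simpa [xs] using ((hasDerivAt_id (0 : ℝ)).smul_const u').const_add x₀
      refine h3.congr_of_eventuallyEq ?_
      filter_upwards [isOpen_Ioo.mem_nhds h0] with s hs using (hfa s hs).1
    exact h1.unique h2
  have ev : ∀ s, (a, s) ∈ variationDomain a b ε O →
      partialWithin (variationDomain a b ε O) (mapRep E p₀ f) (1, 0) (a, s) = ys s := fun s hs ↦ by
    rw [← (hfa s hs.1.2).2]
    exact ((hasDerivWithinAt_slice hO hs hu).derivWithin (hJ a ha)).symm
  have ev0 : partialWithin (variationDomain a b ε O) (mapRep E p₀ f) (1, 0) (a, 0) = v₀ :=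
    (ev 0 hzO).trans (congrArg Prod.snd hZ0)
  have ex0 : mapRep E p₀ f (a, 0) = x₀ := (hfa 0 h0).1.trans hxs0
  have ew : partialWithin (variationDomain a b ε O)
      (partialWithin (variationDomain a b ε O) (mapRep E p₀ f) (1, 0)) (0, 1) (a, 0) =
      fderiv ℝ (F.projRep p₀) x₀ u' v₀ + F.projRep p₀ x₀ k := by
    have h1 := hasDerivAt_slice hO hzO hA
    have h2 : HasDerivAt ys (fderiv ℝ (F.projRep p₀) x₀ u' v₀ + F.projRep p₀ x₀ k) 0 := by
      have h3 : HasDerivAt xs u' 0 := by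
        simpa [xs] using ((hasDerivAt_id (0 : ℝ)).smul_const u').const_add x₀
      have h4 : HasDerivAt (fun s : ℝ ↦ v₀ + s • k) k 0 := by
        simpa using ((hasDerivAt_id (0 : ℝ)).smul_const k).const_add v₀
      have h5 : HasFDerivAt (F.projRep p₀) (fderiv ℝ (F.projRep p₀) x₀) (xs 0) := by
        rw [hxs0]; exact (hπ.differentiableAt (by simp)).hasFDerivAt
      have h6 := (h5.comp_hasDerivAt 0 h3).clm_apply h4
      simp only [Function.comp_apply, hxs0, zero_smul, add_zero] at h6
      exact h6
    refine h1.unique (h2.congr_of_eventuallyEq ?_)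
    filter_upwards [eventually_mem_variationDomain_right hO hzO] with s hs using ev s hs
  have eX : extendField X a = u :=
    coordVec_injective hp ((alongRep_variationField hf hfγ hX hO hsrc hzO).trans eu)
  refine ⟨eX, coordVec_injective hp ?_⟩
  refine (coordVec_jacobiMomentum_variationField hab hε hf hfγ hX hγ.smooth h.toHasChristoffel
    hO hsrc hzO).trans ?_
  rw [partialWithin_comm hu hS hcl hzO, ew, eu, ev0, ex0]
  -- As `P` is parallel and `P v₀ = v₀`, the sum `dP(u') v₀ + Γ(v₀, u')` equals `P Γ(v₀, u')`. The
  -- momentum is then `P (Γ(v₀, u') + k) = P w' = w'`, so the projection has not spoiled it.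
  have hc := h.projRep_christoffel hx₀ v₀ u'
  rw [hv₀] at hc
  have : fderiv ℝ (F.projRep p₀) x₀ u' v₀ + F.projRep p₀ x₀ k + Γ p₀ x₀ v₀ u' =
      (fderiv ℝ (F.projRep p₀) x₀ u' v₀ + Γ p₀ x₀ v₀ u') + F.projRep p₀ x₀ k := by abel
  rw [this, hc, ← map_add, add_sub_cancel, hw']

end SmoothFoliation
end

noncomputable section

/-! ### The space of Jacobi fields -/

section Linearity

variable {E : Type*} [NormedAddCommGroup E] [NormedSpace ℝ E] [CompleteSpace E]
  {M : Type*} [TopologicalSpace M] [ChartedSpace E M] [IsManifold 𝓘(ℝ, E) ∞ M]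
  {D : ConnectionOperator E M} {Γ : M → E → E →L[ℝ] E →L[ℝ] E}
  {a b : ℝ} {γ : ℝ → M}

section Extend

variable (X Y : Π t : Icc a b, TangentSpace 𝓘(ℝ, E) (γ t)) (c : ℝ)

lemma extendField_add : extendField (X + Y) = fun t ↦ extendField X t + extendField Y t := by
  funext t
  by_cases ht : t ∈ Icc a b
  · simp only [extendField_of_mem ht]
    rfl
  · simp only [extendField, dif_neg ht, add_zero]

lemma extendField_smul : extendField (c • X) = fun t ↦ c • extendField X t := by
  funext t
  by_cases ht : t ∈ Icc a b
  · simp only [extendField_of_mem ht]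
    rfl
  · simp only [extendField, dif_neg ht, smul_zero]

lemma extendField_zero :
    extendField (0 : Π t : Icc a b, TangentSpace 𝓘(ℝ, E) (γ t)) = fun _ ↦ 0 := by
  funext t
  by_cases ht : t ∈ Icc a b
  · rw [extendField_of_mem ht]
    rfl
  · simp only [extendField, dif_neg ht]

end Extend

variable {J : Set ℝ} {X Y : Π t, TangentSpace 𝓘(ℝ, E) (γ t)} {t : ℝ}

namespace HasChristoffel

lemma torsionTensor_add (h : HasChristoffel D Γ) {p : M} (u v w : TangentSpace 𝓘(ℝ, E) p) :
    torsionTensor D p u (v + w) = torsionTensor D p u v + torsionTensor D p u w := by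
  have hp := mem_chart_source E p
  apply coordVec_injective hp
  rw [map_add, h.coordVec_torsionTensor hp, h.coordVec_torsionTensor hp,
    h.coordVec_torsionTensor hp]
  simp only [map_add, _root_.add_apply]
  abel

lemma torsionTensor_smul (h : HasChristoffel D Γ) {p : M} (c : ℝ) (u v : TangentSpace 𝓘(ℝ, E) p) :
    torsionTensor D p u (c • v) = c • torsionTensor D p u v := by
  have hp := mem_chart_source E p
  apply coordVec_injective hp
  rw [map_smul, h.coordVec_torsionTensor hp, h.coordVec_torsionTensor hp]
  simp only [map_smul, _root_.smul_apply, smul_sub]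

lemma curvatureTensor_add (h : HasChristoffel D Γ) {p : M} (u v w z : TangentSpace 𝓘(ℝ, E) p) :
    curvatureTensor D p u (v + w) z = curvatureTensor D p u v z + curvatureTensor D p u w z := by
  have hp := mem_chart_source E p
  apply coordVec_injective hp
  rw [map_add, h.coordVec_curvatureTensor hp, h.coordVec_curvatureTensor hp,
    h.coordVec_curvatureTensor hp]
  simp only [christoffelCurvature, map_add, _root_.add_apply]
  abel

lemma curvatureTensor_smul (h : HasChristoffel D Γ) {p : M} (c : ℝ)
    (u v z : TangentSpace 𝓘(ℝ, E) p) :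
    curvatureTensor D p u (c • v) z = c • curvatureTensor D p u v z := by
  have hp := mem_chart_source E p
  apply coordVec_injective hp
  rw [map_smul, h.coordVec_curvatureTensor hp, h.coordVec_curvatureTensor hp]
  simp only [christoffelCurvature, map_smul, _root_.smul_apply, smul_sub, smul_add]

lemma jacobiMomentum_add (h : HasChristoffel D Γ) (hJ : UniqueDiffOn ℝ J)
    (hX : SmoothAlong J γ X) (hY : SmoothAlong J γ Y) (ht : t ∈ J) :
    jacobiMomentum D J γ (fun t ↦ X t + Y t) t =
      jacobiMomentum D J γ X t + jacobiMomentum D J γ Y t := by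
  simp only [jacobiMomentum]
  rw [h.covAlong_add hJ hX hY ht, h.torsionTensor_add]
  abel

lemma jacobiMomentum_const_smul (h : HasChristoffel D Γ) (hJ : UniqueDiffOn ℝ J)
    (hX : SmoothAlong J γ X) (c : ℝ) (ht : t ∈ J) :
    jacobiMomentum D J γ (fun t ↦ c • X t) t = c • jacobiMomentum D J γ X t := by
  simp only [jacobiMomentum]
  rw [h.covAlong_const_smul hJ hX c ht, h.torsionTensor_smul, smul_sub]

lemma jacobiOperator_add (h : HasChristoffel D Γ) (hJ : UniqueDiffOn ℝ J)
    (hX : SmoothAlong J γ X) (hY : SmoothAlong J γ Y) (ht : t ∈ J) :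
    jacobiOperator D J γ (fun t ↦ X t + Y t) t =
      jacobiOperator D J γ X t + jacobiOperator D J γ Y t := by
  have e : covAlong D J γ (jacobiMomentum D J γ fun t ↦ X t + Y t) t =
      covAlong D J γ (fun s ↦ jacobiMomentum D J γ X s + jacobiMomentum D J γ Y s) t :=
    covAlong_congr (by
      filter_upwards [self_mem_nhdsWithin] with s hs using h.jacobiMomentum_add hJ hX hY hs)
      (h.jacobiMomentum_add hJ hX hY ht)
  rw [h.jacobiOperator_eq hJ hX ht, h.jacobiOperator_eq hJ hY ht,
    h.jacobiOperator_eq hJ (hX.add hY) ht, e, h.covAlong_add hJ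
      (h.smoothAlong_jacobiMomentum hJ hX) (h.smoothAlong_jacobiMomentum hJ hY) ht,
    h.curvatureTensor_add]
  abel

lemma jacobiOperator_const_smul (h : HasChristoffel D Γ) (hJ : UniqueDiffOn ℝ J)
    (hX : SmoothAlong J γ X) (c : ℝ) (ht : t ∈ J) :
    jacobiOperator D J γ (fun t ↦ c • X t) t = c • jacobiOperator D J γ X t := by
  have e : covAlong D J γ (jacobiMomentum D J γ fun t ↦ c • X t) t =
      covAlong D J γ (fun s ↦ c • jacobiMomentum D J γ X s) t :=
    covAlong_congr (by
      filter_upwards [self_mem_nhdsWithin] with s hs using h.jacobiMomentum_const_smul hJ hX c hs)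
      (h.jacobiMomentum_const_smul hJ hX c ht)
  rw [h.jacobiOperator_eq hJ hX ht, h.jacobiOperator_eq hJ (hX.const_smul c) ht, e,
    h.covAlong_const_smul hJ (h.smoothAlong_jacobiMomentum hJ hX) c ht, h.curvatureTensor_smul,
    smul_sub]

end HasChristoffel

end Linearity

namespace SmoothFoliation

variable {E' : Type*} [NormedAddCommGroup E'] [NormedSpace ℝ E']
  {E'' : Type*} [NormedAddCommGroup E''] [NormedSpace ℝ E''] [FiniteDimensional ℝ E'']
  {E : Type*} [NormedAddCommGroup E] [NormedSpace ℝ E] [FiniteDimensional ℝ E]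
  {M : Type*} [TopologicalSpace M] [ChartedSpace E M] [IsManifold 𝓘(ℝ, E) ∞ M]
  [RiemannianBundle (fun p : M ↦ TangentSpace 𝓘(ℝ, E) p)]
  [IsContMDiffRiemannianBundle 𝓘(ℝ, E) ∞ E (fun p : M ↦ TangentSpace 𝓘(ℝ, E) p)]
  {F : SmoothFoliation E' E'' E M} {D : ConnectionOperator E M}
  {Γ : M → E → E →L[ℝ] E →L[ℝ] E} {a b : ℝ} {γ : ℝ → M}

lemma mem_adaptedJacobiFields_iff {X : Π t : Icc a b, TangentSpace 𝓘(ℝ, E) (γ t)} :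
    X ∈ F.adaptedJacobiFields D a b γ ↔ SmoothAlong (Icc a b) γ (extendField X) ∧
      (∀ t ∈ Icc a b, jacobiOperator D (Icc a b) γ (extendField X) t = 0) ∧
      jacobiInitial D X a ∈ F.vert (γ a) := Iff.rfl

lemma jacobiInitial_add [CompleteSpace E] (h : HasChristoffel D Γ) (hab : a < b)
    {X Y : Π t : Icc a b, TangentSpace 𝓘(ℝ, E) (γ t)}
    (hX : SmoothAlong (Icc a b) γ (extendField X)) (hY : SmoothAlong (Icc a b) γ (extendField Y)) :
    jacobiInitial D (X + Y) a = jacobiInitial D X a + jacobiInitial D Y a :=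
  (congrArg (fun V ↦ jacobiMomentum D (Icc a b) γ V a) (extendField_add X Y)).trans
    (h.jacobiMomentum_add (uniqueDiffOn_Icc hab) hX hY (left_mem_Icc.2 hab.le))

lemma jacobiInitial_smul [CompleteSpace E] (h : HasChristoffel D Γ) (hab : a < b)
    {X : Π t : Icc a b, TangentSpace 𝓘(ℝ, E) (γ t)}
    (hX : SmoothAlong (Icc a b) γ (extendField X)) (c : ℝ) :
    jacobiInitial D (c • X) a = c • jacobiInitial D X a :=
  (congrArg (fun V ↦ jacobiMomentum D (Icc a b) γ V a) (extendField_smul X c)).trans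
    (h.jacobiMomentum_const_smul (uniqueDiffOn_Icc hab) hX c (left_mem_Icc.2 hab.le))

lemma smul_mem_adaptedJacobiFields [CompleteSpace E] (h : HasChristoffel D Γ) (hab : a < b) (c : ℝ)
    {X : Π t : Icc a b, TangentSpace 𝓘(ℝ, E) (γ t)} (hX : X ∈ F.adaptedJacobiFields D a b γ) :
    c • X ∈ F.adaptedJacobiFields D a b γ := by
  rw [mem_adaptedJacobiFields_iff] at hX ⊢
  rw [extendField_smul, jacobiInitial_smul h hab hX.1]
  refine ⟨hX.1.const_smul c, fun t ht ↦ ?_, Submodule.smul_mem _ c hX.2.2⟩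
  rw [h.jacobiOperator_const_smul (uniqueDiffOn_Icc hab) hX.1 c ht, hX.2.1 t ht, smul_zero]

lemma add_mem_adaptedJacobiFields [CompleteSpace E] (h : HasChristoffel D Γ) (hab : a < b)
    {X Y : Π t : Icc a b, TangentSpace 𝓘(ℝ, E) (γ t)} (hX : X ∈ F.adaptedJacobiFields D a b γ)
    (hY : Y ∈ F.adaptedJacobiFields D a b γ) : X + Y ∈ F.adaptedJacobiFields D a b γ := by
  rw [mem_adaptedJacobiFields_iff] at hX hY ⊢
  rw [extendField_add, jacobiInitial_add h hab hX.1 hY.1]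
  refine ⟨hX.1.add hY.1, fun t ht ↦ ?_, Submodule.add_mem _ hX.2.2 hY.2.2⟩
  rw [h.jacobiOperator_add (uniqueDiffOn_Icc hab) hX.1 hY.1 ht, hX.2.1 t ht, hY.2.1 t ht, add_zero]

/-- The adapted Jacobi fields along `γ`, as a linear space. -/
def jacobiSubmodule [CompleteSpace E] (F : SmoothFoliation E' E'' E M) (h : HasChristoffel D Γ)
    (hab : a < b) (hγ : ContMDiffOn 𝓘(ℝ, ℝ) 𝓘(ℝ, E) ∞ γ (Icc a b)) :
    Submodule ℝ (Π t : Icc a b, TangentSpace 𝓘(ℝ, E) (γ t)) where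
  carrier := F.adaptedJacobiFields D a b γ
  add_mem' := add_mem_adaptedJacobiFields h hab
  smul_mem' c _ := smul_mem_adaptedJacobiFields h hab c
  zero_mem' := by
    have hv : SmoothAlong (Icc a b) γ
        (extendField (0 : Π t : Icc a b, TangentSpace 𝓘(ℝ, E) (γ t))) := by
      rw [extendField_zero]
      -- The zero field is smooth along `γ` as a zero multiple of the velocity.
      simpa only [zero_smul] using
        (smoothAlong_curveVelocity (E := E) (uniqueDiffOn_Icc hab) hγ).const_smul 0
    have e0 : (0 : ℝ) • (0 : Π t : Icc a b, TangentSpace 𝓘(ℝ, E) (γ t)) = 0 := smul_zero 0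
    have e1 : (extendField (0 : Π t : Icc a b, TangentSpace 𝓘(ℝ, E) (γ t))) =
        fun t ↦ (0 : ℝ) • extendField (0 : Π t : Icc a b, TangentSpace 𝓘(ℝ, E) (γ t)) t := by
      simp only [extendField_zero, smul_zero]
    refine mem_adaptedJacobiFields_iff.2 ⟨hv, fun t ht ↦ ?_, ?_⟩
    · rw [e1, h.jacobiOperator_const_smul (uniqueDiffOn_Icc hab) hv 0 ht, zero_smul]
    · rw [← e0, jacobiInitial_smul h hab hv, zero_smul]
      exact Submodule.zero_mem _

/-- An adapted Jacobi field is sent to its initial data. -/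
def jacobiInitialData [CompleteSpace E] (F : SmoothFoliation E' E'' E M) (h : HasChristoffel D Γ)
    (hab : a < b) (hγ : ContMDiffOn 𝓘(ℝ, ℝ) 𝓘(ℝ, E) ∞ γ (Icc a b)) :
    F.jacobiSubmodule h hab hγ →ₗ[ℝ] TangentSpace 𝓘(ℝ, E) (γ a) × F.vert (γ a) where
  toFun X := (X.1 ⟨a, left_mem_Icc.2 hab.le⟩, ⟨jacobiInitial D X.1 a, X.2.2.2⟩)
  map_add' X Y := Prod.ext rfl (Subtype.ext (jacobiInitial_add h hab X.2.1 Y.2.1))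
  map_smul' c X := Prod.ext rfl (Subtype.ext (jacobiInitial_smul h hab X.2.1 c))

lemma injective_jacobiInitialData [CompleteSpace E] (h : HasChristoffel D Γ)
    (hab : a < b) (hγ : ContMDiffOn 𝓘(ℝ, ℝ) 𝓘(ℝ, E) ∞ γ (Icc a b)) :
    Function.Injective (F.jacobiInitialData h hab hγ) := by
  refine (injective_iff_map_eq_zero _).2 fun X hX ↦ Subtype.ext (funext fun t ↦ ?_)
  have h1 : extendField X.1 a = 0 :=
    (extendField_of_mem (left_mem_Icc.2 hab.le)).trans (congrArg Prod.fst hX)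
  have h2 : jacobiInitial D X.1 a = 0 := congrArg (fun z ↦ (z.2 : TangentSpace 𝓘(ℝ, E) (γ a))) hX
  have h3 := h.eq_zero_of_jacobiOperator_eq_zero hab X.2.1 X.2.2.1 h1 h2 t t.2
  rwa [extendField_of_mem t.2] at h3

/-- A Jacobi field with given initial data is supplied by a geodesic variation. -/
lemma HasAdaptedChristoffel.surjective_jacobiInitialData [CompleteSpace E]
    (h : F.HasAdaptedChristoffel D Γ) (hab : a < b) (hγ : F.IsLeafwiseGeodesic D a b γ) :
    Function.Surjective (F.jacobiInitialData h.toHasChristoffel hab hγ.smooth) := by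
  rintro ⟨u, w, hw⟩
  obtain ⟨ε, hε, f, hf, X, hX, h1, h2⟩ := h.exists_variationField hab hγ u hw
  refine ⟨⟨X, h.variationField_mem_adaptedJacobiFields hab hε hγ.smooth hf hX⟩,
    Prod.ext ?_ (Subtype.ext h2)⟩
  exact (extendField_of_mem (left_mem_Icc.2 hab.le)).symm.trans h1

/-- The adapted Jacobi fields are the variation fields of leafwise geodesic variations. -/
theorem HasAdaptedChristoffel.adaptedJacobiFields_eq (h : F.HasAdaptedChristoffel D Γ)
    (hab : a < b) (hγ : F.IsLeafwiseGeodesic D a b γ) :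
    F.adaptedJacobiFields D a b γ = {X | ∃ ε > 0, ∃ f : ℝ × ℝ → M,
      F.IsLeafwiseGeodesicVariation D a b γ ε f ∧ IsVariationField f X} := by
  have : CompleteSpace E := FiniteDimensional.complete ℝ E
  refine Subset.antisymm (fun X hX ↦ ?_) ?_
  -- The momentum of `X` at `a` is vertical, so some leafwise variation has the same initial data as
  -- `X`. By uniqueness its variation field `Y` is `X`.
  · obtain ⟨ε, hε, f, hf, Y, hY, h1, h2⟩ := h.exists_variationField hab hγ (extendField X a) hX.2.2
    have hYJ := h.variationField_mem_adaptedJacobiFields hab hε hγ.smooth hf hY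
    have e : (⟨Y, hYJ⟩ : F.jacobiSubmodule h.toHasChristoffel hab hγ.smooth) = ⟨X, hX⟩ := by
      refine injective_jacobiInitialData h.toHasChristoffel hab hγ.smooth
        (Prod.ext ?_ (Subtype.ext h2))
      have ha := left_mem_Icc.2 hab.le
      exact (extendField_of_mem ha).symm.trans (h1.trans (extendField_of_mem ha))
    have e' : Y = X := congrArg Subtype.val e
    exact ⟨ε, hε, f, hf, e' ▸ hY⟩
  · rintro X ⟨ε, hε, f, hf, hX⟩
    exact h.variationField_mem_adaptedJacobiFields hab hε hγ.smooth hf hX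

end SmoothFoliation
end

/-! ### The proposition. -/

theorem proposition5p4
    {E' : Type*} [NormedAddCommGroup E'] [NormedSpace ℝ E'] [FiniteDimensional ℝ E']
    {E'' : Type*} [NormedAddCommGroup E''] [NormedSpace ℝ E''] [FiniteDimensional ℝ E'']
    {E : Type*} [NormedAddCommGroup E] [NormedSpace ℝ E] [FiniteDimensional ℝ E]
    {M : Type*} [TopologicalSpace M] [T2Space M] [ChartedSpace E M] [IsManifold 𝓘(ℝ, E) ∞ M]
    [RiemannianBundle (fun p : M ↦ TangentSpace 𝓘(ℝ, E) p)]
    [IsContMDiffRiemannianBundle 𝓘(ℝ, E) ∞ E (fun p : M ↦ TangentSpace 𝓘(ℝ, E) p)]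
    (nabla : CovariantDerivative 𝓘(ℝ, E) E (fun p : M ↦ TangentSpace 𝓘(ℝ, E) p))
    (hnabla : IsLeviCivita nabla)
    (F : SmoothFoliation E' E'' E M) (hF : F.IsBundleLike)
    (a b : ℝ) (hab : a < b) (γ : ℝ → M)
    (hγ : F.IsLeafwiseGeodesic (F.adaptedConnection nabla) a b γ) :
    F.adaptedJacobiFields (F.adaptedConnection nabla) a b γ =
        {X | ∃ ε > 0, ∃ f : ℝ × ℝ → M,
          F.IsLeafwiseGeodesicVariation (F.adaptedConnection nabla) a b γ ε f ∧
            SmoothFoliation.IsVariationField f X} ∧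
      ∃ 𝒥 : Submodule ℝ (Π t : Icc a b, TangentSpace 𝓘(ℝ, E) (γ t)),
        (𝒥 : Set (Π t : Icc a b, TangentSpace 𝓘(ℝ, E) (γ t))) =
            F.adaptedJacobiFields (F.adaptedConnection nabla) a b γ ∧
          ∃ Φ : 𝒥 ≃ₗ[ℝ] (TangentSpace 𝓘(ℝ, E) (γ a) × F.vert (γ a)), ∀ X : 𝒥,
            (Φ X).1 = X.1 ⟨a, left_mem_Icc.2 hab.le⟩ ∧
            ((Φ X).2 : TangentSpace 𝓘(ℝ, E) (γ a)) =
              SmoothFoliation.jacobiInitial (F.adaptedConnection nabla) X.1 a := by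
  have : CompleteSpace E := FiniteDimensional.complete ℝ E
  have h := F.hasAdaptedChristoffel_adaptedConnection
    (hasChristoffel_christoffel (nabla := nabla) hnabla.smooth)
  refine ⟨h.adaptedJacobiFields_eq hab hγ, F.jacobiSubmodule h.toHasChristoffel hab hγ.smooth, rfl,
    LinearEquiv.ofBijective (F.jacobiInitialData h.toHasChristoffel hab hγ.smooth)
      ⟨SmoothFoliation.injective_jacobiInitialData h.toHasChristoffel hab hγ.smooth,
        h.surjective_jacobiInitialData hab hγ⟩, fun X ↦ ⟨rfl, rfl⟩⟩
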